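/- Let $a\ge 2$ be a real number and let $G_a\le \mathsf{GL}_2(\mathbb{R})$ be the subgroup generated by $$g_a=\begin{pmatrix} a&0\\0&1\end{pmatrix},\qquad h=\begin{pmatrix}1&1\\0&1\end{pmatrix}.$$ Then polynomial identity testing over $\mathbb{Z}$ for skew arithmetic circuits is logspace many-one reducible to the compressed word problem for $G_a$ with respect to the generators $g_a,h$. Here, an arithmetic circuit is a finite set of gates with a distinguished output gate, in which every gate has a right-hand side that is a variable, one of the constants $-1,0,1$, or of the form $B+C$ or $B\cdot C$ for gates $B,C$, such that for some linear order on the gates $B<A$ whenever $B$ occurs in the right-hand side of $A$. It is skew if for every gate with right-hand side $B\cdot C$ one of $B,C$ is an input gate, i.e. has a variable or a constant as its right-hand side. Polynomial identity testing over $\mathbb{Z}$ for skew circuits asks whether a given skew circuit evaluates to the zero polynomial in $\mathbb{Z}[x_1,x_2,\dots]$. A straight-line program over a finite alphabet $\Sigma$ is defined in the same way, with right-hand sides that are symbols from $\Sigma$ or of the form $BC$ (concatenation); it produces a single word over $\Sigma$. The compressed word problem for $G_a$ asks whether the word produced by a given straight-line program over $\{g_a,g_a^{-1},h,h^{-1}\}$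 represents the identity matrix. Circuits and straight-line programs are given as words over a finite alphabet that list the right-hand sides of all gates, with gate numbers and indices of variables in binary. Logspace many-one reducible means that there is a deterministic Turing machine with a two-way read-only input tape, a write-only output tape and finitely many work tapes, on each of which it uses $O(\log N)$ cells for inputs of length $N$, that halts on the encoding of every skew circuit $\mathcal{C}$ and outputs the encoding of a straight-line program $\mathcal{G}$ such that $\mathcal{C}$ evaluates to the zero polynomial if and only if the word produced by $\mathcal{G}$ represents the identity of $G_a$. -/

import Mathlib

/-! ### Logspace transducers -/

/-- Head movements of a Turing machine. -/
inductive HeadMove where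
  | left
  | stay
  | right

/-- New position of a head on a tape whose cells are numbered `0, 1, 2, …`
(a head on cell `0` that is told to move left stays where it is). -/
def HeadMove.apply : HeadMove → ℕ → ℕ
  | .left, p => p - 1
  | .stay, p => p
  | .right, p => p + 1

/-- What the input head sees: an endmarker or a symbol of the input word. -/
inductive InputCell (I : Type) where
  | leftEnd
  | symbol (x : I)
  | rightEnd

/-- The input tape: `leftEnd` in cell `0`, the word in cells `1, …, w.length`,
and `rightEnd` in cell `w.length + 1`. -/
def inputCell {I : Type} (w : List I) : ℕ → InputCell I
  | 0 => .leftEnd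
  | p + 1 =>
    match w[p]? with
    | some x => .symbol x
    | none => .rightEnd

/-- The effect of one step: the next state, the symbols written to the work tapes, the movements
of the work heads and of the input head, and the symbol (if any) appended to the output. -/
structure TransducerAction (State Work O : Type) (k : ℕ) where
  next : State
  write : Fin k → Work
  moveWork : Fin k → HeadMove
  moveInput : HeadMove
  emit : Option O

/-- A deterministic Turing machine with a two-way read-only input tape over the alphabet `I`,
finitely many two-way work tapes over a finite alphabet, and a one-way write-only output tape over
the alphabet `O`. The machine halts when the transition function returns `none`. -/
structure Transducer (I O : Type) where
  State : Type
  finite_state : Finite State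
  Work : Type
  finite_work : Finite Work
  blank : Work
  tapes : ℕ
  start : State
  transition : State → InputCell I → (Fin tapes → Work) →
    Option (TransducerAction State Work O tapes)

namespace Transducer

variable {I O : Type}

/-- Configurations. The work tapes have cells `0, 1, 2, …`. -/
structure Cfg (M : Transducer I O) where
  state : M.State
  inputPos : ℕ
  work : Fin M.tapes → ℕ → M.Work
  workPos : Fin M.tapes → ℕ
  output : List O

/-- The initial configuration: all work tapes are blank, all heads are on cell `0`. -/
def init (M : Transducer I O) : M.Cfg where
  state := M.start
  inputPos := 0
  work := fun _ _ => M.blank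
  workPos := fun _ => 0
  output := []

/-- One step on the input word `w`; `none` means that the machine has halted.
The input head cannot leave the part of the input tape between the endmarkers. -/
def step (M : Transducer I O) (w : List I) (c : M.Cfg) : Option M.Cfg :=
  (M.transition c.state (inputCell w c.inputPos) (fun i => c.work i (c.workPos i))).map fun t =>
    { state := t.next
      inputPos := min (t.moveInput.apply c.inputPos) (w.length + 1)
      work := fun i => Function.update (c.work i) (c.workPos i) (t.write i)
      workPos := fun i => (t.moveWork i).apply (c.workPos i)
      output := c.output ++ t.emit.toList }

/-- The configuration `c` occurs in the computation on `w`. -/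
def Reaches (M : Transducer I O) (w : List I) (c : M.Cfg) : Prop :=
  Relation.ReflTransGen (fun c₁ c₂ => M.step w c₁ = some c₂) M.init c

/-- On input `w` the machine halts with output `v`, and on each work tape it only visits
the first `s` cells. -/
def OutputsInSpace (M : Transducer I O) (w : List I) (v : List O) (s : ℕ) : Prop :=
  (∃ c, M.Reaches w c ∧ M.step w c = none ∧ c.output = v) ∧
    ∀ c, M.Reaches w c → ∀ i, c.workPos i < s

end Transducer

/-- The function `f` is computed, with respect to the given encodings of its arguments and values,
by a transducer in space `O(log n)`, where `n` is the length of the encoding of the argument. -/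
def LogspaceComputable {α β I O : Type} (encα : α → List I) (encβ : β → List O) (f : α → β) :
    Prop :=
  ∃ (M : Transducer I O) (c : ℕ), ∀ x : α,
    M.OutputsInSpace (encα x) (encβ (f x)) (c * (Nat.log 2 (encα x).length + 1))

/-- A decision problem: a type of instances, an encoding of the instances by words over a finite
alphabet, and the set of instances for which the answer is "yes". -/
structure DecisionProblem where
  Instance : Type
  Symbol : Type
  finite_symbol : Finite Symbol
  encode : Instance → List Symbol
  encode_injective : Function.Injective encode
  Yes : Instance → Prop

/-- Logspace many-one reducibility. -/
def LogspaceReducible (P Q : DecisionProblem) : Prop :=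
  ∃ f : P.Instance → Q.Instance,
    LogspaceComputable P.encode Q.encode f ∧ ∀ x, P.Yes x ↔ Q.Yes (f x)

/-! ### Words that describe circuits -/

/-- The alphabet for describing circuits whose gates carry labels from `L`. -/
inductive Token (L : Type) where
  | bit (b : Bool)
  | comma
  | label (l : L)
  deriving DecidableEq

/-- The word for one gate: its label, followed by its arguments, which are natural numbers in
binary (least significant bit first), each preceded by a comma. -/
def gateWord {L : Type} (g : L × List ℕ) : List (Token L) :=
  .label g.1 :: g.2.flatMap fun k : ℕ => .comma :: (Nat.bits k).map .bit

/-- The word for a circuit: the number of the output gate in binary, followed by the words for all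
gates in the order of their numbers. -/
def circuitWord {L : Type} (out : ℕ) (gates : List (L × List ℕ)) : List (Token L) :=
  out.bits.map .bit ++ gates.flatMap gateWord

theorem Token.finite {L : Type} [Finite L] : Finite (Token L) := by
  refine Finite.of_injective
    (fun t : Token L => match t with
      | .bit b => (Sum.inl (some b) : Option Bool ⊕ L)
      | .comma => Sum.inl none
      | .label l => Sum.inr l) ?_
  intro s t h
  cases s <;> cases t <;> simp_all

theorem natBits_injective : Function.Injective Nat.bits := by
  intro m n h
  apply Nat.eq_of_testBit_eq
  intro i
  rw [Nat.testBit_eq_inth, Nat.testBit_eq_inth, h]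

/-- A maximal block of bits can be read off a word. -/
theorem bits_append_inj {L : Type} {u v : List Bool} {x y : List (Token L)}
    (hx : ∀ b, x.head? ≠ some (.bit b)) (hy : ∀ b, y.head? ≠ some (.bit b))
    (h : u.map Token.bit ++ x = v.map Token.bit ++ y) : u = v ∧ x = y := by
  induction u generalizing v with
  | nil =>
    cases v with
    | nil => exact ⟨rfl, by simpa using h⟩
    | cons b v => exact absurd (by simp at h; simp [h]) (hx b)
  | cons a u ih =>
    cases v with
    | nil => exact absurd (by simp at h; simp [← h]) (hy a)
    | cons b v =>
      simp only [List.map_cons, List.cons_append, List.cons.injEq, Token.bit.injEq] at h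
      obtain ⟨h₁, h₂⟩ := ih h.2
      exact ⟨by rw [h.1, h₁], h₂⟩

theorem head_gatesWord {L : Type} (gs : List (L × List ℕ)) :
    (∀ b, (gs.flatMap gateWord).head? ≠ some (.bit b)) ∧
      (gs.flatMap gateWord).head? ≠ some .comma := by
  cases gs <;> simp [gateWord]

theorem args_append_inj {L : Type} {u v : List ℕ} {x y : List (Token L)}
    (hx : ∀ b, x.head? ≠ some (.bit b)) (hx' : x.head? ≠ some .comma)
    (hy : ∀ b, y.head? ≠ some (.bit b)) (hy' : y.head? ≠ some .comma)
    (h : (u.flatMap fun k : ℕ => Token.comma :: (Nat.bits k).map .bit) ++ x =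
      (v.flatMap fun k : ℕ => Token.comma :: (Nat.bits k).map .bit) ++ y) : u = v ∧ x = y := by
  induction u generalizing v with
  | nil =>
    cases v with
    | nil => exact ⟨rfl, by simpa using h⟩
    | cons b v => exact absurd (by simp at h; simp [h]) hx'
  | cons a u ih =>
    cases v with
    | nil => exact absurd (by simp at h; simp [← h]) hy'
    | cons b v =>
      simp only [List.flatMap_cons, List.cons_append, List.append_assoc, List.cons.injEq,
        true_and] at h
      have key : ∀ (w : List ℕ) (z : List (Token L)), (∀ b, z.head? ≠ some (.bit b)) →
          ∀ b, ((w.flatMap fun k : ℕ => Token.comma :: (Nat.bits k).map .bit) ++ z).head? ≠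
            some (.bit b) := by
        intro w z hz b
        cases w with
        | nil => simpa using hz b
        | cons => simp
      obtain ⟨h₁, h₂⟩ := bits_append_inj (key u x hx) (key v y hy) h
      obtain ⟨h₃, h₄⟩ := ih h₂
      exact ⟨by rw [natBits_injective h₁, h₃], h₄⟩

theorem gatesWord_injective {L : Type} {gs gs' : List (L × List ℕ)}
    (h : gs.flatMap gateWord = gs'.flatMap gateWord) : gs = gs' := by
  induction gs generalizing gs' with
  | nil =>
    cases gs' with
    | nil => rfl
    | cons => simp [gateWord] at h
  | cons g gs ih =>
    cases gs' with
    | nil => simp [gateWord] at h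
    | cons g' gs' =>
      simp only [List.flatMap_cons, gateWord, List.cons_append, List.cons.injEq,
        Token.label.injEq] at h
      obtain ⟨h₁, h₂⟩ := args_append_inj (head_gatesWord gs).1 (head_gatesWord gs).2
        (head_gatesWord gs').1 (head_gatesWord gs').2 h.2
      rw [ih h₂, Prod.ext h.1 h₁]

theorem circuitWord_inj {L : Type} {o o' : ℕ} {gs gs' : List (L × List ℕ)}
    (h : circuitWord o gs = circuitWord o' gs') : o = o' ∧ gs = gs' := by
  obtain ⟨h₁, h₂⟩ := bits_append_inj (head_gatesWord gs).1 (head_gatesWord gs').1 h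
  exact ⟨natBits_injective h₁, gatesWord_injective h₂⟩

/-- If `occurs B A` implies `B < A` for some linear order on a finite set, then `occurs` is
well-founded. -/
theorem wellFounded_of_linearOrder {n : ℕ} {occurs : Fin n → Fin n → Prop}
    (h : ∃ lt : Fin n → Fin n → Prop, IsStrictTotalOrder (Fin n) lt ∧
      ∀ A B, occurs B A → lt B A) : WellFounded occurs := by
  obtain ⟨lt, hlt, hsub⟩ := h
  exact Subrelation.wf (fun {B A} hBA => hsub A B hBA) (Finite.wellFounded_of_trans_of_irrefl lt)

/-! ### Arithmetic circuits and polynomial identity testing -/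

/-- Right-hand sides of gates of an arithmetic circuit with set of gates `V`. -/
inductive ArithRhs (V : Type) where
  | var (i : ℕ)
  | negOne
  | zero
  | one
  | add (B C : V)
  | mul (B C : V)

namespace ArithRhs

/-- The gates that occur in a right-hand side. -/
def gates {V : Type} : ArithRhs V → List V
  | .add B C => [B, C]
  | .mul B C => [B, C]
  | _ => []

/-- The right-hand sides of input gates, i.e. variables and constants. -/
def IsInput {V : Type} : ArithRhs V → Prop
  | .add _ _ => False
  | .mul _ _ => False
  | _ => True

end ArithRhs

/-- An arithmetic circuit over the variables `x_0, x_1, x_2, …`. Its gates are numbered by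
`0, …, size - 1`; the linear order on the gates need not be the order of these numbers. -/
structure ArithCircuit where
  size : ℕ
  out : Fin size
  rhs : Fin size → ArithRhs (Fin size)
  acyclic : ∃ lt : Fin size → Fin size → Prop, IsStrictTotalOrder (Fin size) lt ∧
    ∀ A B, B ∈ (rhs A).gates → lt B A

namespace ArithCircuit

theorem wf (C : ArithCircuit) : WellFounded fun B A => B ∈ (C.rhs A).gates :=
  wellFounded_of_linearOrder C.acyclic

/-- The polynomial to which a gate evaluates. -/
noncomputable def gateVal (R : Type) [CommRing R] (C : ArithCircuit) (A : Fin C.size) :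
    MvPolynomial ℕ R :=
  match h : C.rhs A with
  | .var i => MvPolynomial.X i
  | .negOne => -1
  | .zero => 0
  | .one => 1
  | .add B D => C.gateVal R B + C.gateVal R D
  | .mul B D => C.gateVal R B * C.gateVal R D
termination_by C.wf.wrap A
decreasing_by
  all_goals
    change _ ∈ (C.rhs A).gates
    simp only [h, ArithRhs.gates, List.mem_cons, List.not_mem_nil, or_false]
    first | exact Or.inl rfl | exact Or.inr rfl

/-- The polynomial to which the circuit evaluates. -/
noncomputable def val (R : Type) [CommRing R] (C : ArithCircuit) : MvPolynomial ℕ R :=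
  C.gateVal R C.out

/-- In a skew circuit every multiplication gate has an argument that is an input gate. -/
def IsSkew (C : ArithCircuit) : Prop :=
  ∀ A B D, C.rhs A = .mul B D → (C.rhs B).IsInput ∨ (C.rhs D).IsInput

end ArithCircuit

/-- Gate labels in the encoding of arithmetic circuits. -/
inductive ArithLabel where
  | var
  | negOne
  | zero
  | one
  | add
  | mul
  deriving DecidableEq

instance : Fintype ArithLabel :=
  ⟨{.var, .negOne, .zero, .one, .add, .mul}, fun x => by cases x <;> decide⟩

/-- Label and numerical arguments of a gate. The index of a variable is written in binary. -/
def ArithRhs.code {n : ℕ} : ArithRhs (Fin n) → ArithLabel × List ℕ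
  | .var i => (.var, [i])
  | .negOne => (.negOne, [])
  | .zero => (.zero, [])
  | .one => (.one, [])
  | .add B C => (.add, [B, C])
  | .mul B C => (.mul, [B, C])

theorem ArithRhs.code_injective {n : ℕ} :
    Function.Injective (ArithRhs.code : ArithRhs (Fin n) → _) := by
  intro r s h
  cases r <;> cases s <;> simp_all [ArithRhs.code, Fin.ext_iff]

/-- The word that describes an arithmetic circuit. -/
def ArithCircuit.encode (C : ArithCircuit) : List (Token ArithLabel) :=
  circuitWord C.out (List.ofFn fun A => (C.rhs A).code)

theorem ArithCircuit.encode_injective : Function.Injective ArithCircuit.encode := by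
  rintro ⟨n, S, r, hr⟩ ⟨n', S', r', hr'⟩ h
  obtain ⟨h₁, h₂⟩ := circuitWord_inj h
  dsimp only at h₁ h₂
  obtain rfl : n = n' := by simpa using congrArg List.length h₂
  have h₃ := List.ofFn_injective h₂
  obtain rfl : r = r' := funext fun A => ArithRhs.code_injective (congrFun h₃ A)
  obtain rfl : S = S' := Fin.ext h₁
  rfl

/-- Polynomial identity testing over `R` for skew arithmetic circuits: given a skew circuit, does
it evaluate to the zero polynomial? -/
noncomputable def skewPIT (R : Type) [CommRing R] : DecisionProblem where
  Instance := {C : ArithCircuit // C.IsSkew}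
  Symbol := Token ArithLabel
  finite_symbol := Token.finite
  encode := fun C => C.1.encode
  encode_injective := ArithCircuit.encode_injective.comp Subtype.val_injective
  Yes := fun C => C.1.val R = 0

/-! ### Straight-line programs and the compressed word problem -/

/-- Right-hand sides of a straight-line program over the alphabet `σ` with set of variables `V`. -/
inductive SLPRhs (σ V : Type) where
  | sym (a : σ)
  | cat (B C : V)

/-- The variables that occur in a right-hand side. -/
def SLPRhs.gates {σ V : Type} : SLPRhs σ V → List V
  | .sym _ => []
  | .cat B C => [B, C]

/-- A straight-line program over the alphabet `σ` with variables numbered by `0, …, size - 1`; the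
linear order on the variables need not be the order of these numbers. -/
structure SLP (σ : Type) where
  size : ℕ
  out : Fin size
  rhs : Fin size → SLPRhs σ (Fin size)
  acyclic : ∃ lt : Fin size → Fin size → Prop, IsStrictTotalOrder (Fin size) lt ∧
    ∀ A B, B ∈ (rhs A).gates → lt B A

namespace SLP

variable {σ : Type}

theorem wf (P : SLP σ) : WellFounded fun B A => B ∈ (P.rhs A).gates :=
  wellFounded_of_linearOrder P.acyclic

/-- The word derived from a variable. -/
def gateVal (P : SLP σ) (A : Fin P.size) : List σ :=
  match _h : P.rhs A with
  | .sym a => [a]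
  | .cat B C => P.gateVal B ++ P.gateVal C
termination_by P.wf.wrap A
decreasing_by
  all_goals
    change _ ∈ (P.rhs A).gates
    simp only [_h, SLPRhs.gates, List.mem_cons, List.not_mem_nil, or_false]
    first | exact Or.inl rfl | exact Or.inr rfl

/-- The word produced by the program. -/
def val (P : SLP σ) : List σ :=
  P.gateVal P.out

end SLP

/-- Gate labels in the encoding of straight-line programs. -/
inductive SLPLabel (σ : Type) where
  | sym (a : σ)
  | cat

theorem SLPLabel.finite {σ : Type} [Finite σ] : Finite (SLPLabel σ) := by
  refine Finite.of_injective
    (fun t : SLPLabel σ => match t with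
      | .sym a => some a
      | .cat => none) ?_
  intro s t h
  cases s <;> cases t <;> simp_all

/-- Label and arguments of a variable. -/
def SLPRhs.code {σ : Type} {n : ℕ} : SLPRhs σ (Fin n) → SLPLabel σ × List ℕ
  | .sym a => (.sym a, [])
  | .cat B C => (.cat, [B, C])

theorem SLPRhs.code_injective {σ : Type} {n : ℕ} :
    Function.Injective (SLPRhs.code : SLPRhs σ (Fin n) → _) := by
  intro r s h
  cases r <;> cases s <;> simp_all [SLPRhs.code, Fin.ext_iff]

/-- The word that describes a straight-line program. -/
def SLP.encode {σ : Type} (P : SLP σ) : List (Token (SLPLabel σ)) :=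
  circuitWord P.out (List.ofFn fun A => (P.rhs A).code)

theorem SLP.encode_injective {σ : Type} :
    Function.Injective (SLP.encode : SLP σ → List (Token (SLPLabel σ))) := by
  rintro ⟨n, S, r, hr⟩ ⟨n', S', r', hr'⟩ h
  obtain ⟨h₁, h₂⟩ := circuitWord_inj h
  dsimp only at h₁ h₂
  obtain rfl : n = n' := by simpa using congrArg List.length h₂
  have h₃ := List.ofFn_injective h₂
  obtain rfl : r = r' := funext fun A => SLPRhs.code_injective (congrFun h₃ A)
  obtain rfl : S = S' := Fin.ext h₁
  rfl

/-- The group element represented by a word over the generators and their inverses: the letter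
`(i, true)` stands for the generator `gen i`, the letter `(i, false)` for its inverse. -/
def evalWord {G ι : Type} [Group G] (gen : ι → G) (w : List (ι × Bool)) : G :=
  (w.map fun p => if p.2 then gen p.1 else (gen p.1)⁻¹).prod

/-- The compressed word problem of a group with a given finite generating family: given a
straight-line program over the generators and their inverses, does the word that it produces
represent the identity of the group? -/
def compressedWordProblem {G ι : Type} [Group G] [Finite ι] (gen : ι → G)
    (_hgen : Subgroup.closure (Set.range gen) = ⊤) : DecisionProblem where
  Instance := SLP (ι × Bool)
  Symbol := Token (SLPLabel (ι × Bool))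
  finite_symbol :=
    have : Finite (SLPLabel (ι × Bool)) := SLPLabel.finite
    Token.finite
  encode := SLP.encode
  encode_injective := SLP.encode_injective
  Yes := fun P => evalWord gen P.val = 1

/-! ### The groups `G_a` -/

/-- The two generators of `G_a`. -/
inductive GaLetter where
  | g
  | h
  deriving DecidableEq

instance : Fintype GaLetter :=
  ⟨{.g, .h}, fun x => by cases x <;> decide⟩

/-- The matrices `g_a = diag(a, 1)` and `h = [[1, 1], [0, 1]]`. -/
noncomputable def gaMatrix (a : ℝ) (ha : 2 ≤ a) : GaLetter → GL (Fin 2) ℝ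
  | .g => Matrix.GeneralLinearGroup.mkOfDetNeZero !![a, 0; 0, 1]
      (by rw [Matrix.det_fin_two_of]; linarith)
  | .h => Matrix.GeneralLinearGroup.mkOfDetNeZero !![1, 1; 0, 1]
      (by rw [Matrix.det_fin_two_of]; norm_num)

/-- The subgroup `G_a` of `GL_2(ℝ)` generated by `g_a` and `h`. -/
noncomputable def groupGa (a : ℝ) (ha : 2 ≤ a) : Subgroup (GL (Fin 2) ℝ) :=
  Subgroup.closure {gaMatrix a ha .g, gaMatrix a ha .h}

/-- `g_a` and `h` as elements of `G_a`. -/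
noncomputable def gaGen (a : ℝ) (ha : 2 ≤ a) (x : GaLetter) : groupGa a ha :=
  ⟨gaMatrix a ha x, Subgroup.subset_closure (by cases x <;> simp)⟩

theorem gaGen_generates (a : ℝ) (ha : 2 ≤ a) :
    Subgroup.closure (Set.range (gaGen a ha)) = ⊤ := by
  have h : Set.range (gaGen a ha) =
      ((↑) : groupGa a ha → GL (Fin 2) ℝ) ⁻¹' {gaMatrix a ha .g, gaMatrix a ha .h} := by
    ext y
    constructor
    · rintro ⟨x, rfl⟩
      cases x <;> simp [gaGen]
    · rintro (hy | hy)
      · exact ⟨.g, Subtype.ext hy.symm⟩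
      · exact ⟨.h, Subtype.ext hy.symm⟩
  rw [h]
  exact Subgroup.closure_closure_coe_preimage

/-!
Conjugation by `g` acts on the powers of `h` as multiplication of the exponent by `a`: with
`h ^ v` read as the matrix `[[1, v], [0, 1]]` for real `v`, one has `g ^ e * h ^ v * g ^ (-e) =
h ^ (a ^ e * v)`, while products of powers of `h` add the exponents. A straight-line program can
therefore follow a skew circuit gate by gate, once every variable `x_k` is replaced by a power
`a ^ (2 ^ t)`. For a gate with value `v` it has variables that produce words for `h ^ v` and for
`h ^ (-v)`. An addition is a concatenation, and a multiplication by an input gate is a conjugation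
by `g ^ (2 ^ t)` for a variable, and the choice of the word for `v`, for `-v`, or of the identity,
for a constant. The words for `g ^ (2 ^ t)` and its inverse come from a table that is filled by
repeated squaring. This is `CircuitWord.IsEvaluation.valueRef_eq`, and by
`CircuitWord.evalWord_slp_eq_one_iff` the program produces the identity if and only if the circuit
vanishes at the chosen powers of `a`.

The powers are those of a Kronecker substitution. Let `n` be the number of gates. Because the
circuit is skew, its polynomial has degree at most `n` in each variable, and the absolute values of
its coefficients have sum at most `2 ^ n` (`CircuitWord.gateVal_bounds`). If the variable that first
occurs at gate `j` is replaced by `a ^ (2 ^ ((n + 1) * (j + 1)))`, then a monomial becomes a power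
of `a` in whose exponent the degrees of the variables are digits in base `2 ^ (n + 1)`, and the
lowest digit is zero. So the exponents for distinct monomials differ by at least `2 ^ (n + 1)`, and
the largest power outweighs all other terms since `a ≥ 2`
(`MvPolynomial.sum_coeff_mul_pow_ne_zero`). Hence a nonzero polynomial stays nonzero.

For the space bound, the numbers that occur in the construction (positions in the input word, gate
numbers, references of the program) are treated as functions of the input word and of parameters.
`LogspaceFun` says that such a function is polynomially bounded and that a machine, composed from
the fragments `Frag`, computes it on binary counters of logarithmic length. The class is closed
under composition, bounded recursion and bounded search, which suffices for reading the circuit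
from its word and for the right-hand sides of the program; `LogspaceOutput` is the analogous notion
for functions that produce an output word, and `LogspaceOutput.logspaceComputable` turns it into a
transducer.
-/

/-! ### Fragments of machines -/

/-- Symbols on the work tapes: the marker in cell `0`, binary digits, and the blank. -/
inductive WorkSym where
  | blank
  | mark
  | bit (b : Bool)
  deriving DecidableEq

theorem WorkSym.finite : Finite WorkSym := by
  refine Finite.of_injective
    (fun t : WorkSym => match t with
      | .blank => (none : Option (Option Bool))
      | .mark => some none
      | .bit b => some (some b)) ?_
  intro s t h
  cases s <;> cases t <;> simp_all

/-- A configuration of a machine without its internal state. There is a work tape for every natural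
number; a machine uses finitely many of them. -/
structure Conf (O : Type) where
  pos : ℕ
  work : ℕ → ℕ → WorkSym
  hd : ℕ → ℕ
  out : List O

/-- The effect of one step in which at most one work tape is touched; `res` says how the computation
continues. -/
structure Act (O X : Type) where
  res : X
  write : WorkSym
  moveWork : HeadMove
  moveInput : HeadMove
  emit : Option O

/-- The configuration after a step that touches the work tape `r`. -/
def Act.apply {I O X : Type} (a : Act O X) (w : List I) (r : ℕ) (c : Conf O) : Conf O where
  pos := min (a.moveInput.apply c.pos) (w.length + 1)
  work := Function.update c.work r (Function.update (c.work r) (c.hd r) a.write)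
  hd := Function.update c.hd r (a.moveWork.apply (c.hd r))
  out := c.out ++ a.emit.toList

/-- A program fragment: a machine that touches one work tape per step, and that leaves its set `Q`
of states with a result in `X`. -/
structure Frag (I O X : Type) where
  Q : Type
  finite_Q : Finite Q
  start : Q
  tape : Q → ℕ
  act : Q → InputCell I → WorkSym → Act O (Q ⊕ X)

namespace Frag

variable {I O X Y : Type}

/-- The action of a fragment in state `q` and configuration `c`. -/
def actAt (F : Frag I O X) (w : List I) (q : F.Q) (c : Conf O) : Act O (F.Q ⊕ X) :=
  F.act q (inputCell w c.pos) (c.work (F.tape q) (c.hd (F.tape q)))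

/-- `F.Steps w s z c x c'`: from state `z` and configuration `c`, the fragment `F` reaches the
result `x` and the configuration `c'` on the input word `w`, and all work heads stay in the first
`s` cells. -/
inductive Steps (F : Frag I O X) (w : List I) (s : ℕ) :
    F.Q ⊕ X → Conf O → X → Conf O → Prop
  | done (x : X) (c : Conf O) (h : ∀ i, c.hd i < s) : Steps F w s (.inr x) c x c
  | step (q : F.Q) (c : Conf O) (x : X) (c' : Conf O) (h : ∀ i, c.hd i < s)
      (hs : Steps F w s (F.actAt w q c).res ((F.actAt w q c).apply w (F.tape q) c) x c') :
      Steps F w s (.inl q) c x c'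

/-- The fragment, started in configuration `c`, ends with result `x` in configuration `c'`, and all
work heads stay in the first `s` cells. -/
def Runs (F : Frag I O X) (w : List I) (s : ℕ) (c : Conf O) (x : X) (c' : Conf O) : Prop :=
  F.Steps w s (.inl F.start) c x c'

/-- One step, with the result determined by what the heads see. -/
def atom (r : ℕ) (f : InputCell I → WorkSym → Act O X) : Frag I O X where
  Q := Unit
  finite_Q := inferInstance
  start := ()
  tape := fun _ => r
  act := fun _ x a =>
    let t := f x a
    ⟨.inr t.res, t.write, t.moveWork, t.moveInput, t.emit⟩

theorem runs_atom {r : ℕ} {f : InputCell I → WorkSym → Act O X} {w : List I} {s : ℕ} {c : Conf O}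
    (h : ∀ i, c.hd i < s)
    (h' : (f (inputCell w c.pos) (c.work r (c.hd r))).moveWork.apply (c.hd r) < s) :
    (atom r f).Runs w s c (f (inputCell w c.pos) (c.work r (c.hd r))).res
      ((f (inputCell w c.pos) (c.work r (c.hd r))).apply w r c) := by
  refine Steps.step _ _ _ _ h (Steps.done _ _ fun i => ?_)
  by_cases hi : i = r
  · subst hi; simpa [Act.apply, actAt, atom] using h'
  · simpa [Act.apply, actAt, atom, hi] using h i

/-- Sequential composition; the second fragment depends on the result of the first one. -/
def bind [Finite X] (F : Frag I O X) (G : X → Frag I O Y) : Frag I O Y where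
  Q := F.Q ⊕ Σ x, (G x).Q
  finite_Q := by
    have := F.finite_Q
    have := fun x => (G x).finite_Q
    infer_instance
  start := .inl F.start
  tape := Sum.elim F.tape fun q => (G q.1).tape q.2
  act := fun q x a => match q with
    | .inl q =>
      let t := F.act q x a
      ⟨.inl (t.res.elim .inl fun y => .inr ⟨y, (G y).start⟩), t.write, t.moveWork, t.moveInput,
        t.emit⟩
    | .inr ⟨y, q⟩ =>
      let t := (G y).act q x a
      ⟨t.res.elim (fun q => .inl (.inr ⟨y, q⟩)) .inr, t.write, t.moveWork, t.moveInput, t.emit⟩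

theorem Runs.bind [Finite X] {F : Frag I O X} {G : X → Frag I O Y} {w : List I} {s : ℕ}
    {c c₁ c₂ : Conf O} {x : X} {y : Y} (hF : F.Runs w s c x c₁) (hG : (G x).Runs w s c₁ y c₂) :
    (F.bind G).Runs w s c y c₂ := by
  have h₂ : ∀ z c, (G x).Steps w s z c y c₂ →
      (F.bind G).Steps w s (z.elim (fun q => .inl (.inr ⟨x, q⟩)) .inr) c y c₂ := by
    intro z c h
    induction h with
    | done y c h => exact Steps.done _ _ h
    | step q c y c' h _ ih => exact Steps.step _ _ _ _ h (by exact ih hG)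
  have h₁ : ∀ z c, F.Steps w s z c x c₁ →
      (F.bind G).Steps w s (.inl (z.elim .inl fun y => .inr ⟨y, (G y).start⟩)) c y c₂ := by
    intro z c h
    clear hF
    induction h with
    | done x c h => exact h₂ _ _ hG
    | step q c x c' h _ ih => exact Steps.step _ _ _ _ h (ih hG h₂)
  exact h₁ _ _ hF

/-- Repetition until the result is of the form `some x`. -/
def loop (F : Frag I O (Option X)) : Frag I O X where
  Q := F.Q
  finite_Q := F.finite_Q
  start := F.start
  tape := F.tape
  act := fun q x a =>
    let t := F.act q x a
    ⟨t.res.elim .inl fun y => y.elim (.inl F.start) .inr, t.write, t.moveWork, t.moveInput, t.emit⟩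

theorem Steps.loop_aux {F : Frag I O (Option X)} {w : List I} {s : ℕ} {z} {c c₁ c₂ : Conf O}
    {o : Option X} {x : X} (h : F.Steps w s z c o c₁)
    (h' : F.loop.Steps w s (o.elim (.inl F.start) .inr) c₁ x c₂) :
    F.loop.Steps w s (z.elim .inl fun y => y.elim (.inl F.start) .inr) c x c₂ := by
  induction h with
  | done o c h => exact h'
  | step q c o c' h _ ih => exact Steps.step _ _ _ _ h (ih h')

theorem Runs.loop_some {F : Frag I O (Option X)} {w : List I} {s : ℕ} {c c₁ : Conf O} {x : X}
    (h : F.Runs w s c (some x) c₁) (hs : ∀ i, c₁.hd i < s) : F.loop.Runs w s c x c₁ :=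
  Steps.loop_aux h (Steps.done _ _ hs)

theorem Runs.loop_none {F : Frag I O (Option X)} {w : List I} {s : ℕ} {c c₁ c₂ : Conf O} {x : X}
    (h : F.Runs w s c none c₁) (h' : F.loop.Runs w s c₁ x c₂) : F.loop.Runs w s c x c₂ :=
  Steps.loop_aux h h'

theorem Runs.space {F : Frag I O X} {w : List I} {s : ℕ} {c c₁ : Conf O} {x : X}
    (h : F.Runs w s c x c₁) : ∀ i, c₁.hd i < s := by
  unfold Runs at h
  generalize Sum.inl F.start = z at h
  induction h <;> assumption

/-! ### Fragments as transducers -/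

/-- The initial configuration. -/
def initConf (O : Type) : Conf O := ⟨0, fun _ _ => .blank, fun _ => 0, []⟩

/-- A number of work tapes that is sufficient for a fragment. -/
theorem exists_tapes (F : Frag I O X) : ∃ k, ∀ q, F.tape q < k := by
  have := F.finite_Q
  obtain ⟨k, hk⟩ := (Set.finite_range F.tape).bddAbove
  exact ⟨k + 1, fun q => Nat.lt_succ_of_le (hk ⟨q, rfl⟩)⟩

/-- The transducer with `k` work tapes that runs a fragment. -/
def toTransducer (F : Frag I O Unit) (k : ℕ) (hk : ∀ q, F.tape q < k) : Transducer I O where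
  State := F.Q ⊕ Unit
  finite_state := by have := F.finite_Q; infer_instance
  Work := WorkSym
  finite_work := WorkSym.finite
  blank := .blank
  tapes := k
  start := .inl F.start
  transition := fun z x a => match z with
    | .inl q =>
      let t := F.act q x (a ⟨F.tape q, hk q⟩)
      some ⟨t.res, Function.update a ⟨F.tape q, hk q⟩ t.write,
        Function.update (fun _ => .stay) ⟨F.tape q, hk q⟩ t.moveWork, t.moveInput, t.emit⟩
    | .inr _ => none

/-- The configuration of the transducer that corresponds to a configuration of the fragment. -/
def toCfg (F : Frag I O Unit) (k : ℕ) (hk : ∀ q, F.tape q < k) (z : F.Q ⊕ Unit) (c : Conf O) :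
    (F.toTransducer k hk).Cfg where
  state := z
  inputPos := c.pos
  work := fun i => c.work i.1
  workPos := fun i => c.hd i.1
  output := c.out

theorem step_toCfg_inl (F : Frag I O Unit) (k : ℕ) (hk : ∀ q, F.tape q < k) (w : List I) (q : F.Q)
    (c : Conf O) : (F.toTransducer k hk).step w (F.toCfg k hk (.inl q) c) =
      some (F.toCfg k hk (F.actAt w q c).res ((F.actAt w q c).apply w (F.tape q) c)) := by
  have key : ∀ i : Fin k, i ≠ ⟨F.tape q, hk q⟩ → i.1 ≠ F.tape q :=
    fun i h h' => h (Fin.ext h')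
  simp only [Transducer.step, toTransducer, toCfg, Option.map_some, Option.some.injEq,
    Transducer.Cfg.mk.injEq, Act.apply, actAt, true_and, and_true]
  refine ⟨?_, ?_⟩
  · funext i
    by_cases h : i = ⟨F.tape q, hk q⟩
    · subst h; simp
    · simp [h, key i h]
  · funext i
    by_cases h : i = ⟨F.tape q, hk q⟩
    · subst h; simp
    · simp [h, key i h, HeadMove.apply]

theorem Runs.outputsInSpace {F : Frag I O Unit} {k : ℕ} (hk : ∀ q, F.tape q < k) {w : List I}
    {s : ℕ} {c : Conf O} (h : F.Runs w s (initConf O) () c) :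
    (F.toTransducer k hk).OutputsInSpace w c.out s := by
  have key : ∀ z c₀ x c, F.Steps w s z c₀ x c →
      (∃ d, Relation.ReflTransGen (fun c₁ c₂ => (F.toTransducer k hk).step w c₁ = some c₂)
        (F.toCfg k hk z c₀) d ∧ (F.toTransducer k hk).step w d = none ∧ d.output = c.out) ∧
      ∀ d, Relation.ReflTransGen (fun c₁ c₂ => (F.toTransducer k hk).step w c₁ = some c₂)
        (F.toCfg k hk z c₀) d → ∀ i, d.workPos i < s := by
    intro z c₀ x c h
    induction h with
    | done x c h =>
      refine ⟨⟨_, .refl, rfl, rfl⟩, fun d hd i => ?_⟩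
      rcases Relation.ReflTransGen.cases_head hd with rfl | ⟨e, he, -⟩
      · exact h i.1
      · exact absurd he (by simp [Transducer.step, toTransducer, toCfg])
    | step q c x c' h _ ih =>
      obtain ⟨⟨d, hd₁, hd₂⟩, ih⟩ := ih
      refine ⟨⟨d, hd₁.head (step_toCfg_inl F k hk w q c), hd₂⟩, fun d hd i => ?_⟩
      rcases Relation.ReflTransGen.cases_head hd with rfl | ⟨e, he, hd⟩
      · exact h i.1
      · rw [step_toCfg_inl, Option.some.injEq] at he
        exact ih d (he ▸ hd) i
  exact key _ _ _ _ h

end Frag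

/-! ### Binary counters on work tapes -/

/-- The cells of a tape from cell `p` on hold the digits `l`, followed by a blank. -/
def HoldsBits (T : ℕ → WorkSym) : ℕ → List Bool → Prop
  | p, [] => T p = .blank
  | p, b :: l => T p = .bit b ∧ HoldsBits T (p + 1) l

theorem HoldsBits.nil_iff {T : ℕ → WorkSym} {p : ℕ} : HoldsBits T p [] ↔ T p = .blank := Iff.rfl

/-- A tape holds the number `v`: the marker in cell `0`, then the binary digits of `v`, least
significant digit first, then a blank. The cells after this blank are arbitrary. -/
def HoldsNat (T : ℕ → WorkSym) (v : ℕ) : Prop :=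
  T 0 = .mark ∧ HoldsBits T 1 v.bits

/-- Increment of a binary number with the least significant digit first. -/
def incBits : List Bool → List Bool
  | [] => [true]
  | false :: l => true :: l
  | true :: l => false :: incBits l

theorem incBits_bits (v : ℕ) : incBits v.bits = (v + 1).bits := by
  induction v using Nat.binaryRec' with
  | zero => simp [incBits]
  | bit b n h ih =>
    rw [Nat.bits_append_bit n b h]
    cases b
    · have : n ≠ 0 := fun h0 => by simpa using h h0
      simp [incBits, Nat.bit, Nat.bit1_bits]
    · simp only [incBits, ih, Nat.bit, cond_true]
      rw [show 2 * n + 1 + 1 = 2 * (n + 1) by ring, Nat.bit0_bits _ (Nat.succ_ne_zero n)]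

theorem length_bits_le {v m : ℕ} (h : v < 2 ^ m) : v.bits.length ≤ m := by
  rw [Nat.size_eq_bits_len]
  exact Nat.size_le.2 h

theorem HoldsBits.congr {T T' : ℕ → WorkSym} {p : ℕ} {l : List Bool} (h : HoldsBits T p l)
    (h' : ∀ j, p ≤ j → T' j = T j) : HoldsBits T' p l := by
  induction l generalizing p with
  | nil => exact (h' p le_rfl).trans h
  | cons b l ih => exact ⟨(h' p le_rfl).trans h.1, ih h.2 fun j hj => h' j (by omega)⟩

theorem HoldsBits.ne_mark {T : ℕ → WorkSym} {p : ℕ} {l : List Bool} (h : HoldsBits T p l) {j : ℕ}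
    (h₁ : p ≤ j) (h₂ : j ≤ p + l.length) : T j ≠ .mark := by
  induction l generalizing p with
  | nil =>
    obtain rfl : j = p := by simpa using le_antisymm h₂ h₁
    intro h'; simp [HoldsBits, h'] at h
  | cons b l ih =>
    rcases eq_or_lt_of_le h₁ with rfl | h₁
    · rw [h.1]; simp
    · exact ih h.2 h₁ (by simp at h₂; omega)

/-- The configuration in which tape `r` has the content `T` and its head is on cell `p`. -/
def Conf.put {O : Type} (c : Conf O) (r : ℕ) (T : ℕ → WorkSym) (p : ℕ) : Conf O :=
  { c with work := Function.update c.work r T, hd := Function.update c.hd r p }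

namespace Frag

variable {I O X Y : Type}

theorem put_comm (c : Conf O) {r t : ℕ} (h : r ≠ t) (T T' : ℕ → WorkSym) (p p' : ℕ) :
    (c.put r T p).put t T' p' = (c.put t T' p').put r T p := by
  simp [Conf.put, Function.update_comm h]

theorem put_hd_lt {c : Conf O} {s : ℕ} (h : ∀ i, c.hd i < s) {r : ℕ} {T : ℕ → WorkSym} {p : ℕ}
    (hp : p < s) (i : ℕ) : (c.put r T p).hd i < s := by
  by_cases hi : i = r
  · subst hi; simpa [Conf.put] using hp
  · simpa [Conf.put, hi] using h i

theorem runs_atom_emit {r : ℕ} {f : InputCell I → WorkSym → Act O X} {w : List I} {s : ℕ}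
    {c : Conf O} {T : ℕ → WorkSym} {p p' : ℕ} {x : X} {a : WorkSym} {d : HeadMove} {e : Option O}
    (hpos : c.pos ≤ w.length + 1) (h : ∀ i, c.hd i < s)
    (hf : f (inputCell w c.pos) (T p) = ⟨x, a, d, .stay, e⟩)
    (hd : d.apply p = p') (hp : p < s) (hp' : p' < s) :
    (atom r f).Runs w s (c.put r T p) x
      { c.put r (Function.update T p a) p' with out := c.out ++ e.toList } := by
  have := runs_atom (f := f) (r := r) (w := w) (c := c.put r T p) (put_hd_lt h hp)
    (by simp [Conf.put, hf, hd, hp'])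
  simpa [Act.apply, Conf.put, hf, hd, show ∀ p, HeadMove.apply .stay p = p from fun _ => rfl, hpos]
    using this

theorem runs_atom_write {r : ℕ} {f : InputCell I → WorkSym → Act O X} {w : List I} {s : ℕ}
    {c : Conf O} {T : ℕ → WorkSym} {p p' : ℕ} {x : X} {a : WorkSym} {d : HeadMove}
    (hpos : c.pos ≤ w.length + 1) (h : ∀ i, c.hd i < s)
    (hf : f (inputCell w c.pos) (T p) = ⟨x, a, d, .stay, none⟩)
    (hd : d.apply p = p') (hp : p < s) (hp' : p' < s) :
    (atom r f).Runs w s (c.put r T p) x (c.put r (Function.update T p a) p') := by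
  simpa [Conf.put] using runs_atom_emit hpos h hf hd hp hp'

theorem runs_atom_read {r : ℕ} {f : InputCell I → WorkSym → Act O X} {w : List I} {s : ℕ}
    {c : Conf O} {T : ℕ → WorkSym} {p p' : ℕ} {x : X} {d : HeadMove}
    (hpos : c.pos ≤ w.length + 1) (h : ∀ i, c.hd i < s)
    (hf : f (inputCell w c.pos) (T p) = ⟨x, T p, d, .stay, none⟩)
    (hd : d.apply p = p') (hp : p < s) (hp' : p' < s) :
    (atom r f).Runs w s (c.put r T p) x (c.put r T p') := by
  simpa using runs_atom_write hpos h hf hd hp hp'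

/-- The fragment that does nothing and ends with result `x`. -/
def ret (x : X) : Frag I O X := atom 0 fun _ a => ⟨x, a, .stay, .stay, none⟩

theorem runs_ret {w : List I} {s : ℕ} {c : Conf O} (x : X) (hpos : c.pos ≤ w.length + 1)
    (h : ∀ i, c.hd i < s) : (ret x).Runs w s c x c := by
  have := runs_atom (r := 0) (f := fun _ a => (⟨x, a, .stay, .stay, none⟩ : Act O X)) (w := w) h
    (h 0)
  have hc : min c.pos (w.length + 1) = c.pos := min_eq_left hpos
  unfold ret
  simpa [HeadMove.apply, Act.apply, hc] using this

/-- Move the head on tape `r` back to the marker. -/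
def rewind (r : ℕ) : Frag I O Unit :=
  loop (atom r fun _ a =>
    if a = .mark then ⟨some (), a, .stay, .stay, none⟩ else ⟨none, a, .left, .stay, none⟩)

theorem runs_rewind {r : ℕ} {w : List I} {s : ℕ} {c : Conf O} {T : ℕ → WorkSym} {p : ℕ}
    (hpos : c.pos ≤ w.length + 1) (h : ∀ i, c.hd i < s) (hp : p < s) (h0 : T 0 = .mark)
    (hne : ∀ j, 1 ≤ j → j ≤ p → T j ≠ .mark) :
    (rewind r).Runs w s (c.put r T p) () (c.put r T 0) := by
  induction p with
  | zero =>
    exact Runs.loop_some (runs_atom_read hpos h (by rw [if_pos h0]) rfl hp hp) (put_hd_lt h hp)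
  | succ p ih =>
    exact Runs.loop_none (runs_atom_read (p' := p) hpos h (by rw [if_neg (hne _ (by omega) le_rfl)])
      rfl hp
      (by omega)) (ih (by omega) fun j h₁ h₂ => hne j h₁ (by omega))

/-- Increment the digits to the right of the head on tape `r`. -/
def carry (r : ℕ) : Frag I O Unit :=
  loop ((atom r fun _ a => match a with
      | .bit true => ⟨none, .bit false, .right, .stay, none⟩
      | .bit false => ⟨some false, .bit true, .stay, .stay, none⟩
      | _ => ⟨some true, .bit true, .right, .stay, none⟩).bind fun x : Option Bool => match x with
    | none => ret none
    | some false => ret (some ())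
    | some true => atom r fun _ _ => ⟨some (), .blank, .stay, .stay, none⟩)

theorem runs_carry {r : ℕ} {w : List I} {s : ℕ} {l : List Bool} {c : Conf O} {T : ℕ → WorkSym}
    {p : ℕ} (hpos : c.pos ≤ w.length + 1) (h : ∀ i, c.hd i < s) (hl : HoldsBits T p l)
    (hs : p + l.length + 1 < s) :
    ∃ T' p', (carry r).Runs w s (c.put r T p) () (c.put r T' p') ∧
      HoldsBits T' p (incBits l) ∧ (∀ j < p, T' j = T j) ∧ p' ≤ p + (incBits l).length := by
  induction l generalizing T p with
  | nil =>
    simp only [List.length_nil] at hs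
    refine ⟨Function.update (Function.update T p (.bit true)) (p + 1) .blank, p + 1,
      Runs.loop_some (Runs.bind (runs_atom_write (x := some true) (a := .bit true)
      (d := .right) (p' := p + 1) hpos h ?_ rfl ?_ ?_) (runs_atom_write hpos h rfl rfl ?_ ?_))
      (put_hd_lt h ?_),
      ?_, ?_, ?_⟩
    · rw [HoldsBits.nil_iff.1 hl]
    iterate 5 omega
    · simp [incBits, HoldsBits]
    · intro j hj
      rw [Function.update_of_ne (by omega), Function.update_of_ne (by omega)]
    · simp [incBits]
  | cons b l ih =>
    simp only [List.length_cons] at hs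
    cases b with
    | false =>
      have hh : ∀ T' i, (c.put r T' p).hd i < s := fun T' => put_hd_lt h (by omega)
      refine ⟨Function.update T p (.bit true), p, Runs.loop_some (Runs.bind
        (runs_atom_write (x := some false) (a := .bit true) (d := .stay) (p' := p) hpos h
        ?_ rfl ?_ ?_)
        (runs_ret (some ()) hpos (hh _))) (hh _), ?_, ?_, ?_⟩
      · rw [hl.1]
      iterate 2 omega
      · refine ⟨by simp, hl.2.congr fun j hj => ?_⟩
        rw [Function.update_of_ne (by omega)]
      · intro j hj
        rw [Function.update_of_ne (by omega)]
      · omega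
    | true =>
      obtain ⟨T', p', h₁, h₂, h₃, h₄⟩ := ih (T := Function.update T p (.bit false)) (p := p + 1)
        (hl.2.congr fun j hj => by rw [Function.update_of_ne (by omega)]) (by omega)
      refine ⟨T', p', Runs.loop_none (Runs.bind (runs_atom_write (x := none) (a := .bit false)
        (d := .right) (p' := p + 1) hpos h ?_ rfl ?_ ?_) (runs_ret none hpos (put_hd_lt h ?_))) h₁,
        ⟨?_, h₂⟩, ?_, ?_⟩
      · rw [hl.1]
      iterate 3 omega
      · rw [h₃ _ (Nat.lt_succ_self _)]; simp
      · intro j hj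
        rw [h₃ _ (by omega), Function.update_of_ne (by omega)]
      · simp [incBits]; omega

/-- Between two operations on registers, the input head is on its tape and all work heads are on
cell `0`. -/
def AtRest (w : List I) (c : Conf O) : Prop :=
  c.pos ≤ w.length + 1 ∧ ∀ i, c.hd i = 0

/-- The configuration in which the content of tape `r` is replaced. -/
def _root_.Conf.setTape (c : Conf O) (r : ℕ) (T : ℕ → WorkSym) : Conf O :=
  { c with work := Function.update c.work r T }

theorem AtRest.setTape {w : List I} {c : Conf O} (h : AtRest w c) (r : ℕ) (T : ℕ → WorkSym) :
    AtRest w (c.setTape r T) := h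

theorem AtRest.put_zero {w : List I} {c : Conf O} (h : AtRest w c) (r : ℕ) (T : ℕ → WorkSym) :
    c.put r T 0 = c.setTape r T := by
  simp only [Conf.put, Conf.setTape]
  rw [← h.2 r, Function.update_eq_self]

theorem AtRest.put_self {w : List I} {c : Conf O} (h : AtRest w c) (r : ℕ) :
    c.put r (c.work r) 0 = c := by
  rw [h.put_zero, Conf.setTape, Function.update_eq_self]

/-- Numbers below `2 ^ m` have at most `m` digits. With the marker, the carry and the blank at the
end, a register for such a number stays in the first `m + 4` cells. -/
theorem AtRest.lt {w : List I} {c : Conf O} (h : AtRest w c) (m i : ℕ) : c.hd i < m + 4 := by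
  rw [h.2]; omega

/-- Increment register `r`. -/
def inc (r : ℕ) : Frag I O Unit :=
  (atom r fun _ a => ⟨(), a, .right, .stay, none⟩).bind fun _ =>
    (carry r).bind fun _ => rewind r

theorem runs_inc {r v m : ℕ} {w : List I} {c : Conf O} (hc : AtRest w c)
    (hv : HoldsNat (c.work r) v) (hm : v < 2 ^ m) :
    ∃ T, HoldsNat T (v + 1) ∧ (inc r).Runs w (m + 4) c () (c.setTape r T) := by
  have hlen := length_bits_le hm
  obtain ⟨T, p, h₁, h₂, h₃, h₄⟩ := runs_carry (r := r) (w := w) (s := m + 4) (c := c) hc.1 (hc.lt m)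
    hv.2 (by omega)
  have hT : T 0 = .mark := (h₃ 0 (by omega)).trans hv.1
  have hp := h₁.space r
  simp only [Conf.put, Function.update_self] at hp
  rw [incBits_bits] at h₂ h₄
  refine ⟨T, ⟨hT, h₂⟩, ?_⟩
  have := Runs.bind (G := fun _ => (carry r).bind fun _ => rewind r)
    (runs_atom_read (r := r) (T := c.work r) (p := 0) (p' := 1) (d := .right) (x := ())
      (f := fun _ a => ⟨(), a, .right, .stay, none⟩) hc.1 (hc.lt m) rfl rfl (by omega) (by omega))
    (Runs.bind h₁ (runs_rewind hc.1 (hc.lt m) hp hT fun j hj hj' => h₂.ne_mark hj (by omega)))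
  rwa [hc.put_self, hc.put_zero] at this

/-- Set register `r` to `0`. -/
def clear (r : ℕ) : Frag I O Unit :=
  (atom r fun _ _ => ⟨(), .mark, .right, .stay, none⟩).bind fun _ =>
    atom r fun _ _ => ⟨(), .blank, .left, .stay, none⟩

theorem runs_clear {m : ℕ} {w : List I} {c : Conf O} (r : ℕ) (hc : AtRest w c) :
    ∃ T, HoldsNat T 0 ∧ (clear r).Runs w (m + 4) c () (c.setTape r T) := by
  refine ⟨Function.update (Function.update (c.work r) 0 .mark) 1 .blank, ⟨by simp, by
    simp [HoldsBits]⟩, ?_⟩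
  have := Runs.bind (w := w) (s := m + 4) (c := c.put r (c.work r) 0)
    (F := atom r fun _ _ => (⟨(), .mark, .right, .stay, none⟩ : Act O Unit))
    (G := fun _ => atom r fun _ _ => ⟨(), .blank, .left, .stay, none⟩)
    (runs_atom_write hc.1 (hc.lt m) rfl rfl (by omega) (by simp [HeadMove.apply]))
    (runs_atom_write (p' := 0) hc.1 (hc.lt m) rfl rfl (by simp [HeadMove.apply]) (by omega))
  rwa [hc.put_self, hc.put_zero] at this

/-- Compare the digits to the right of the heads on the tapes `r` and `t`. -/
def compareDigits (r t : ℕ) : Frag I O Bool :=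
  have := WorkSym.finite
  loop ((atom r fun _ a => ⟨a, a, .stay, .stay, none⟩).bind fun a : WorkSym =>
    (atom t fun _ b =>
      ⟨if a = b then if a = .blank then some true else none else some false, b, .stay, .stay,
        none⟩).bind fun x : Option Bool => match x with
      | some b => ret (some b)
      | none => (atom r fun _ a => ⟨(), a, .right, .stay, none⟩).bind fun _ =>
          atom t fun _ a => ⟨none, a, .right, .stay, none⟩)

theorem runs_compareDigits {r t : ℕ} (hrt : r ≠ t) {w : List I} {s : ℕ} {l l' : List Bool}
    {c : Conf O} {T T' : ℕ → WorkSym} {p : ℕ} (hpos : c.pos ≤ w.length + 1)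
    (h : ∀ i, c.hd i < s) (hl : HoldsBits T p l) (hl' : HoldsBits T' p l')
    (hs : p + l.length < s) (hs' : p + l'.length < s) :
    ∃ p', p' ≤ p + l.length ∧ p' ≤ p + l'.length ∧
      (compareDigits r t).Runs w s ((c.put r T p).put t T' p) (decide (l = l'))
        ((c.put r T p').put t T' p') := by
  have := WorkSym.finite
  have hh : ∀ p, p < s → ∀ i, ((c.put r T p).put t T' p).hd i < s :=
    fun p hp => put_hd_lt (put_hd_lt h hp) hp
  -- reading the tape `r` while the head on `t` is on cell `p'`
  have hread : ∀ {X : Type} (p p' q : ℕ) (x : X) (d : HeadMove) (f : WorkSym → Act O X),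
      f (T p) = ⟨x, T p, d, .stay, none⟩ → d.apply p = q → p < s → p' < s → q < s →
      (atom r fun _ a => f a : Frag I O X).Runs w s ((c.put r T p).put t T' p') x
        ((c.put r T q).put t T' p') := by
    intro X p p' q x d f hf hd hp hp' hq
    rw [put_comm _ hrt, put_comm _ hrt]
    exact runs_atom_read hpos (put_hd_lt h hp') hf hd hp hq
  induction l generalizing p l' with
  | nil =>
    rw [HoldsBits.nil_iff] at hl
    refine ⟨p, by omega, by omega, Runs.loop_some (Runs.bind
      (hread p p p (T p) .stay _ rfl rfl (by omega) (by omega) (by omega)) (Runs.bind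
      (x := some (decide ([] = l'))) (runs_atom_read (p' := p) (d := .stay) hpos
      (put_hd_lt h (by omega))
      ?_ rfl (by omega) (by omega)) (runs_ret _ hpos (hh p (by omega))))) (hh p (by omega))⟩
    cases l' with
    | nil => rw [HoldsBits.nil_iff] at hl'; simp [hl, hl']
    | cons b' l' => simp [hl, hl'.1]
  | cons b l ih =>
    cases l' with
    | nil =>
      rw [HoldsBits.nil_iff] at hl'
      refine ⟨p, by omega, by omega, Runs.loop_some (Runs.bind
        (hread p p p (T p) .stay _ rfl rfl (by omega) (by omega) (by omega)) (Runs.bind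
        (x := some (decide (b :: l = []))) (runs_atom_read (p' := p) (d := .stay) hpos
        (put_hd_lt h (by omega)) ?_ rfl (by omega) (by omega))
        (runs_ret _ hpos (hh p (by omega))))) (hh p (by omega))⟩
      simp [hl.1, hl']
    | cons b' l' =>
      simp only [List.length_cons] at hs hs'
      by_cases hb : b = b'
      · subst hb
        obtain ⟨p', h₁, h₂, h₃⟩ := ih hl.2 hl'.2 (by omega) (by omega)
        refine ⟨p', by simp; omega, by simp; omega, Runs.loop_none (Runs.bind
          (hread p p p (T p) .stay _ rfl rfl (by omega) (by omega) (by omega)) (Runs.bind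
          (x := none) (runs_atom_read (p' := p) (d := .stay) hpos
          (put_hd_lt h (by omega)) ?_ rfl (by omega) (by omega))
          (Runs.bind (x := ()) (hread p p (p + 1) () .right _ rfl rfl (by omega) (by omega)
          (by omega))
            (runs_atom_read (p' := p + 1) hpos (put_hd_lt h (by omega)) rfl rfl (by omega)
              (by omega))))) ?_⟩
        · simp [hl.1, hl'.1]
        · simp only [List.cons.injEq, true_and]
          exact h₃
      · refine ⟨p, by omega, by omega, Runs.loop_some (Runs.bind
          (hread p p p (T p) .stay _ rfl rfl (by omega) (by omega) (by omega)) (Runs.bind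
          (x := some (decide (b :: l = b' :: l'))) (runs_atom_read (p' := p) (d := .stay) hpos
          (put_hd_lt h (by omega)) ?_ rfl (by omega) (by omega))
          (runs_ret _ hpos (hh p (by omega))))) (hh p (by omega))⟩
        simp [hl.1, hl'.1, hb]

/-- Test whether the registers `r` and `t` are equal. -/
def testEq (r t : ℕ) : Frag I O Bool :=
  (atom r fun _ a => ⟨(), a, .right, .stay, none⟩).bind fun _ =>
    (atom t fun _ a => ⟨(), a, .right, .stay, none⟩).bind fun _ =>
      (compareDigits r t).bind fun b => (rewind r).bind fun _ => (rewind t).bind fun _ => ret b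

theorem runs_testEq {r t v v' m : ℕ} (hrt : r ≠ t) {w : List I} {c : Conf O} (hc : AtRest w c)
    (hv : HoldsNat (c.work r) v) (hv' : HoldsNat (c.work t) v') (hm : v < 2 ^ m)
    (hm' : v' < 2 ^ m) :
    (testEq r t).Runs w (m + 4) c (decide (v = v')) c := by
  have hlen := length_bits_le hm
  have hlen' := length_bits_le hm'
  have hs := hc.lt m
  obtain ⟨p, h₁, h₂, h₃⟩ := runs_compareDigits hrt hc.1 (hc.lt m) hv.2 hv'.2 (by omega) (by omega)
  rw [show decide (v.bits = v'.bits) = decide (v = v') by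
    simp [natBits_injective.eq_iff]] at h₃
  have hself : (c.put r (c.work r) 0).put t (c.work t) 0 = c := by
    rw [hc.put_self, hc.put_self]
  refine Runs.bind (x := ()) (c₁ := (c.put r (c.work r) 1).put t (c.work t) 0) ?_
    (Runs.bind (x := ())
    (c₁ := (c.put r (c.work r) 1).put t (c.work t) 1) ?_ (Runs.bind h₃ (Runs.bind (x := ())
    (c₁ := (c.put r (c.work r) 0).put t (c.work t) p) ?_ (Runs.bind (x := ())
    (c₁ := (c.put r (c.work r) 0).put t (c.work t) 0) ?_ ?_))))
  · nth_rw 1 [← hself]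
    rw [put_comm _ hrt, put_comm _ hrt]
    exact runs_atom_read hc.1 (put_hd_lt hs (by omega)) rfl rfl (by omega) (by omega)
  · exact runs_atom_read hc.1 (put_hd_lt hs (by omega)) rfl rfl (by omega) (by omega)
  · rw [put_comm _ hrt, put_comm _ hrt]
    exact runs_rewind hc.1 (put_hd_lt hs (by omega)) (by omega) hv.1
      fun j hj hj' => hv.2.ne_mark hj (by omega)
  · exact runs_rewind hc.1 (put_hd_lt hs (by omega)) (by omega) hv'.1
      fun j hj hj' => hv'.2.ne_mark hj (by omega)
  · rw [hself]
    exact runs_ret _ hc.1 hs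

/-- Emit the digits of register `r`. -/
def emitBits (g : Bool → O) (r : ℕ) : Frag I O Unit :=
  (atom r fun _ a => ⟨(), a, .right, .stay, none⟩).bind fun _ =>
    (loop (atom r fun _ a => match a with
      | .bit b => ⟨none, a, .right, .stay, some (g b)⟩
      | _ => ⟨some (), a, .stay, .stay, none⟩)).bind fun _ => rewind r

theorem runs_emitBits {g : Bool → O} {r v m : ℕ} {w : List I} {c : Conf O} (hc : AtRest w c)
    (hv : HoldsNat (c.work r) v) (hm : v < 2 ^ m) :
    (emitBits g r).Runs w (m + 4) c () { c with out := c.out ++ v.bits.map g } := by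
  have hlen := length_bits_le hm
  have key : ∀ l p out, HoldsBits (c.work r) p l → p + l.length < m + 4 →
      (loop (atom r fun _ a => match a with
        | .bit b => ⟨none, a, .right, .stay, some (g b)⟩
        | _ => ⟨some (), a, .stay, .stay, none⟩)).Runs w (m + 4)
        ({ c with out := out }.put r (c.work r) p) ()
        ({ c with out := out ++ l.map g }.put r (c.work r) (p + l.length)) := by
    intro l
    induction l with
    | nil =>
      intro p out hl hp
      rw [HoldsBits.nil_iff] at hl
      simp only [List.length_nil, add_zero] at hp
      simp only [List.map_nil, List.append_nil, List.length_nil, add_zero]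
      refine Runs.loop_some (runs_atom_read (d := .stay) hc.1 (hc.lt m) ?_ rfl hp hp)
        (put_hd_lt (T := c.work r) (hc.lt m) hp)
      rw [hl]
    | cons b l ih =>
      intro p out hl hp
      simp only [List.length_cons] at hp
      have h₁ := ih (p + 1) (out ++ [g b]) hl.2 (by omega)
      rw [show p + 1 + l.length = p + (b :: l).length by simp; omega, List.append_assoc] at h₁
      refine Runs.loop_none ?_ h₁
      have h₂ := runs_atom_emit (c := { c with out := out }) (r := r) (T := c.work r) (p := p)
        (p' := p + 1) (s := m + 4) (w := w) (x := (none : Option Unit)) (a := c.work r p)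
        (d := .right)
        (e := some (g b)) (f := fun _ a => match a with
        | .bit b => ⟨none, a, .right, .stay, some (g b)⟩
        | _ => ⟨some (), a, .stay, .stay, none⟩) hc.1 (hc.lt m) (by rw [hl.1]) rfl (by omega)
        (by omega)
      simpa [Conf.put] using h₂
  have hc' : AtRest w { c with out := c.out ++ v.bits.map g } := hc
  have h := Runs.bind (G := fun _ => rewind r) (key v.bits 1 c.out hv.2 (by omega))
    (runs_rewind hc'.1 (hc'.lt m) (by omega) hv.1 fun j hj hj' => hv.2.ne_mark hj hj')
  have := hc'.put_self r
  simp only at this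
  rw [this] at h
  refine Runs.bind (x := ()) ?_ h
  nth_rw 1 [← hc.put_self r]
  exact runs_atom_read hc.1 (hc.lt m) rfl rfl (by omega) (by omega)

end Frag

/-! ### Counting loops and access to the input -/

namespace Frag

variable {I O X Y : Type}

/-- Execute `body` with register `i` running through `0, …, n - 1`, where `n` is the content of
register `r`. -/
def forLoop (i r : ℕ) (body : Frag I O Unit) : Frag I O Unit :=
  (clear i).bind fun _ => loop ((testEq i r).bind fun b : Bool => match b with
    | true => ret (some ())
    | false => body.bind fun _ => (inc i).bind fun _ => ret none)

/-- A loop invariant `P` that does not depend on the loop counter `i` is preserved by a counting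
loop. -/
theorem runs_forLoop {i r n m : ℕ} (hir : i ≠ r) {body : Frag I O Unit} {w : List I} {c : Conf O}
    (P : ℕ → Conf O → Prop) (hP : ∀ j c T, P j c → P j (c.setTape i T))
    (hc : AtRest w c) (hn : HoldsNat (c.work r) n) (hm : n < 2 ^ m) (h0 : P 0 c)
    (hbody : ∀ j < n, ∀ c, AtRest w c → HoldsNat (c.work i) j → HoldsNat (c.work r) n → P j c →
      ∃ c', body.Runs w (m + 4) c () c' ∧ AtRest w c' ∧ c'.work i = c.work i ∧
        c'.work r = c.work r ∧ P (j + 1) c') :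
    ∃ c', (forLoop i r body).Runs w (m + 4) c () c' ∧ AtRest w c' ∧ P n c' ∧
      HoldsNat (c'.work r) n := by
  have key : ∀ (k j : ℕ) (c : Conf O), j + k = n → AtRest w c → HoldsNat (c.work i) j →
      HoldsNat (c.work r) n → P j c →
      ∃ c', (loop ((testEq i r).bind fun b : Bool => match b with
        | true => ret (some ())
        | false => body.bind fun _ => (inc i).bind fun _ => ret none)).Runs w (m + 4) c () c' ∧
        AtRest w c' ∧ P n c' ∧ HoldsNat (c'.work r) n := by
    intro k
    induction k with
    | zero =>
      intro j c hj hc hi hr hp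
      obtain rfl : j = n := hj
      refine ⟨c, Runs.loop_some (Runs.bind (runs_testEq hir hc hi hr hm hm) ?_) (hc.lt m), hc, hp,
        hr⟩
      simpa using runs_ret (some ()) hc.1 (hc.lt m)
    | succ k ih =>
      intro j c hj hc hi hr hp
      obtain ⟨c₁, h₁, hc₁, hi₁, hr₁, hp₁⟩ := hbody j (by omega) c hc hi hr hp
      obtain ⟨T, hT, h₂⟩ := runs_inc (m := m) hc₁ (hi₁ ▸ hi) (by omega)
      obtain ⟨c', h₃, h₄⟩ := ih (j + 1) (c₁.setTape i T) (by omega) (hc₁.setTape i T)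
        (by simpa [Conf.setTape] using hT) (by simpa [Conf.setTape, hir.symm, hr₁] using hr)
        (hP _ _ _ hp₁)
      refine ⟨c', Runs.loop_none (Runs.bind (runs_testEq hir hc hi hr (by omega) hm) ?_) h₃, h₄⟩
      rw [decide_eq_false (by omega)]
      exact Runs.bind h₁ (Runs.bind h₂ (runs_ret _ hc₁.1 ((hc₁.setTape i T).lt m)))
  obtain ⟨T, hT, h₁⟩ := runs_clear (m := m) i hc
  obtain ⟨c', h₂, h₃⟩ := key n 0 (c.setTape i T) (by omega) (hc.setTape i T)
    (by simpa [Conf.setTape] using hT) (by simpa [Conf.setTape, hir.symm] using hn) (hP _ _ _ h0)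
  exact ⟨c', Runs.bind h₁ h₂, h₃⟩

/-- Copy register `t` to register `r`, with `i` as a counter. -/
def copy (r t i : ℕ) : Frag I O Unit :=
  (clear r).bind fun _ => forLoop i t (inc r)

theorem runs_copy {r t i v m : ℕ} (hrt : r ≠ t) (hir : i ≠ r) (hit : i ≠ t) {w : List I}
    {c : Conf O}
    (hc : AtRest w c) (hv : HoldsNat (c.work t) v) (hm : v < 2 ^ m) :
    ∃ c', (copy r t i).Runs w (m + 4) c () c' ∧ AtRest w c' ∧ HoldsNat (c'.work r) v ∧
      c'.out = c.out ∧ ∀ j, j ≠ r → j ≠ i → c'.work j = c.work j := by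
  obtain ⟨T, hT, h₁⟩ := runs_clear (m := m) r hc
  obtain ⟨c', h₂, h₃, h₄, -⟩ := runs_forLoop (i := i) (r := t) (n := v) (m := m) hit (body := inc r)
    (w := w) (c := c.setTape r T) (fun k d => HoldsNat (d.work r) k ∧ d.out = c.out ∧
      ∀ j, j ≠ r → j ≠ i → d.work j = c.work j)
    (fun k d T h => ⟨by simpa [Conf.setTape, hir.symm] using h.1, h.2.1, fun j h₁ h₂ => by
      simpa [Conf.setTape, h₂] using h.2.2 j h₁ h₂⟩) (hc.setTape r T)
    (by simpa [Conf.setTape, hrt.symm] using hv) hm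
    ⟨by simpa [Conf.setTape] using hT, rfl, fun j h₁ h₂ => by simp [Conf.setTape, h₁]⟩
    (fun k hk d hd hi ht hp => by
      obtain ⟨T, hT, h⟩ := runs_inc (m := m) hd hp.1 (by omega)
      exact ⟨_, h, hd.setTape r T, by simp [Conf.setTape, hir], by simp [Conf.setTape, hrt.symm],
        by simpa [Conf.setTape] using hT, hp.2.1, fun j h₁ h₂ => by
          simpa [Conf.setTape, h₁] using hp.2.2 j h₁ h₂⟩)
  exact ⟨c', Runs.bind h₁ h₂, h₃, h₄⟩

/-- Move the input head. -/
def moveInput (d : HeadMove) : Frag I O Unit := atom 0 fun _ a => ⟨(), a, .stay, d, none⟩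

theorem runs_moveInput {d : HeadMove} {w : List I} {s : ℕ} {c : Conf O} (h : ∀ i, c.hd i < s) :
    (moveInput d).Runs w s c () { c with pos := min (d.apply c.pos) (w.length + 1) } := by
  have := runs_atom (r := 0) (f := fun _ a => (⟨(), a, .stay, d, none⟩ : Act O Unit)) (w := w) h
    (h 0)
  unfold moveInput
  simpa [Act.apply, show ∀ p, HeadMove.apply .stay p = p from fun _ => rfl] using this

/-- Evaluate a function of the input symbol. -/
def readInput (f : InputCell I → X) : Frag I O X := atom 0 fun x a => ⟨f x, a, .stay, .stay, none⟩

theorem runs_readInput {f : InputCell I → X} {w : List I} {s : ℕ} {c : Conf O}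
    (hpos : c.pos ≤ w.length + 1) (h : ∀ i, c.hd i < s) :
    (readInput f).Runs w s c (f (inputCell w c.pos)) c := by
  have := runs_atom (r := 0)
    (f := fun x a => (⟨f x, a, .stay, .stay, none⟩ : Act O X)) (w := w) h (h 0)
  have hc : min c.pos (w.length + 1) = c.pos := min_eq_left hpos
  unfold readInput
  simpa [HeadMove.apply, Act.apply, hc] using this

/-- Move the input head to the left endmarker. -/
def rewindInput : Frag I O Unit :=
  loop ((readInput fun x => match x with | .leftEnd => true | _ => false).bind fun b : Bool =>
    match b with
    | true => ret (some ())
    | false => (moveInput .left).bind fun _ => ret none)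

theorem runs_rewindInput {w : List I} {s : ℕ} {c : Conf O}
    (hpos : c.pos ≤ w.length + 1) (h : ∀ i, c.hd i < s) :
    rewindInput.Runs w s c () { c with pos := 0 } := by
  generalize hp : c.pos = p at hpos
  induction p generalizing c with
  | zero =>
    have hc : c = { c with pos := 0 } := by rw [← hp]
    rw [← hc]
    have hr := runs_readInput (f := fun x => match x with | .leftEnd => true | _ => false) (w := w)
      (hp.trans_le hpos) h
    rw [hp] at hr
    exact Runs.loop_some (Runs.bind hr (runs_ret _ (by omega) h)) h
  | succ p ih =>
    have hr := runs_readInput (f := fun x => match x with | .leftEnd => true | _ => false) (w := w)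
      (hp.trans_le hpos) h
    have hf : (match inputCell w c.pos with | .leftEnd => true | _ => false) = false := by
      rw [hp, inputCell]
      split <;> rename_i h' <;> first | rfl | (split at h' <;> simp at h')
    rw [hf] at hr
    refine Runs.loop_none (Runs.bind hr (Runs.bind (runs_moveInput h) (runs_ret _ (by simp) h))) ?_
    have hm : min (HeadMove.apply .left c.pos) (w.length + 1) = p := by
      simp [HeadMove.apply, hp]; omega
    rw [hm]
    exact ih (c := { c with pos := p }) h rfl (by omega)

/-- Move the input head to the cell whose number is in register `r`, with `i` as a counter. -/
def seek (r i : ℕ) : Frag I O Unit :=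
  rewindInput.bind fun _ => forLoop i r (moveInput .right)

theorem runs_seek {r i v m : ℕ} (hir : i ≠ r) {w : List I} {c : Conf O} (hc : AtRest w c)
    (hv : HoldsNat (c.work r) v) (hm : v < 2 ^ m) :
    ∃ c', (seek r i).Runs w (m + 4) c () c' ∧ AtRest w c' ∧ c'.pos = min v (w.length + 1) ∧
      c'.out = c.out ∧ ∀ j, j ≠ i → c'.work j = c.work j := by
  obtain ⟨c', h₂, h₃, h₄, -⟩ := runs_forLoop (i := i) (r := r) (n := v) (m := m) hir
    (body := moveInput .right) (w := w) (c := { c with pos := 0 })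
    (fun k d => d.pos = min k (w.length + 1) ∧ d.out = c.out ∧ ∀ j, j ≠ i → d.work j = c.work j)
    (fun k d T h => ⟨h.1, h.2.1, fun j h₁ => by
      simpa [Conf.setTape, h₁] using h.2.2 j h₁⟩) ⟨Nat.zero_le _, hc.2⟩ hv hm
    ⟨by simp, rfl, fun j _ => rfl⟩
    (fun k hk d hd hi ht hp => ⟨_, runs_moveInput (hd.lt m), ⟨by simp, hd.2⟩, rfl, rfl,
      by simp [hp.1, HeadMove.apply], hp.2⟩)
  exact ⟨c', Runs.bind (runs_rewindInput hc.1 (hc.lt m)) h₂, h₃, h₄⟩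

theorem inputCell_min (w : List I) (v : ℕ) :
    inputCell w (min v (w.length + 1)) = inputCell w v := by
  rcases le_total v (w.length + 1) with h | h
  · rw [min_eq_left h]
  · rw [min_eq_right h]
    obtain ⟨v, rfl⟩ : ∃ k, v = k + 1 := ⟨v - 1, by omega⟩
    simp only [inputCell]
    rw [List.getElem?_eq_none (by omega), List.getElem?_eq_none (by omega)]

/-- Store the length of the input word in register `r`. -/
def inputLength (r : ℕ) : Frag I O Unit :=
  rewindInput.bind fun _ => (clear r).bind fun _ => (moveInput .right).bind fun _ =>
    loop ((readInput fun x => match x with | .rightEnd => true | _ => false).bind fun b : Bool =>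
      match b with
      | true => ret (some ())
      | false => (inc r).bind fun _ => (moveInput .right).bind fun _ => ret none)

theorem runs_inputLength (r : ℕ) {m : ℕ} {w : List I} {c : Conf O} (hc : AtRest w c)
    (hm : w.length < 2 ^ m) :
    ∃ c', (inputLength r).Runs w (m + 4) c () c' ∧ AtRest w c' ∧ HoldsNat (c'.work r) w.length ∧
      c'.out = c.out ∧ ∀ j, j ≠ r → c'.work j = c.work j := by
  have key : ∀ (k j : ℕ) (c : Conf O), j + k = w.length → AtRest w c → HoldsNat (c.work r) j →
      c.pos = j + 1 →
      ∃ c', (loop ((readInput fun x => match x with | .rightEnd => true | _ => false).bind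
        fun b : Bool => match b with
        | true => ret (some ())
        | false => (inc r).bind fun _ => (moveInput .right).bind fun _ => ret none)).Runs
          w (m + 4) c () c' ∧ AtRest w c' ∧ HoldsNat (c'.work r) w.length ∧
      c'.out = c.out ∧ ∀ j, j ≠ r → c'.work j = c.work j := by
    intro k
    induction k with
    | zero =>
      intro j c hj hc hr hp
      refine ⟨c, ?_, hc, by rwa [← hj], rfl, fun _ _ => rfl⟩
      have hR := runs_readInput (f := fun x => match x with | .rightEnd => true | _ => false)
        (w := w)
        hc.1 (hc.lt m)
      rw [hp, inputCell, List.getElem?_eq_none (by omega)] at hR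
      exact Runs.loop_some (Runs.bind hR (runs_ret _ hc.1 (hc.lt m))) (hc.lt m)
    | succ k ih =>
      intro j c hj hc hr hp
      obtain ⟨T, hT, h₁⟩ := runs_inc (m := m) hc hr (by omega)
      have hc' : AtRest w { c.setTape r T with pos := j + 1 + 1 } := ⟨by simp; omega, hc.2⟩
      obtain ⟨c', h₂, h₃, h₄, h₅, h₆⟩ := ih (j + 1) { c.setTape r T with pos := j + 1 + 1 }
        (by omega)
        hc' (by simpa [Conf.setTape] using hT) rfl
      refine ⟨c', ?_, h₃, h₄, h₅, fun i hi => by simpa [Conf.setTape, hi] using h₆ i hi⟩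
      have hR := runs_readInput (f := fun x => match x with | .rightEnd => true | _ => false)
        (w := w)
        hc.1 (hc.lt m)
      rw [hp, inputCell, List.getElem?_eq_getElem (by omega)] at hR
      have hM := runs_moveInput (d := .right) (w := w) (s := m + 4) (c := c.setTape r T) (hc.lt m)
      rw [show min (HeadMove.right.apply (c.setTape r T).pos) (w.length + 1) = j + 1 + 1 by
        simp [Conf.setTape, hp, HeadMove.apply]; omega] at hM
      exact Runs.loop_none (Runs.bind hR (Runs.bind h₁ (Runs.bind hM
        (runs_ret none hc'.1 (hc'.lt m))))) h₂
  have hc0 : AtRest w { c with pos := 0 } := ⟨Nat.zero_le _, hc.2⟩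
  obtain ⟨T, hT, h₁⟩ := runs_clear (m := m) r hc0
  have hM := runs_moveInput (d := .right) (w := w) (s := m + 4)
    (c := Conf.setTape { c with pos := 0 } r T) (hc.lt m)
  rw [show min (HeadMove.right.apply (Conf.setTape { c with pos := 0 } r T).pos) (w.length + 1) =
    1 by
    simp [Conf.setTape, HeadMove.apply]] at hM
  obtain ⟨c', h₂, h₃, h₄, h₅, h₆⟩ := key w.length 0
    { Conf.setTape { c with pos := 0 } r T with pos := 1 } (by omega) ⟨by simp, hc.2⟩
    (by simpa [Conf.setTape] using hT) rfl
  exact ⟨c', Runs.bind (runs_rewindInput hc.1 (hc.lt m)) (Runs.bind h₁ (Runs.bind hM h₂)), h₃, h₄,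
    h₅,
    fun j hj => by simpa [Conf.setTape, hj] using h₆ j hj⟩

/-- Emit the symbol `o`. -/
def emitSymbol (o : O) : Frag I O Unit := atom 0 fun _ a => ⟨(), a, .stay, .stay, some o⟩

theorem runs_emitSymbol (o : O) {w : List I} {s : ℕ} {c : Conf O} (hpos : c.pos ≤ w.length + 1)
    (h : ∀ i, c.hd i < s) :
    (emitSymbol o).Runs w s c () { c with out := c.out ++ [o] } := by
  have := runs_atom (r := 0)
    (f := fun _ a => (⟨(), a, .stay, .stay, some o⟩ : Act O Unit)) (w := w) h (h 0)
  have hc : min c.pos (w.length + 1) = c.pos := min_eq_left hpos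
  unfold emitSymbol
  simpa [HeadMove.apply, Act.apply, hc] using this

end Frag

/-! ### Functions computable in logarithmic space -/

section LogspaceFun

variable {I O : Type} {n : ℕ}

/-- `L` is an upper bound for the length of `w` and for the numbers `v`. -/
structure SizeBound (w : List I) (v : Fin n → ℕ) (L : ℕ) : Prop where
  two_le : 2 ≤ L
  length_le : w.length ≤ L
  le : ∀ i, v i ≤ L

/-- The values of `f` are polynomially bounded in the length of the word and in the numerical
arguments. -/
def PolyBounded (f : List I → (Fin n → ℕ) → ℕ) : Prop :=
  ∃ k, ∀ w v L, SizeBound w v L → f w v ≤ L ^ k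

/-- The function `f` of a word and of `n` numbers is polynomially bounded, and for any choice of
registers `ℓ i` for the arguments and `r` for the value there is a fragment that computes `f` with
polynomially bounded numbers in its registers. Among the registers below `b`, the fragment changes
only `r`. -/
structure LogspaceFun (O : Type) (f : List I → (Fin n → ℕ) → ℕ) : Prop where
  bounded : PolyBounded f
  run : ∀ (ℓ : Fin n → ℕ) (r b : ℕ), (∀ i, ℓ i < b) → r < b → (∀ i, ℓ i ≠ r) →
    ∃ (p : Frag I O Unit) (k : ℕ), ∀ w v L m c, SizeBound w v L → L ^ k < 2 ^ m →
      Frag.AtRest w c → (∀ i, HoldsNat (c.work (ℓ i)) (v i)) →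
      ∃ c', p.Runs w (m + 4) c () c' ∧ Frag.AtRest w c' ∧ HoldsNat (c'.work r) (f w v) ∧
        c'.out = c.out ∧ ∀ j < b, j ≠ r → c'.work j = c.work j

theorem SizeBound.pow_le {w : List I} {v : Fin n → ℕ} {L : ℕ} (h : SizeBound w v L) {a b : ℕ}
    (hab : a ≤ b) : L ^ a ≤ L ^ b :=
  Nat.pow_le_pow_right (by have := h.two_le; omega) hab

theorem SizeBound.le_pow {w : List I} {v : Fin n → ℕ} {L : ℕ} (_ : SizeBound w v L) {k : ℕ}
    (hk : 1 ≤ k) : L ≤ L ^ k :=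
  Nat.le_self_pow (by omega) L

theorem SizeBound.mono {w : List I} {v : Fin n → ℕ} {L : ℕ} (h : SizeBound w v L) {k l : ℕ}
    {u : Fin l → ℕ} (hk : 1 ≤ k) (hu : ∀ i, u i ≤ L ^ k) : SizeBound w u (L ^ k) :=
  ⟨h.two_le.trans (h.le_pow hk), h.length_le.trans (h.le_pow hk), hu⟩

namespace LogspaceFun

theorem proj (i : Fin n) : LogspaceFun O fun (_ : List I) v => v i where
  bounded := ⟨1, fun _ _ _ h => by simpa using h.le i⟩
  run := fun ℓ r b hℓ hr hne => by
    refine ⟨Frag.copy r (ℓ i) b, 1, fun w v L m c h hm hc hv => ?_⟩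
    obtain ⟨c', h₁, h₂, h₃, h₄, h₅⟩ := Frag.runs_copy (r := r) (t := ℓ i) (i := b) (hne i).symm
      hr.ne'
      (hℓ i).ne' hc (hv i) (((h.le i).trans (h.le_pow le_rfl)).trans_lt hm)
    exact ⟨c', h₁, h₂, h₃, h₄, fun j hj hjr => h₅ j hjr hj.ne⟩

theorem zero : LogspaceFun O fun (_ : List I) (_ : Fin n → ℕ) => 0 where
  bounded := ⟨0, fun _ _ _ _ => Nat.zero_le _⟩
  run := fun ℓ r b hℓ hr hne => by
    refine ⟨Frag.clear r, 0, fun w v L m c h hm hc hv => ?_⟩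
    obtain ⟨T, hT, h₁⟩ := Frag.runs_clear (m := m) r hc
    exact ⟨_, h₁, hc.setTape r T, by simpa [Conf.setTape] using hT, rfl,
      fun j hj hjr => by simp [Conf.setTape, hjr]⟩

theorem succ {f : List I → (Fin n → ℕ) → ℕ} (hf : LogspaceFun O f) :
    LogspaceFun O fun w v => f w v + 1 where
  bounded := by
    obtain ⟨k, hk⟩ := hf.bounded
    refine ⟨k + 1, fun w v L h => ?_⟩
    have h₁ : 1 ≤ L ^ k := Nat.one_le_pow _ _ (by have := h.two_le; omega)
    calc f w v + 1 ≤ L ^ k + L ^ k := add_le_add (hk w v L h) h₁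
      _ = L ^ k * 2 := by ring
      _ ≤ L ^ (k + 1) := by rw [pow_succ]; exact Nat.mul_le_mul_left _ h.two_le
  run := fun ℓ r b hℓ hr hne => by
    obtain ⟨p, k, hp⟩ := hf.run ℓ r b hℓ hr hne
    obtain ⟨k', hk'⟩ := hf.bounded
    refine ⟨p.bind fun _ => Frag.inc r, max k k', fun w v L m c h hm hc hv => ?_⟩
    obtain ⟨c', h₁, h₂, h₃, h₄, h₅⟩ := hp w v L m c h ((h.pow_le (le_max_left _ _)).trans_lt hm)
      hc hv
    obtain ⟨T, hT, h₆⟩ := Frag.runs_inc (m := m) h₂ h₃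
      (((hk' w v L h).trans (h.pow_le (le_max_right _ _))).trans_lt hm)
    exact ⟨_, h₁.bind h₆, h₂.setTape r T, by simpa [Conf.setTape] using hT, h₄,
      fun j hj hjr => by simpa [Conf.setTape, hjr] using h₅ j hj hjr⟩

/-- Test of the symbol in a given cell of the input tape. -/
theorem cell (S : InputCell I → Bool) :
    LogspaceFun O fun (w : List I) (v : Fin 1 → ℕ) => (S (inputCell w (v 0))).toNat where
  bounded := ⟨0, fun _ _ _ _ => by simpa using Bool.toNat_le _⟩
  run := fun ℓ r b hℓ hr hne => by
    refine ⟨(Frag.seek (ℓ 0) b).bind fun _ => (Frag.clear r).bind fun _ =>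
      (Frag.readInput S).bind fun b : Bool => match b with
        | true => Frag.inc r
        | false => Frag.ret (), 1, fun w v L m c h hm hc hv => ?_⟩
    obtain ⟨c₁, h₁, hc₁, hp, ho, hw⟩ := Frag.runs_seek (r := ℓ 0) (i := b) (hℓ 0).ne' hc (hv 0)
      (((h.le 0).trans (h.le_pow le_rfl)).trans_lt hm)
    obtain ⟨T, hT, h₂⟩ := Frag.runs_clear (m := m) r hc₁
    have h₃ := Frag.runs_readInput (f := S) (s := m + 4) (hc₁.setTape r T).1
      ((hc₁.setTape r T).lt m)
    rw [show (c₁.setTape r T).pos = min (v 0) (w.length + 1) from hp, Frag.inputCell_min] at h₃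
    cases hS : S (inputCell w (v 0)) with
    | true =>
      rw [hS] at h₃
      obtain ⟨T', hT', h₄⟩ := Frag.runs_inc (m := m) (r := r) (v := 0) (hc₁.setTape r T)
        (by simpa [Conf.setTape] using hT) (by positivity)
      exact ⟨_, h₁.bind (h₂.bind (h₃.bind h₄)), hc₁, by simpa [Conf.setTape] using hT', ho,
        fun j hj hjr => by simpa [Conf.setTape, hjr] using hw j hj.ne⟩
    | false =>
      rw [hS] at h₃
      exact ⟨_, h₁.bind (h₂.bind (h₃.bind (Frag.runs_ret () hc₁.1 ((hc₁.setTape r T).lt m)))), hc₁,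
        by simpa [Conf.setTape] using hT, ho,
        fun j hj hjr => by simpa [Conf.setTape, hjr] using hw j hj.ne⟩

theorem length : LogspaceFun O fun (w : List I) (_ : Fin n → ℕ) => w.length where
  bounded := ⟨1, fun _ _ _ h => by simpa using h.length_le⟩
  run := fun ℓ r b hℓ hr hne => by
    refine ⟨Frag.inputLength r, 1, fun w v L m c h hm hc hv => ?_⟩
    obtain ⟨c', h₁, h₂, h₃, h₄, h₅⟩ := Frag.runs_inputLength r hc
      ((h.length_le.trans (h.le_pow le_rfl)).trans_lt hm)
    exact ⟨c', h₁, h₂, h₃, h₄, fun j hj hjr => h₅ j hjr⟩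

/-- A common polynomial bound for finitely many functions. -/
theorem exists_common_bound {l : ℕ} {g : Fin l → List I → (Fin n → ℕ) → ℕ}
    (hg : ∀ i, PolyBounded (g i)) :
    ∃ k, 1 ≤ k ∧ ∀ w v L, SizeBound w v L → ∀ i, g i w v ≤ L ^ k := by
  choose k hk using hg
  refine ⟨(∑ i, k i) + 1, by omega, fun w v L h i => (hk i w v L h).trans (h.pow_le ?_)⟩
  exact (Finset.single_le_sum (f := k) (fun _ _ => Nat.zero_le _) (Finset.mem_univ i)).trans
    (Nat.le_succ _)

/-- Evaluation of several functions, with values in the registers `b, b + 1, …`. -/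
theorem run_all {l : ℕ} {g : Fin l → List I → (Fin n → ℕ) → ℕ} (hg : ∀ i, LogspaceFun O (g i))
    (ℓ : Fin n → ℕ) (b : ℕ) (hℓ : ∀ i, ℓ i < b) :
    ∃ (p : Frag I O Unit) (k : ℕ), ∀ w v L m c, SizeBound w v L → L ^ k < 2 ^ m →
      Frag.AtRest w c → (∀ i, HoldsNat (c.work (ℓ i)) (v i)) →
      ∃ c', p.Runs w (m + 4) c () c' ∧ Frag.AtRest w c' ∧
        (∀ i : Fin l, HoldsNat (c'.work (b + i)) (g i w v)) ∧
        c'.out = c.out ∧ ∀ j < b, c'.work j = c.work j := by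
  have key : ∀ t ≤ l, ∃ (p : Frag I O Unit) (k : ℕ), ∀ w v L m c, SizeBound w v L →
      L ^ k < 2 ^ m → Frag.AtRest w c → (∀ i, HoldsNat (c.work (ℓ i)) (v i)) →
      ∃ c', p.Runs w (m + 4) c () c' ∧ Frag.AtRest w c' ∧
        (∀ i : Fin l, i.1 < t → HoldsNat (c'.work (b + i)) (g i w v)) ∧
        c'.out = c.out ∧ ∀ j < b, c'.work j = c.work j := by
    intro t
    induction t with
    | zero =>
      exact fun _ => ⟨Frag.ret (), 0, fun w v L m c h hm hc hv =>
        ⟨c, Frag.runs_ret _ hc.1 (hc.lt m),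
        hc, by simp, rfl, fun _ _ => rfl⟩⟩
    | succ t ih =>
      intro ht
      obtain ⟨p, k, hp⟩ := ih (by omega)
      obtain ⟨p', k', hp'⟩ := (hg ⟨t, ht⟩).run ℓ (b + t) (b + l) (fun i => by have := hℓ i; omega)
        (by omega) (fun i => by have := hℓ i; omega)
      refine ⟨p.bind fun _ => p', max k k', fun w v L m c h hm hc hv => ?_⟩
      obtain ⟨c₁, h₁, h₂, h₃, h₄, h₅⟩ := hp w v L m c h ((h.pow_le (le_max_left _ _)).trans_lt hm)
        hc hv
      obtain ⟨c₂, h₁', h₂', h₃', h₄', h₅'⟩ := hp' w v L m c₁ h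
        ((h.pow_le (le_max_right _ _)).trans_lt hm) h₂ (fun i => by rw [h₅ _ (hℓ i)]; exact hv i)
      refine ⟨c₂, h₁.bind h₁', h₂', fun i hi => ?_, h₄'.trans h₄,
        fun j hj => (h₅' j (by omega) (by omega)).trans (h₅ j hj)⟩
      rcases Nat.lt_succ_iff_lt_or_eq.1 hi with hi | hi
      · rw [h₅' _ (by omega) (by omega)]; exact h₃ i hi
      · obtain rfl : i = ⟨t, ht⟩ := Fin.ext hi
        exact h₃'
  obtain ⟨p, k, hp⟩ := key l le_rfl
  refine ⟨p, k, fun w v L m c h hm hc hv => ?_⟩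
  obtain ⟨c', h₁, h₂, h₃, h₄⟩ := hp w v L m c h hm hc hv
  exact ⟨c', h₁, h₂, fun i => h₃ i i.2, h₄⟩

theorem comp {l : ℕ} {f : List I → (Fin l → ℕ) → ℕ} {g : Fin l → List I → (Fin n → ℕ) → ℕ}
    (hf : LogspaceFun O f) (hg : ∀ i, LogspaceFun O (g i)) :
    LogspaceFun O fun w v => f w fun i => g i w v := by
  obtain ⟨K, hK, hgK⟩ := exists_common_bound fun i => (hg i).bounded
  refine ⟨?_, fun ℓ r b hℓ hr hne => ?_⟩
  · obtain ⟨k, hk⟩ := hf.bounded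
    refine ⟨K * k, fun w v L h => ?_⟩
    rw [pow_mul]
    exact hk w _ _ (h.mono hK (hgK w v L h))
  · obtain ⟨p, k, hp⟩ := run_all hg ℓ b hℓ
    obtain ⟨p', k', hp'⟩ := hf.run (fun i => b + i) r (b + l) (fun i => by omega) (by omega)
      (fun i => by omega)
    refine ⟨p.bind fun _ => p', max k (K * k'), fun w v L m c h hm hc hv => ?_⟩
    obtain ⟨c₁, h₁, h₂, h₃, h₄, h₅⟩ := hp w v L m c h ((h.pow_le (le_max_left _ _)).trans_lt hm)
      hc hv
    obtain ⟨c₂, h₁', h₂', h₃', h₄', h₅'⟩ := hp' w (fun i => g i w v) (L ^ K) m c₁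
      (h.mono hK (hgK w v L h)) (by rw [← pow_mul]; exact (h.pow_le (le_max_right _ _)).trans_lt hm)
      h₂ h₃
    exact ⟨c₂, h₁.bind h₁', h₂', h₃', h₄'.trans h₄,
      fun j hj hjr => (h₅' j (by omega) hjr).trans (h₅ j hj)⟩

theorem comp1 {f : List I → ℕ → ℕ} {g : List I → (Fin n → ℕ) → ℕ}
    (hf : LogspaceFun O fun w (v : Fin 1 → ℕ) => f w (v 0)) (hg : LogspaceFun O g) :
    LogspaceFun O fun w v => f w (g w v) :=
  hf.comp (g := fun _ => g) fun _ => hg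

theorem comp2 {f : List I → ℕ → ℕ → ℕ} {g g' : List I → (Fin n → ℕ) → ℕ}
    (hf : LogspaceFun O fun w (v : Fin 2 → ℕ) => f w (v 0) (v 1)) (hg : LogspaceFun O g)
    (hg' : LogspaceFun O g') : LogspaceFun O fun w v => f w (g w v) (g' w v) :=
  hf.comp (g := ![g, g']) fun i => by fin_cases i <;> assumption

theorem comp3 {f : List I → ℕ → ℕ → ℕ → ℕ} {g g' g'' : List I → (Fin n → ℕ) → ℕ}
    (hf : LogspaceFun O fun w (v : Fin 3 → ℕ) => f w (v 0) (v 1) (v 2)) (hg : LogspaceFun O g)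
    (hg' : LogspaceFun O g') (hg'' : LogspaceFun O g'') :
    LogspaceFun O fun w v => f w (g w v) (g' w v) (g'' w v) :=
  hf.comp (g := ![g, g', g'']) fun i => by fin_cases i <;> assumption

/-- Primitive recursion, provided that all intermediate values are polynomially bounded. -/
theorem natRec {f bd : List I → (Fin n → ℕ) → ℕ} {h : List I → (Fin (n + 2) → ℕ) → ℕ}
    (hf : LogspaceFun O f) (hbd : LogspaceFun O bd) (hh : LogspaceFun O h)
    (hrec : ∃ k, ∀ w v L, SizeBound w v L → ∀ i ≤ bd w v,
      (Nat.rec (f w v) (fun i x => h w (Fin.cons i (Fin.cons x v))) i : ℕ) ≤ L ^ k) :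
    LogspaceFun O fun w v =>
      (Nat.rec (f w v) (fun i x => h w (Fin.cons i (Fin.cons x v))) (bd w v) : ℕ) := by
  obtain ⟨K, hK⟩ := hrec
  refine ⟨⟨K, fun w v L hL => hK w v L hL _ le_rfl⟩, fun ℓ r b hℓ hr hne => ?_⟩
  obtain ⟨kb, hkb⟩ := hbd.bounded
  obtain ⟨p₁, k₁, hp₁⟩ := hf.run ℓ r b hℓ hr hne
  obtain ⟨p₂, k₂, hp₂⟩ := hbd.run ℓ b (b + 1) (fun i => (hℓ i).trans (Nat.lt_succ_self b))
    (Nat.lt_succ_self b) (fun i => (hℓ i).ne)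
  obtain ⟨p₃, k₃, hp₃⟩ := hh.run (Fin.cons (b + 1) (Fin.cons r ℓ)) (b + 2) (b + 3)
    (Fin.cases (by simp) (Fin.cases (by simp; omega) fun i => by
      simpa using (hℓ i).trans (by omega)))
    (by omega)
    (Fin.cases (by simp) (Fin.cases (by simp; omega) fun i => by
      simpa using ((hℓ i).trans (by omega)).ne))
  -- the arguments of `h` are bounded by `L ^ A`
  set A := K + kb + 1 with hA
  refine ⟨p₁.bind fun _ => p₂.bind fun _ =>
    Frag.forLoop (b + 1) b (p₃.bind fun _ => Frag.copy r (b + 2) (b + 3)),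
    k₁ + k₂ + A * k₃ + A, fun w v L m c hL hm hc hv => ?_⟩
  have hm' : ∀ {k}, k ≤ k₁ + k₂ + A * k₃ + A → L ^ k < 2 ^ m := fun hk => (hL.pow_le hk).trans_lt hm
  set x : ℕ → ℕ := fun i => Nat.rec (f w v) (fun i x => h w (Fin.cons i (Fin.cons x v))) i with hx
  have hxA : ∀ i ≤ bd w v, x i ≤ L ^ A := fun i hi =>
    (hK w v L hL i hi).trans (hL.pow_le (by omega))
  have hbA : bd w v ≤ L ^ A := (hkb w v L hL).trans (hL.pow_le (by omega))
  obtain ⟨c₁, h₁, hc₁, hr₁, ho₁, hw₁⟩ := hp₁ w v L m c hL (hm' (by omega)) hc hv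
  obtain ⟨c₂, h₂, hc₂, hr₂, ho₂, hw₂⟩ := hp₂ w v L m c₁ hL (hm' (by omega)) hc₁
    (fun i => by rw [hw₁ _ (hℓ i) (hne i)]; exact hv i)
  obtain ⟨c₃, h₃, hc₃, ⟨hr₃, ho₃, hw₃⟩, -⟩ := Frag.runs_forLoop (i := b + 1) (r := b) (n := bd w v)
    (m := m) (by omega) (body := p₃.bind fun _ => Frag.copy r (b + 2) (b + 3)) (w := w) (c := c₂)
    (fun j d => HoldsNat (d.work r) (x j) ∧ d.out = c.out ∧
      ∀ t < b, t ≠ r → d.work t = c.work t)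
    (fun j d T hd => by
      refine ⟨?_, hd.2.1, fun t ht htr => ?_⟩
      · simpa [Conf.setTape, show r ≠ b + 1 by omega] using hd.1
      · simpa [Conf.setTape, show t ≠ b + 1 by omega] using hd.2.2 t ht htr)
    hc₂ hr₂ (hbA.trans_lt (hm' (by omega)))
    ⟨by rw [hw₂ r (by omega) (by omega)]; exact hr₁, ho₂.trans ho₁, fun t ht htr => by
      rw [hw₂ t (by omega) (by omega), hw₁ t ht htr]⟩
    (fun j hj d hd hi hb hP => by
      have hsz : SizeBound w (Fin.cons j (Fin.cons (x j) v) : Fin (n + 2) → ℕ) (L ^ A) :=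
        hL.mono (by omega) (Fin.cases (by simpa using hj.le.trans hbA) (Fin.cases
          (by simpa using hxA j hj.le) fun i => by
            simpa using (hL.le i).trans (hL.le_pow (by omega))))
      obtain ⟨d₁, g₁, hd₁, hr₁, ho₁, hw₁⟩ := hp₃ w (Fin.cons j (Fin.cons (x j) v)) (L ^ A) m d hsz
        (by rw [← pow_mul]; exact hm' (by omega)) hd
        (Fin.cases (by simpa using hi) (Fin.cases (by simpa using hP.1) fun i => by
          simp only [Fin.cons_succ]; rw [hP.2.2 _ (hℓ i) (hne i)]; exact hv i))
      obtain ⟨d₂, g₂, hd₂, hr₂, ho₂, hw₂⟩ := Frag.runs_copy (r := r) (t := b + 2) (i := b + 3)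
        (m := m)
        (by omega) (by omega) (by omega) hd₁ hr₁
        ((hxA (j + 1) hj).trans_lt (hm' (by omega)))
      refine ⟨d₂, g₁.bind g₂, hd₂, ?_, ?_, hr₂, ho₂.trans (ho₁.trans hP.2.1), fun t ht htr => ?_⟩
      · rw [hw₂ _ (by omega) (by omega), hw₁ _ (by omega) (by omega)]
      · rw [hw₂ _ (by omega) (by omega), hw₁ _ (by omega) (by omega)]
      · rw [hw₂ _ htr (by omega), hw₁ _ (by omega) (by omega), hP.2.2 t ht htr])
  exact ⟨c₃, h₁.bind (h₂.bind h₃), hc₃, hr₃, ho₃, hw₃⟩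

end LogspaceFun

/-- The word `F w v` can be emitted by a fragment with polynomially bounded numbers in its
registers, for any choice of registers `ℓ i` for the arguments `v`. The fragment does not change the
registers below `b`. -/
def LogspaceOutput (F : List I → (Fin n → ℕ) → List O) : Prop :=
  ∀ (ℓ : Fin n → ℕ) (b : ℕ), (∀ i, ℓ i < b) →
    ∃ (p : Frag I O Unit) (k : ℕ), ∀ w v L m c, SizeBound w v L → L ^ k < 2 ^ m →
      Frag.AtRest w c → (∀ i, HoldsNat (c.work (ℓ i)) (v i)) →
      ∃ c', p.Runs w (m + 4) c () c' ∧ Frag.AtRest w c' ∧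
        c'.out = c.out ++ F w v ∧ ∀ j < b, c'.work j = c.work j

namespace LogspaceOutput

theorem append {F G : List I → (Fin n → ℕ) → List O} (hF : LogspaceOutput F)
    (hG : LogspaceOutput G) : LogspaceOutput fun w v => F w v ++ G w v := fun ℓ b hℓ => by
  obtain ⟨p, k, hp⟩ := hF ℓ b hℓ
  obtain ⟨p', k', hp'⟩ := hG ℓ b hℓ
  refine ⟨p.bind fun _ => p', max k k', fun w v L m c h hm hc hv => ?_⟩
  obtain ⟨c₁, h₁, h₂, h₃, h₄⟩ := hp w v L m c h ((h.pow_le (le_max_left _ _)).trans_lt hm) hc hv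
  obtain ⟨c₂, h₁', h₂', h₃', h₄'⟩ := hp' w v L m c₁ h ((h.pow_le (le_max_right _ _)).trans_lt hm) h₂
    (fun i => by rw [h₄ _ (hℓ i)]; exact hv i)
  exact ⟨c₂, h₁.bind h₁', h₂', by rw [h₃', h₃, List.append_assoc],
    fun j hj => (h₄' j hj).trans (h₄ j hj)⟩

theorem single (o : O) : LogspaceOutput fun (_ : List I) (_ : Fin n → ℕ) => [o] := fun _ _ _ =>
  ⟨Frag.emitSymbol o, 0, fun _ _ _ m _ _ _ hc _ => ⟨_, Frag.runs_emitSymbol o hc.1 (hc.lt m), hc,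
    rfl, fun _ _ => rfl⟩⟩

theorem bits (g : Bool → O) {f : List I → (Fin n → ℕ) → ℕ} (hf : LogspaceFun O f) :
    LogspaceOutput fun w v => (f w v).bits.map g := fun ℓ b hℓ => by
  obtain ⟨p, k, hp⟩ := hf.run ℓ b (b + 1) (fun i => (hℓ i).trans (Nat.lt_succ_self b))
    (Nat.lt_succ_self b) (fun i => (hℓ i).ne)
  obtain ⟨k', hk'⟩ := hf.bounded
  refine ⟨p.bind fun _ => Frag.emitBits g b, max k k', fun w v L m c h hm hc hv => ?_⟩
  obtain ⟨c₁, h₁, h₂, h₃, h₄, h₅⟩ := hp w v L m c h ((h.pow_le (le_max_left _ _)).trans_lt hm) hc hv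
  exact ⟨_, h₁.bind (Frag.runs_emitBits h₂ h₃
    (((hk' w v L h).trans (h.pow_le (le_max_right _ _))).trans_lt hm)), h₂, by rw [h₄],
    fun j hj => h₅ j (by omega) (by omega)⟩

/-- Concatenation over a range of numbers. -/
theorem flatMap_range {bd : List I → (Fin n → ℕ) → ℕ} {F : List I → (Fin (n + 1) → ℕ) → List O}
    (hbd : LogspaceFun O bd) (hF : LogspaceOutput F) :
    LogspaceOutput fun w v => (List.range (bd w v)).flatMap fun i => F w (Fin.cons i v) :=
  fun ℓ b hℓ => by
  obtain ⟨p₁, k₁, hp₁⟩ := hbd.run ℓ b (b + 1) (fun i => (hℓ i).trans (Nat.lt_succ_self b))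
    (Nat.lt_succ_self b) (fun i => (hℓ i).ne)
  obtain ⟨kb, hkb⟩ := hbd.bounded
  obtain ⟨p₂, k₂, hp₂⟩ := hF (Fin.cons (b + 1) ℓ) (b + 2)
    (Fin.cases (by simp) fun i => by simpa using (hℓ i).trans (by omega))
  set A := kb + 1 with hA
  refine ⟨p₁.bind fun _ => Frag.forLoop (b + 1) b p₂, k₁ + A * k₂ + A,
    fun w v L m c hL hm hc hv => ?_⟩
  have hm' : ∀ {k}, k ≤ k₁ + A * k₂ + A → L ^ k < 2 ^ m := fun hk => (hL.pow_le hk).trans_lt hm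
  have hbA : bd w v ≤ L ^ A := (hkb w v L hL).trans (hL.pow_le (by omega))
  obtain ⟨c₁, h₁, hc₁, hr₁, ho₁, hw₁⟩ := hp₁ w v L m c hL (hm' (by omega)) hc hv
  obtain ⟨c₂, h₂, hc₂, ⟨ho₂, hw₂⟩, -⟩ := Frag.runs_forLoop (i := b + 1) (r := b) (n := bd w v)
    (m := m)
    (by omega) (body := p₂) (w := w) (c := c₁)
    (fun j d => d.out = c.out ++ ((List.range j).flatMap fun i => F w (Fin.cons i v)) ∧
      ∀ t < b, d.work t = c.work t)
    (fun j d T hd => ⟨hd.1, fun t ht => by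
      simpa [Conf.setTape, show t ≠ b + 1 by omega] using hd.2 t ht⟩)
    hc₁ hr₁ (hbA.trans_lt (hm' (by omega)))
    ⟨by simp [ho₁], fun t ht => hw₁ t (by omega) (by omega)⟩
    (fun j hj d hd hi hb hP => by
      have hsz : SizeBound w (Fin.cons j v : Fin (n + 1) → ℕ) (L ^ A) :=
        hL.mono (by omega) (Fin.cases (by simpa using hj.le.trans hbA) fun i => by
          simpa using (hL.le i).trans (hL.le_pow (by omega)))
      obtain ⟨d₁, g₁, hd₁, ho₁, hw₁⟩ := hp₂ w (Fin.cons j v) (L ^ A) m d hsz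
        (by rw [← pow_mul]; exact hm' (by omega)) hd
        (Fin.cases (by simpa using hi) fun i => by
          simp only [Fin.cons_succ]; rw [hP.2 _ (hℓ i)]; exact hv i)
      refine ⟨d₁, g₁, hd₁, hw₁ _ (by omega), hw₁ _ (by omega), ?_, fun t ht => ?_⟩
      · rw [ho₁, hP.1, List.range_succ, List.flatMap_append, List.append_assoc]
        simp
      · rw [hw₁ _ (by omega), hP.2 t ht])
  exact ⟨c₂, h₁.bind h₂, hc₂, ho₂, hw₂⟩

/-- A function with a `LogspaceOutput` description is computable in logarithmic space. -/
theorem logspaceComputable {α β : Type} {encα : α → List I} {encβ : β → List O} {f : α → β}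
    {F : List I → (Fin 0 → ℕ) → List O} (hF : LogspaceOutput F)
    (hf : ∀ x, encβ (f x) = F (encα x) Fin.elim0) : LogspaceComputable encα encβ f := by
  obtain ⟨p, k, hp⟩ := hF Fin.elim0 0 (fun i => i.elim0)
  obtain ⟨t, ht⟩ := p.exists_tapes
  -- with `L = |w| + 2`, numbers below `L ^ k` fit into `k * (log₂ |w| + 2) + 1` digits
  refine ⟨p.toTransducer t ht, 2 * k + 5, fun x => ?_⟩
  set w := encα x
  set N := Nat.log 2 w.length with hN
  have hL : w.length + 2 ≤ 2 ^ (N + 2) := by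
    have : w.length < 2 ^ (N + 1) := Nat.lt_pow_succ_log_self (by omega) w.length
    have h1 : 2 ≤ 2 ^ (N + 1) := Nat.le_self_pow (by omega) 2
    rw [pow_succ]
    omega
  have hpow : (w.length + 2) ^ k < 2 ^ ((2 * k + 5) * (N + 1) - 4) := by
    refine (Nat.pow_le_pow_left hL k).trans_lt ?_
    rw [← pow_mul]
    refine Nat.pow_lt_pow_right (by omega) ?_
    have : (2 * k + 5) * (N + 1) = 2 * (N * k) + 2 * k + 5 * N + 5 := by ring
    have h2 : (N + 2) * k = N * k + 2 * k := by ring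
    omega
  obtain ⟨c, h₁, -, h₂, -⟩ := hp w Fin.elim0 (w.length + 2) _ (Frag.initConf O)
    ⟨by omega, by omega, fun i => i.elim0⟩ hpow ⟨Nat.zero_le _, fun _ => rfl⟩ (fun i => i.elim0)
  rw [Nat.sub_add_cancel (by nlinarith)] at h₁
  have := Frag.Runs.outputsInSpace ht h₁
  rwa [h₂, ← hf, show (Frag.initConf O).out = [] from rfl, List.nil_append] at this

end LogspaceOutput

end LogspaceFun

/-! ### Arithmetic in logarithmic space -/

open Classical in
/-- The least number below `b` with property `P`, or `b` if there is none. -/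
noncomputable def leastBelow (P : ℕ → Prop) : ℕ → ℕ
  | 0 => 0
  | b + 1 => if leastBelow P b = b ∧ ¬ P b then b + 1 else leastBelow P b

theorem leastBelow_spec (P : ℕ → Prop) (b : ℕ) :
    leastBelow P b ≤ b ∧ (∀ j < leastBelow P b, ¬ P j) ∧
    (leastBelow P b < b → P (leastBelow P b)) := by
  induction b with
  | zero => simp [leastBelow]
  | succ b ih =>
    obtain ⟨h₁, h₂, h₃⟩ := ih
    rw [leastBelow]
    split_ifs with hb
    · refine ⟨le_rfl, fun j hj => ?_, fun h => absurd h (lt_irrefl _)⟩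
      rcases Nat.lt_succ_iff_lt_or_eq.1 hj with hj | rfl
      · exact h₂ j (by omega)
      · exact hb.2
    · refine ⟨by omega, h₂, fun h => ?_⟩
      rcases Nat.lt_succ_iff_lt_or_eq.1 h with h | h
      · exact h₃ h
      · rw [h]; by_contra hP; exact hb ⟨h, hP⟩

theorem leastBelow_eq {P : ℕ → Prop} {b k : ℕ} (hk : k ≤ b) (hP : k < b → P k)
    (h : ∀ j < k, ¬ P j) : leastBelow P b = k := by
  obtain ⟨h₁, h₂, h₃⟩ := leastBelow_spec P b
  rcases lt_trichotomy (leastBelow P b) k with hlt | heq | hgt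
  · exact absurd (h₃ (by omega)) (h _ hlt)
  · exact heq
  · exact absurd (hP (by omega)) (h₂ _ hgt)

section LogspaceArith

variable {I O : Type} {n : ℕ}

namespace LogspaceFun

theorem congr {f g : List I → (Fin n → ℕ) → ℕ} (hf : LogspaceFun O f) (h : ∀ w v, f w v = g w v) :
    LogspaceFun O g := by
  obtain rfl : f = g := funext fun w => funext (h w)
  exact hf

theorem const (k : ℕ) : LogspaceFun O fun (_ : List I) (_ : Fin n → ℕ) => k := by
  induction k with
  | zero => exact zero
  | succ k ih => exact ih.succ

theorem add {f g : List I → (Fin n → ℕ) → ℕ} (hf : LogspaceFun O f) (hg : LogspaceFun O g) :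
    LogspaceFun O fun w v => f w v + g w v := by
  have h : LogspaceFun O fun (_ : List I) (v : Fin 2 → ℕ) => v 0 + v 1 := by
    have key : ∀ a i : ℕ, (Nat.rec a (fun _ x => x + 1) i : ℕ) = a + i := by
      intro a i
      induction i with
      | zero => rfl
      | succ i ih => simp only [ih]; rfl
    refine (natRec (f := fun _ v => v 0) (bd := fun _ v => v 1) (h := fun _ u => u 1 + 1)
      (proj 0) (proj 1) (proj 1).succ ⟨2, fun w v L hL i hi => ?_⟩).congr fun w v => key _ _
    refine (key _ _).trans_le ?_
    have h₀ := hL.le 0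
    have h₁ := hL.le 1
    have := Nat.mul_le_mul_left L hL.two_le
    rw [pow_two]
    omega
  exact comp2 (f := fun _ a b => a + b) h hf hg

theorem mul {f g : List I → (Fin n → ℕ) → ℕ} (hf : LogspaceFun O f) (hg : LogspaceFun O g) :
    LogspaceFun O fun w v => f w v * g w v := by
  have h : LogspaceFun O fun (_ : List I) (v : Fin 2 → ℕ) => v 0 * v 1 := by
    have key : ∀ a i : ℕ, (Nat.rec 0 (fun _ x => x + a) i : ℕ) = a * i := by
      intro a i
      induction i with
      | zero => rfl
      | succ i ih => simp only [ih]; rfl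
    refine (natRec (f := fun _ v => 0) (bd := fun _ v => v 1) (h := fun _ u => u 1 + u 2)
      zero (proj 1) ((proj 1).add (proj 2)) ⟨2, fun w v L hL i hi => ?_⟩).congr fun w v => key _ _
    refine (key (v 0) _).trans_le ?_
    rw [pow_two]
    exact Nat.mul_le_mul (hL.le 0) (hi.trans (hL.le 1))
  exact comp2 (f := fun _ a b => a * b) h hf hg

theorem sub {f g : List I → (Fin n → ℕ) → ℕ} (hf : LogspaceFun O f) (hg : LogspaceFun O g) :
    LogspaceFun O fun w v => f w v - g w v := by
  have hpred : LogspaceFun O fun (_ : List I) (v : Fin 1 → ℕ) => v 0 - 1 := by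
    have key : ∀ i : ℕ, (Nat.rec 0 (fun i _ => i) i : ℕ) = i - 1 := by
      intro i
      cases i <;> rfl
    refine (natRec (f := fun _ v => 0) (bd := fun _ v => v 0) (h := fun _ u => u 0)
      zero (proj 0) (proj 0) ⟨1, fun w v L hL i hi => ?_⟩).congr fun w v => key _
    refine (key _).trans_le ?_
    have := hL.le 0
    rw [pow_one]
    omega
  have h : LogspaceFun O fun (_ : List I) (v : Fin 2 → ℕ) => v 0 - v 1 := by
    have key : ∀ a i : ℕ, (Nat.rec a (fun _ x => x - 1) i : ℕ) = a - i := by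
      intro a i
      induction i with
      | zero => rfl
      | succ i ih => simp only [ih]; rfl
    refine (natRec (f := fun _ v => v 0) (bd := fun _ v => v 1) (h := fun _ u => u 1 - 1)
      (proj 0) (proj 1) (comp1 (f := fun _ a => a - 1) hpred (proj 1))
      ⟨1, fun w v L hL i hi => ?_⟩).congr fun w v => key _ _
    refine (key _ _).trans_le ?_
    have := hL.le 0
    rw [pow_one]
    omega
  exact comp2 (f := fun _ a b => a - b) h hf hg

/-- Case distinction on whether a number is zero. -/
theorem casesZero {c f g : List I → (Fin n → ℕ) → ℕ} (hc : LogspaceFun O c) (hf : LogspaceFun O f)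
    (hg : LogspaceFun O g) : LogspaceFun O fun w v => if c w v = 0 then f w v else g w v := by
  have h : LogspaceFun O fun (_ : List I) (v : Fin 3 → ℕ) => if v 0 = 0 then v 1 else v 2 := by
    have key : ∀ a b i : ℕ, (Nat.rec a (fun _ _ => b) i : ℕ) = if i = 0 then a else b := by
      intro a b i
      cases i <;> simp
    refine (natRec (f := fun _ v => v 1) (bd := fun _ v => v 0) (h := fun _ u => u 4)
      (proj 1) (proj 0) (proj 4) ⟨1, fun w v L hL i hi => ?_⟩).congr fun w v => key _ (v 2) _
    refine (key _ (v 2) _).trans_le ?_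
    rw [pow_one]
    split_ifs
    exacts [hL.le 1, hL.le 2]
  exact comp3 (f := fun _ a b c => if a = 0 then b else c) h hc hf hg

end LogspaceFun

/-- A predicate that can be decided in logarithmic space: it says that a certain function in
`LogspaceFun` does not vanish. -/
def LogspacePred (O : Type) (P : List I → (Fin n → ℕ) → Prop) : Prop :=
  ∃ f, LogspaceFun O f ∧ ∀ w v, P w v ↔ f w v ≠ 0

namespace LogspacePred

variable {P Q : List I → (Fin n → ℕ) → Prop} {f g : List I → (Fin n → ℕ) → ℕ}

theorem ite [∀ w v, Decidable (P w v)] (hP : LogspacePred O P) (hf : LogspaceFun O f)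
    (hg : LogspaceFun O g) : LogspaceFun O fun w v => if P w v then f w v else g w v := by
  obtain ⟨c, hc, hcP⟩ := hP
  refine (hc.casesZero hg hf).congr fun w v => ?_
  by_cases h : P w v
  · rw [if_pos h, if_neg ((hcP w v).1 h)]
  · rw [if_neg h, if_pos (by simpa [hcP] using h)]

theorem not (hP : LogspacePred O P) : LogspacePred O fun w v => ¬ P w v := by
  obtain ⟨c, hc, hcP⟩ := hP
  refine ⟨_, hc.casesZero (LogspaceFun.const 1) LogspaceFun.zero, fun w v => ?_⟩
  simp [hcP]

theorem and (hP : LogspacePred O P) (hQ : LogspacePred O Q) :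
    LogspacePred O fun w v => P w v ∧ Q w v := by
  obtain ⟨c, hc, hcP⟩ := hP
  obtain ⟨d, hd, hdQ⟩ := hQ
  exact ⟨_, hc.mul hd, fun w v => by simp [hcP, hdQ]⟩

theorem congr (hP : LogspacePred O P) (h : ∀ w v, P w v ↔ Q w v) : LogspacePred O Q := by
  obtain ⟨c, hc, hcP⟩ := hP
  exact ⟨c, hc, fun w v => (h w v).symm.trans (hcP w v)⟩

theorem or (hP : LogspacePred O P) (hQ : LogspacePred O Q) :
    LogspacePred O fun w v => P w v ∨ Q w v :=
  (hP.not.and hQ.not).not.congr fun _ _ => by tauto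

theorem iff (hP : LogspacePred O P) (hQ : LogspacePred O Q) :
    LogspacePred O fun w v => (P w v ↔ Q w v) :=
  ((hP.and hQ).or (hP.not.and hQ.not)).congr fun _ _ => by tauto

theorem eq (hf : LogspaceFun O f) (hg : LogspaceFun O g) :
    LogspacePred O fun w v => f w v = g w v :=
  (show LogspacePred O fun w v => (f w v - g w v) + (g w v - f w v) ≠ 0 from
    ⟨_, (hf.sub hg).add (hg.sub hf), fun _ _ => Iff.rfl⟩).not.congr fun _ _ => by omega

theorem comp {l : ℕ} {P : List I → (Fin l → ℕ) → Prop} {g : Fin l → List I → (Fin n → ℕ) → ℕ}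
    (hP : LogspacePred O P) (hg : ∀ i, LogspaceFun O (g i)) :
    LogspacePred O fun w v => P w fun i => g i w v := by
  obtain ⟨c, hc, hcP⟩ := hP
  exact ⟨_, hc.comp hg, fun w v => hcP _ _⟩

theorem comp1 {P : List I → ℕ → Prop} (hP : LogspacePred O fun w (v : Fin 1 → ℕ) => P w (v 0))
    (hg : LogspaceFun O g) : LogspacePred O fun w v => P w (g w v) :=
  hP.comp (g := fun _ => g) fun _ => hg

theorem comp2 {P : List I → ℕ → ℕ → Prop}
    (hP : LogspacePred O fun w (v : Fin 2 → ℕ) => P w (v 0) (v 1))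
    (hf : LogspaceFun O f) (hg : LogspaceFun O g) : LogspacePred O fun w v => P w (f w v) (g w v) :=
  hP.comp (g := ![f, g]) fun i => by fin_cases i <;> assumption

/-- Test of the symbol in a given cell of the input tape. -/
theorem cell (S : InputCell I → Prop) :
    LogspacePred O fun (w : List I) (v : Fin 1 → ℕ) => S (inputCell w (v 0)) := by
  classical
  refine ⟨_, LogspaceFun.cell fun x => decide (S x), fun w v => ?_⟩
  by_cases h : S (inputCell w (v 0)) <;> simp [h]

end LogspacePred

/-- Bounded search. -/
theorem LogspaceFun.leastBelow {P : List I → (Fin (n + 1) → ℕ) → Prop}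
    {bd : List I → (Fin n → ℕ) → ℕ} (hP : LogspacePred O P) (hbd : LogspaceFun O bd) :
    LogspaceFun O fun w v => leastBelow (fun i => P w (Fin.cons i v)) (bd w v) := by
  classical
  obtain ⟨k, hk⟩ := hbd.bounded
  have hP' : LogspacePred O fun w (u : Fin (n + 2) → ℕ) =>
      P w (Fin.cons (u 0) fun i => u i.succ.succ) :=
    (hP.comp (g := Fin.cons (fun _ u => u 0) fun i _ u => u i.succ.succ)
      (Fin.cases (by simpa using LogspaceFun.proj 0) fun i => by
        simpa using LogspaceFun.proj i.succ.succ)).congr fun w u => by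
      refine iff_of_eq (congrArg (P w) (funext (Fin.cases ?_ fun i => ?_))) <;> simp
  have key : ∀ w v i, (Nat.rec 0 (fun i x => if x = i ∧ ¬ P w (Fin.cons i v) then i + 1 else x)
      i : ℕ) =
      _root_.leastBelow (fun i => P w (Fin.cons i v)) i := by
    intro w v i
    induction i with
    | zero => rfl
    | succ i ih => simp only [ih, _root_.leastBelow]
  refine (LogspaceFun.natRec (f := fun _ _ => 0) (bd := bd)
    (h := fun w u => if u 1 = u 0 ∧ ¬ P w (Fin.cons (u 0) fun i => u i.succ.succ) then u 0 + 1
      else u 1)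
    LogspaceFun.zero hbd (((LogspacePred.eq (.proj 1) (.proj 0)).and hP'.not).ite
      (LogspaceFun.proj 0).succ (.proj 1)) ⟨k, fun w v L hL i hi => ?_⟩).congr fun w v => ?_
  · refine le_trans ?_ (hi.trans (hk w v L hL))
    exact (key w v i).trans_le (leastBelow_spec _ _).1
  · exact key w v _

theorem LogspacePred.forall_lt {P : List I → (Fin (n + 1) → ℕ) → Prop}
    {bd : List I → (Fin n → ℕ) → ℕ} (hP : LogspacePred O P) (hbd : LogspaceFun O bd) :
    LogspacePred O fun w v => ∀ i < bd w v, P w (Fin.cons i v) := by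
  refine (LogspacePred.eq (LogspaceFun.leastBelow hP.not hbd) hbd).congr fun w v => ?_
  obtain ⟨h₁, h₂, h₃⟩ := leastBelow_spec (fun i => ¬ P w (Fin.cons i v)) (bd w v)
  refine ⟨fun h i hi => not_not.1 (h₂ i (by omega)), fun h => ?_⟩
  by_contra hne
  exact h₃ (by omega) (h _ (by omega))

/-- Number of the numbers below a bound that have a certain property. -/
theorem LogspaceFun.count {P : List I → (Fin (n + 1) → ℕ) → Prop}
    [∀ w v, DecidablePred fun i => P w (Fin.cons i v)]
    {bd : List I → (Fin n → ℕ) → ℕ} (hP : LogspacePred O P) (hbd : LogspaceFun O bd) :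
    LogspaceFun O fun w v => Nat.count (fun i => P w (Fin.cons i v)) (bd w v) := by
  classical
  obtain ⟨k, hk⟩ := hbd.bounded
  have hP' : LogspacePred O fun w (u : Fin (n + 2) → ℕ) =>
      P w (Fin.cons (u 0) fun i => u i.succ.succ) :=
    (hP.comp (g := Fin.cons (fun _ u => u 0) fun i _ u => u i.succ.succ)
      (Fin.cases (by simpa using LogspaceFun.proj 0) fun i => by
        simpa using LogspaceFun.proj i.succ.succ)).congr fun w u => by
      refine iff_of_eq (congrArg (P w) (funext (Fin.cases ?_ fun i => ?_))) <;> simp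
  have key : ∀ w v i, (Nat.rec 0 (fun i x => x + if P w (Fin.cons i v) then 1 else 0) i : ℕ) =
      Nat.count (fun i => P w (Fin.cons i v)) i := by
    intro w v i
    induction i with
    | zero => simp
    | succ i ih => rw [Nat.count_succ, ← ih]
  refine (LogspaceFun.natRec (f := fun _ _ => 0) (bd := bd)
    (h := fun w u => u 1 + if P w (Fin.cons (u 0) fun i => u i.succ.succ) then 1 else 0)
    LogspaceFun.zero hbd ((LogspaceFun.proj 1).add (hP'.ite (.const 1) .zero))
      ⟨k, fun w v L hL i hi => ?_⟩).congr fun w v => ?_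
  · refine le_trans ?_ (hi.trans (hk w v L hL))
    exact (key w v i).trans_le (Nat.count_le _)
  · exact key w v _

namespace LogspaceOutput

theorem congr {F G : List I → (Fin n → ℕ) → List O} (hF : LogspaceOutput F)
    (h : ∀ w v, F w v = G w v) : LogspaceOutput G := by
  obtain rfl : F = G := funext fun w => funext (h w)
  exact hF

end LogspaceOutput

end LogspaceArith

/-! ### Reading a circuit from its word -/

namespace CircuitWord

/-- The token at position `p` is a bit. -/
def BitAt (w : List (Token ArithLabel)) (p : ℕ) : Prop := ∃ b, w[p]? = some (.bit b)

/-- The token at position `p` is a gate label. -/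
def LabelAt (w : List (Token ArithLabel)) (p : ℕ) : Prop := ∃ l, w[p]? = some (.label l)

open Classical in
/-- The number of gates. -/
noncomputable def gateCount (w : List (Token ArithLabel)) : ℕ := Nat.count (LabelAt w) w.length

open Classical in
/-- The position of the label of gate `i`. -/
noncomputable def labelPos (w : List (Token ArithLabel)) (i : ℕ) : ℕ :=
  leastBelow (fun p => LabelAt w p ∧ Nat.count (LabelAt w) p = i) w.length

/-- Gate `i` has the label `l`. -/
def HasLabel (l : ArithLabel) (w : List (Token ArithLabel)) (i : ℕ) : Prop :=
  w[labelPos w i]? = some (.label l)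

/-- The number of consecutive bits from position `p` on. -/
noncomputable def blockLen (w : List (Token ArithLabel)) (p : ℕ) : ℕ :=
  leastBelow (fun k => ¬ BitAt w (p + k)) w.length

open Classical in
/-- The number whose binary digits, least significant digit first, are the consecutive bits from
position `p` on. The intermediate results of the Horner scheme are truncated at the length of the
word, so that they stay polynomially bounded even if the bits form the index of a variable. -/
noncomputable def blockVal (w : List (Token ArithLabel)) (p : ℕ) : ℕ :=
  Nat.rec 0 (fun i x => min (2 * x +
    if w[p + (blockLen w p - 1 - i)]? = some (.bit true) then 1 else 0) w.length) (blockLen w p)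

/-- The position after the first comma behind the label of gate `i`. -/
noncomputable def argPos (w : List (Token ArithLabel)) (i : ℕ) : ℕ := labelPos w i + 2

/-- The first argument of gate `i`. -/
noncomputable def fstArg (w : List (Token ArithLabel)) (i : ℕ) : ℕ := blockVal w (argPos w i)

/-- The second argument of gate `i`. -/
noncomputable def sndArg (w : List (Token ArithLabel)) (i : ℕ) : ℕ :=
  blockVal w (argPos w i + blockLen w (argPos w i) + 1)

/-- The blocks of bits that start at the positions `p` and `q` are equal. Indices of variables are
compared in this way, since they need not be polynomially bounded in the length of the word. -/
def BlockEq (w : List (Token ArithLabel)) (p q : ℕ) : Prop :=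
  blockLen w p = blockLen w q ∧
    ∀ k < blockLen w p, (w[p + k]? = some (.bit true) ↔ w[q + k]? = some (.bit true))

/-- The first gate that is labelled with the same variable as gate `i`. -/
noncomputable def firstVar (w : List (Token ArithLabel)) (i : ℕ) : ℕ :=
  leastBelow (fun j => HasLabel .var w j ∧ BlockEq w (argPos w i) (argPos w j)) (gateCount w)

/-! ### These functions are computable in logarithmic space -/

section Logspace

variable {O : Type} {n : ℕ} {f g : List (Token ArithLabel) → (Fin n → ℕ) → ℕ}

/-- Test of the token at a given position. -/
theorem logspacePred_token (S : Token ArithLabel → Prop) (hf : LogspaceFun O f) :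
    LogspacePred O fun w v => ∃ t, w[f w v]? = some t ∧ S t := by
  have h := LogspacePred.cell (O := O) fun x : InputCell (Token ArithLabel) =>
    match x with | .symbol t => S t | _ => False
  refine (LogspacePred.comp1 (P := fun w p => match inputCell w p with
    | .symbol t => S t | _ => False) h hf.succ).congr fun w v => ?_
  simp only [inputCell]
  rcases w[f w v]? with _ | t <;> simp

theorem logspacePred_eq_token (t : Token ArithLabel) (hf : LogspaceFun O f) :
    LogspacePred O fun w v => w[f w v]? = some t :=
  (logspacePred_token (fun t' => t' = t) hf).congr fun w v => by simp

theorem logspacePred_bitAt (hf : LogspaceFun O f) : LogspacePred O fun w v => BitAt w (f w v) :=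
  (logspacePred_token (fun t => ∃ b, t = .bit b) hf).congr fun w v => by
    constructor
    · rintro ⟨_, h, b, rfl⟩; exact ⟨b, h⟩
    · rintro ⟨b, h⟩; exact ⟨_, h, b, rfl⟩

theorem logspacePred_labelAt (hf : LogspaceFun O f) : LogspacePred O fun w v => LabelAt w (f w v) :=
  (logspacePred_token (fun t => ∃ b, t = .label b) hf).congr fun w v => by
    constructor
    · rintro ⟨_, h, b, rfl⟩; exact ⟨b, h⟩
    · rintro ⟨b, h⟩; exact ⟨_, h, b, rfl⟩

theorem logspaceFun_gateCount : LogspaceFun O fun w (_ : Fin n → ℕ) => gateCount w := by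
  classical
  exact (LogspaceFun.count (P := fun w u => LabelAt w (u 0)) (logspacePred_labelAt (.proj 0))
    .length).congr fun w v => by simp only [gateCount, Fin.cons_zero]

theorem logspaceFun_labelPos (hf : LogspaceFun O f) :
    LogspaceFun O fun w v => labelPos w (f w v) := by
  classical
  have hcount : LogspaceFun O fun w (v : Fin 1 → ℕ) => Nat.count (LabelAt w) (v 0) :=
    (LogspaceFun.count (P := fun w u => LabelAt w (u 0)) (logspacePred_labelAt (.proj 0))
      (.proj 0)).congr fun w v => by simp only [Fin.cons_zero]
  have h : LogspaceFun O fun w (v : Fin 1 → ℕ) => labelPos w (v 0) :=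
    (LogspaceFun.leastBelow (n := 1)
      (P := fun w u => LabelAt w (u 0) ∧ Nat.count (LabelAt w) (u 0) = u 1)
      ((logspacePred_labelAt (.proj 0)).and (.eq
        (LogspaceFun.comp1 (f := fun w p => Nat.count (LabelAt w) p) hcount (.proj 0)) (.proj 1)))
      .length).congr fun w v => by simp only [labelPos]; congr
  exact LogspaceFun.comp1 h hf

theorem logspacePred_hasLabel (l : ArithLabel) (hf : LogspaceFun O f) :
    LogspacePred O fun w v => HasLabel l w (f w v) :=
  logspacePred_eq_token (.label l) (logspaceFun_labelPos hf)

theorem logspaceFun_blockLen (hf : LogspaceFun O f) :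
    LogspaceFun O fun w v => blockLen w (f w v) := by
  have h : LogspaceFun O fun w (v : Fin 1 → ℕ) => blockLen w (v 0) :=
    (LogspaceFun.leastBelow (n := 1) (P := fun w u => ¬ BitAt w (u 1 + u 0))
      (logspacePred_bitAt ((LogspaceFun.proj 1).add (.proj 0))).not .length).congr fun w v => rfl
  exact LogspaceFun.comp1 h hf

theorem logspaceFun_blockVal (hf : LogspaceFun O f) :
    LogspaceFun O fun w v => blockVal w (f w v) := by
  classical
  have hmin : ∀ {n} {f g : List (Token ArithLabel) → (Fin n → ℕ) → ℕ}, LogspaceFun O f →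
      LogspaceFun O g → LogspaceFun O fun w v => min (f w v) (g w v) := fun hf hg =>
    (hf.sub (hf.sub hg)).congr fun w v => by omega
  have h : LogspaceFun O fun w (v : Fin 1 → ℕ) => blockVal w (v 0) := by
    refine (LogspaceFun.natRec (n := 1) (f := fun _ _ => 0) (bd := fun w v => blockLen w (v 0))
      (h := fun w u => min (2 * u 1 +
        if w[u 2 + (blockLen w (u 2) - 1 - u 0)]? = some (.bit true) then 1 else 0) w.length)
      .zero (logspaceFun_blockLen (.proj 0))
      (hmin (((LogspaceFun.const 2).mul (.proj 1)).add ((logspacePred_eq_token _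
        ((LogspaceFun.proj 2).add (((logspaceFun_blockLen (.proj 2)).sub (.const 1)).sub
          (.proj 0)))).ite (.const 1) .zero)) .length)
      ⟨1, fun w v L hL i hi => ?_⟩).congr fun w v => ?_
    · refine le_trans ?_ (hL.length_le.trans (hL.le_pow le_rfl))
      cases i with
      | zero => exact Nat.zero_le _
      | succ i => exact min_le_right _ _
    · simp only [blockVal]; congr
  exact LogspaceFun.comp1 h hf

theorem logspaceFun_argPos (hf : LogspaceFun O f) : LogspaceFun O fun w v => argPos w (f w v) :=
  (logspaceFun_labelPos hf).add (.const 2)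

theorem logspaceFun_fstArg (hf : LogspaceFun O f) : LogspaceFun O fun w v => fstArg w (f w v) :=
  logspaceFun_blockVal (logspaceFun_argPos hf)

theorem logspaceFun_sndArg (hf : LogspaceFun O f) : LogspaceFun O fun w v => sndArg w (f w v) :=
  logspaceFun_blockVal (((logspaceFun_argPos hf).add
    (logspaceFun_blockLen (logspaceFun_argPos hf))).add (.const 1))

theorem logspacePred_blockEq (hf : LogspaceFun O f) (hg : LogspaceFun O g) :
    LogspacePred O fun w v => BlockEq w (f w v) (g w v) := by
  have h : LogspacePred O fun w (v : Fin 2 → ℕ) => BlockEq w (v 0) (v 1) :=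
    (LogspacePred.eq (logspaceFun_blockLen (.proj 0)) (logspaceFun_blockLen (.proj 1))).and
      (LogspacePred.forall_lt (n := 2) (P := fun w u => (w[u 1 + u 0]? = some (.bit true) ↔
        w[u 2 + u 0]? = some (.bit true))) (bd := fun w v => blockLen w (v 0))
        ((logspacePred_eq_token _ ((LogspaceFun.proj 1).add (.proj 0))).iff
          (logspacePred_eq_token _ ((LogspaceFun.proj 2).add (.proj 0))))
        (logspaceFun_blockLen (.proj 0)))
  exact LogspacePred.comp2 h hf hg

theorem logspaceFun_firstVar (hf : LogspaceFun O f) :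
    LogspaceFun O fun w v => firstVar w (f w v) := by
  have h : LogspaceFun O fun w (v : Fin 1 → ℕ) => firstVar w (v 0) :=
    (LogspaceFun.leastBelow (n := 1)
      (P := fun w u => HasLabel .var w (u 0) ∧ BlockEq w (argPos w (u 1)) (argPos w (u 0)))
      ((logspacePred_hasLabel _ (.proj 0)).and (logspacePred_blockEq
        (logspaceFun_argPos (.proj 1)) (logspaceFun_argPos (.proj 0))))
      logspaceFun_gateCount).congr fun w v => rfl
  exact LogspaceFun.comp1 h hf

end Logspace

/-! ### The values of these functions on the word of a circuit -/

section Spec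

variable {w : List (Token ArithLabel)}

theorem getElem?_of_drop {p : ℕ} {x : List (Token ArithLabel)} (h : w.drop p = x) (k : ℕ) :
    w[p + k]? = x[k]? := by
  rw [← h, List.getElem?_drop]

theorem blockLen_eq {p : ℕ} {l : List Bool} {x : List (Token ArithLabel)}
    (h : w.drop p = l.map .bit ++ x) (hx : ∀ b, x.head? ≠ some (.bit b)) :
    blockLen w p = l.length := by
  have hlen := congrArg List.length h
  simp only [List.length_drop, List.length_append, List.length_map] at hlen
  refine leastBelow_eq (by omega) (fun _ => ?_) (fun j hj => ?_)
  · rintro ⟨b, hb⟩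
    rw [getElem?_of_drop h, List.getElem?_append_right (by simp)] at hb
    simp only [List.length_map, tsub_self] at hb
    exact hx b (by rw [List.head?_eq_getElem?, hb])
  · rw [not_not]
    refine ⟨l[j], ?_⟩
    rw [getElem?_of_drop h, List.getElem?_append_left (by simpa using hj)]
    simp [hj]

theorem getElem?_block {p : ℕ} {l : List Bool} {x : List (Token ArithLabel)}
    (h : w.drop p = l.map .bit ++ x) {k : ℕ} (hk : k < l.length) :
    w[p + k]? = some (.bit true) ↔ l[k] = true := by
  rw [getElem?_of_drop h, List.getElem?_append_left (by simpa using hk)]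
  simp [hk]

theorem blockVal_eq {p v : ℕ} {x : List (Token ArithLabel)}
    (h : w.drop p = v.bits.map .bit ++ x) (hx : ∀ b, x.head? ≠ some (.bit b)) (hv : v ≤ w.length) :
    blockVal w p = v := by
  classical
  have hlen := blockLen_eq h hx
  have key : ∀ i ≤ v.bits.length, (Nat.rec 0 (fun i x => min (2 * x +
      if w[p + (blockLen w p - 1 - i)]? = some (.bit true) then 1 else 0) w.length) i : ℕ) =
      v / 2 ^ (v.bits.length - i) := by
    intro i hi
    induction i with
    | zero =>
      have hv : v < 2 ^ v.bits.length := by rw [Nat.size_eq_bits_len]; exact Nat.lt_size_self v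
      rw [tsub_zero, Nat.div_eq_of_lt hv]
      rfl
    | succ i ih =>
      have ih' := ih (by omega)
      simp only [hlen] at ih' ⊢
      rw [ih']
      have hbit : w[p + (v.bits.length - 1 - i)]? = some (.bit true) ↔
          v.testBit (v.bits.length - (i + 1)) = true := by
        rw [getElem?_block h (by omega), Nat.testBit_eq_inth,
          List.getI_eq_getElem _ (by omega)]
        simp only [show v.bits.length - 1 - i = v.bits.length - (i + 1) by omega]
      simp only [hbit, Nat.testBit_eq_decide_div_mod_eq, decide_eq_true_eq]
      rw [show v.bits.length - i = v.bits.length - (i + 1) + 1 by omega, pow_succ,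
        ← Nat.div_div_eq_div_mul]
      have := Nat.div_le_self v (2 ^ (v.bits.length - (i + 1)))
      split_ifs <;> omega
  have := key _ le_rfl
  rw [tsub_self, pow_zero, Nat.div_one] at this
  rw [blockVal, hlen]
  rw [hlen] at this
  convert this

/-- Two blocks of bits are equal if and only if they are the digits of the same number. -/
theorem blockEq_iff {p q u v : ℕ} {x y : List (Token ArithLabel)}
    (hp : w.drop p = u.bits.map .bit ++ x) (hx : ∀ b, x.head? ≠ some (.bit b))
    (hq : w.drop q = v.bits.map .bit ++ y) (hy : ∀ b, y.head? ≠ some (.bit b)) :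
    BlockEq w p q ↔ u = v := by
  rw [BlockEq, blockLen_eq hp hx, blockLen_eq hq hy]
  constructor
  · rintro ⟨h₁, h₂⟩
    refine natBits_injective (List.ext_getElem h₁ fun k hk hk' => ?_)
    have := h₂ k hk
    rw [getElem?_block hp hk, getElem?_block hq hk'] at this
    exact Bool.eq_iff_iff.2 this
  · rintro rfl
    exact ⟨rfl, fun k hk => by rw [getElem?_block hp hk, getElem?_block hq hk]⟩

/-- Test for labels. -/
def isLabel : Token ArithLabel → Bool
  | .label _ => true
  | _ => false

theorem labelAt_iff {p : ℕ} : LabelAt w p ↔ ∃ t, w[p]? = some t ∧ isLabel t := by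
  constructor
  · rintro ⟨l, h⟩; exact ⟨_, h, rfl⟩
  · rintro ⟨t, h, ht⟩
    cases t <;> simp [isLabel] at ht
    exact ⟨_, h⟩

open Classical in
theorem count_labelAt (p : ℕ) : Nat.count (LabelAt w) p = (w.take p).countP isLabel := by
  induction p with
  | zero => simp
  | succ p ih =>
    rw [Nat.count_succ, ih, List.take_add_one, List.countP_append, labelAt_iff]
    rcases w[p]? with _ | t <;> simp

theorem countP_isLabel_bits (l : List Bool) : (l.map Token.bit).countP isLabel = 0 := by
  simp [List.countP_eq_zero, isLabel]

theorem countP_isLabel_gateWord (g : ArithLabel × List ℕ) : (gateWord g).countP isLabel = 1 := by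
  have : ∀ l : List ℕ, (l.flatMap fun k : ℕ =>
      (Token.comma : Token ArithLabel) :: (Nat.bits k).map .bit).countP isLabel = 0 := by
    intro l
    simp only [List.countP_eq_zero, List.mem_flatMap, List.mem_cons, List.mem_map]
    rintro t ⟨k, -, rfl | ⟨b, -, rfl⟩⟩ <;> simp [isLabel]
  rw [gateWord, List.countP_cons_of_pos (by rfl), this]

theorem countP_isLabel_gates (gs : List (ArithLabel × List ℕ)) :
    (gs.flatMap gateWord).countP isLabel = gs.length := by
  induction gs with
  | nil => rfl
  | cons g gs ih =>
    rw [List.flatMap_cons, List.countP_append, ih, countP_isLabel_gateWord, List.length_cons,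
      add_comm]

variable {out : ℕ} {gs : List (ArithLabel × List ℕ)}

theorem gateCount_eq (hw : w = circuitWord out gs) : gateCount w = gs.length := by
  rw [gateCount, count_labelAt, List.take_length, hw, circuitWord, List.countP_append,
    countP_isLabel_bits, countP_isLabel_gates, zero_add]

/-- The word of gate `i` starts at `labelPos w i`. -/
theorem drop_labelPos (hw : w = circuitWord out gs) {i : ℕ} (hi : i < gs.length) :
    w.drop (labelPos w i) = gateWord gs[i] ++ (gs.drop (i + 1)).flatMap gateWord := by
  classical
  set pre := out.bits.map Token.bit ++ (gs.take i).flatMap gateWord with hpre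
  have hsplit : w = pre ++ (gateWord gs[i] ++ (gs.drop (i + 1)).flatMap gateWord) := by
    rw [hw, circuitWord, hpre, List.append_assoc]
    congr 1
    rw [← List.flatMap_cons, List.getElem_cons_drop, ← List.flatMap_append, List.take_append_drop]
  have hlab : LabelAt w pre.length := by
    refine ⟨gs[i].1, ?_⟩
    rw [hsplit, List.getElem?_append_right le_rfl]
    simp [gateWord]
  have hcount : Nat.count (LabelAt w) pre.length = i := by
    rw [count_labelAt, hsplit, List.take_left, hpre, List.countP_append, countP_isLabel_bits,
      countP_isLabel_gates, List.length_take, zero_add, min_eq_left hi.le]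
  have hpos : labelPos w i = pre.length := by
    refine leastBelow_eq ?_ (fun _ => ⟨hlab, hcount⟩) fun j hj h => ?_
    · rw [hsplit]; simp
    · have := Nat.count_strict_mono h.1 hj
      omega
  rw [hpos]
  nth_rw 1 [hsplit]
  exact List.drop_left

theorem hasLabel_iff (hw : w = circuitWord out gs) {i : ℕ} (hi : i < gs.length) (l : ArithLabel) :
    HasLabel l w i ↔ gs[i].1 = l := by
  have := getElem?_of_drop (drop_labelPos hw hi) 0
  rw [add_zero] at this
  rw [HasLabel, this]
  simp [gateWord]

theorem drop_argPos (hw : w = circuitWord out gs) {i : ℕ} (hi : i < gs.length) {l : ArithLabel}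
    {k : ℕ} {ks : List ℕ} (hg : gs[i] = (l, k :: ks)) :
    w.drop (argPos w i) = k.bits.map .bit ++ ((ks.flatMap fun k : ℕ =>
      .comma :: (Nat.bits k).map .bit) ++ (gs.drop (i + 1)).flatMap gateWord) := by
  rw [argPos, ← List.drop_drop, drop_labelPos hw hi, hg]
  simp [gateWord]

theorem head_args (ks : List ℕ) (gs : List (ArithLabel × List ℕ)) (b : Bool) :
    ((ks.flatMap fun k : ℕ => Token.comma :: (Nat.bits k).map .bit) ++ gs.flatMap gateWord).head? ≠
      some (.bit b) := by
  cases ks with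
  | nil => simpa using (head_gatesWord gs).1 b
  | cons => simp

theorem fstArg_eq (hw : w = circuitWord out gs) {i : ℕ} (hi : i < gs.length) {l : ArithLabel}
    {k : ℕ} {ks : List ℕ} (hg : gs[i] = (l, k :: ks)) (hk : k ≤ w.length) : fstArg w i = k :=
  blockVal_eq (drop_argPos hw hi hg) (head_args _ _) hk

theorem sndArg_eq (hw : w = circuitWord out gs) {i : ℕ} (hi : i < gs.length) {l : ArithLabel}
    {k k' : ℕ} {ks : List ℕ} (hg : gs[i] = (l, k :: k' :: ks)) (hk : k' ≤ w.length) :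
    sndArg w i = k' := by
  have h := drop_argPos hw hi hg
  rw [sndArg, blockLen_eq h (head_args _ _)]
  refine blockVal_eq (x := (ks.flatMap fun k : ℕ => .comma :: (Nat.bits k).map .bit) ++
    (gs.drop (i + 1)).flatMap gateWord) ?_ (head_args _ _) hk
  rw [add_assoc, ← List.drop_drop, h, ← List.drop_drop]
  rw [List.drop_left' (by simp)]
  simp

/-- The first gate with the same variable as a gate with variable `k`. -/
theorem firstVar_spec (hw : w = circuitWord out gs) {i : ℕ} (hi : i < gs.length) {k : ℕ}
    (hg : gs[i] = (.var, [k])) (hargs : ∀ g ∈ gs, g.1 = .var → ∃ k, g = (.var, [k])) :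
    firstVar w i = leastBelow (fun j => gs[j]? = some (.var, [k])) gs.length := by
  obtain ⟨h₁, h₂, h₃⟩ := leastBelow_spec (fun j => gs[j]? = some (.var, [k])) gs.length
  have key : ∀ j < gs.length, (HasLabel .var w j ∧ BlockEq w (argPos w i) (argPos w j)) ↔
      gs[j]? = some (.var, [k]) := by
    intro j hj
    rw [hasLabel_iff hw hj, List.getElem?_eq_getElem hj, Option.some.injEq]
    constructor
    · rintro ⟨hl, hb⟩
      obtain ⟨k', hk'⟩ := hargs _ (List.getElem_mem hj) hl
      rw [blockEq_iff (drop_argPos hw hi hg) (head_args _ _) (drop_argPos hw hj hk')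
        (head_args _ _)] at hb
      rw [hk', hb]
    · intro hj'
      refine ⟨by rw [hj'], ?_⟩
      rw [blockEq_iff (drop_argPos hw hi hg) (head_args _ _) (drop_argPos hw hj hj')
        (head_args _ _)]
  rw [firstVar, gateCount_eq hw]
  exact leastBelow_eq h₁ (fun h => (key _ h).2 (h₃ h)) fun j hj h =>
    h₂ j hj ((key j (by omega)).1 h)

end Spec

end CircuitWord

/-! ### Straight-line programs given by functions on numbers -/

section OfFun

variable {σ : Type}

/-- Replace the variables in a right-hand side by elements of `Fin N`. -/
def SLPRhs.toFin (N : ℕ) (hN : 0 < N) : SLPRhs σ ℕ → SLPRhs σ (Fin N)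
  | .sym a => .sym a
  | .cat B C => .cat ⟨B % N, Nat.mod_lt _ hN⟩ ⟨C % N, Nat.mod_lt _ hN⟩

/-- Label and arguments of a variable whose right-hand side refers to variables by numbers. -/
def SLPRhs.natCode : SLPRhs σ ℕ → SLPLabel σ × List ℕ
  | .sym a => (.sym a, [])
  | .cat B C => (.cat, [B, C])

/-- The straight-line program with right-hand sides `f 0, …, f (N - 1)`. Its acyclicity is witnessed
by an injective rank function `ρ`. -/
def SLP.ofFun (N out : ℕ) (hout : out < N) (f : ℕ → SLPRhs σ ℕ) (ρ : ℕ → ℕ)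
    (hρ : ∀ m < N, ∀ m' < N, ρ m = ρ m' → m = m')
    (hf : ∀ m < N, ∀ x ∈ (f m).gates, x < N ∧ ρ x < ρ m) : SLP σ where
  size := N
  out := ⟨out, hout⟩
  rhs := fun m => (f m).toFin N (by omega)
  acyclic := by
    refine ⟨fun A B => ρ A < ρ B, ?_, fun A B hB => ?_⟩
    · exact
        { trichotomous := fun A B h₁ h₂ => Fin.ext (hρ _ A.2 _ B.2 (by omega))
          irrefl := fun A => lt_irrefl _
          trans := fun A B C => lt_trans }
    · have h := hf A A.2
      cases hA : f A with
      | sym a => simp [hA, SLPRhs.toFin, SLPRhs.gates] at hB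
      | cat x y =>
        simp only [hA, SLPRhs.gates, List.mem_cons, List.not_mem_nil, or_false, forall_eq_or_imp,
          forall_eq] at h
        simp only [hA, SLPRhs.toFin, SLPRhs.gates, List.mem_cons, List.not_mem_nil, or_false] at hB
        rcases hB with rfl | rfl
        · simpa only [Nat.mod_eq_of_lt h.1.1] using h.1.2
        · simpa only [Nat.mod_eq_of_lt h.2.1] using h.2.2

theorem SLP.gateVal_of_sym {P : SLP σ} {A : Fin P.size} {a : σ} (h : P.rhs A = .sym a) :
    P.gateVal A = [a] := by
  rw [SLP.gateVal]
  split <;> simp_all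

theorem SLP.gateVal_of_cat {P : SLP σ} {A B C : Fin P.size} (h : P.rhs A = .cat B C) :
    P.gateVal A = P.gateVal B ++ P.gateVal C := by
  rw [SLP.gateVal]
  split <;> simp_all

variable {N out : ℕ} {hout : out < N} {f : ℕ → SLPRhs σ ℕ} {ρ : ℕ → ℕ}
  {hρ : ∀ m < N, ∀ m' < N, ρ m = ρ m' → m = m'}
  {hf : ∀ m < N, ∀ x ∈ (f m).gates, x < N ∧ ρ x < ρ m}

theorem SLP.encode_ofFun : (SLP.ofFun N out hout f ρ hρ hf).encode =
    circuitWord out ((List.range N).map fun m => (f m).natCode) := by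
  have h : ∀ m : Fin N, ((f m).toFin N (by omega)).code = (f m).natCode := by
    intro m
    have h := hf m m.2
    cases hm : f m with
    | sym a => rfl
    | cat x y =>
      simp only [hm, SLPRhs.gates, List.mem_cons, List.not_mem_nil, or_false, forall_eq_or_imp,
        forall_eq] at h
      simp only [SLPRhs.toFin, SLPRhs.code, SLPRhs.natCode, Nat.mod_eq_of_lt h.1.1,
        Nat.mod_eq_of_lt h.2.1]
  rw [SLP.encode]
  congr 1
  refine List.ext_getElem (by simp [SLP.ofFun]) fun m h₁ h₂ => ?_
  simp only [List.getElem_ofFn, List.getElem_map, List.getElem_range]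
  exact h ⟨m, by simpa [SLP.ofFun] using h₁⟩

theorem SLP.gateVal_ofFun_sym {m : ℕ} (hm : m < N) {a : σ} (h : f m = .sym a) :
    (SLP.ofFun N out hout f ρ hρ hf).gateVal ⟨m, hm⟩ = [a] :=
  SLP.gateVal_of_sym (show (f m).toFin N (by omega) = _ by rw [h]; rfl)

theorem SLP.gateVal_ofFun_cat {m x y : ℕ} (hm : m < N) (hx : x < N) (hy : y < N)
    (h : f m = .cat x y) :
    (SLP.ofFun N out hout f ρ hρ hf).gateVal ⟨m, hm⟩ =
      (SLP.ofFun N out hout f ρ hρ hf).gateVal ⟨x, hx⟩ ++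
        (SLP.ofFun N out hout f ρ hρ hf).gateVal ⟨y, hy⟩ := by
  refine SLP.gateVal_of_cat (show (f m).toFin N (by omega) = _ from ?_)
  rw [h]
  simp only [SLPRhs.toFin, Nat.mod_eq_of_lt hx, Nat.mod_eq_of_lt hy]
  rfl

end OfFun

/-! ### The straight-line program for a skew circuit -/

namespace CircuitWord

/-- The number of powers of `g` in the table at the beginning of the program. -/
noncomputable def tableSize (w : List (Token ArithLabel)) : ℕ :=
  (gateCount w + 1) * (gateCount w + 1) + 1

/-- The number of the first variable of the program that belongs to a gate of the circuit. Before it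
come `h`, `h⁻¹`, the empty product `h h⁻¹`, and alternately the powers `g ^ (2 ^ t)` and their
inverses. -/
noncomputable def gateBase (w : List (Token ArithLabel)) : ℕ := 3 + 2 * tableSize w

/-- The variable of the program for `h ^ v`, or for `h ^ (-v)` if `s` is true, where `v` is the
value of gate `i`. -/
noncomputable def valueRef (s : Bool) (w : List (Token ArithLabel)) (i : ℕ) : ℕ :=
  gateBase w + 4 * i + if s then 3 else 1

/-- Gate `i` is an input gate. -/
def InputGate (w : List (Token ArithLabel)) (i : ℕ) : Prop :=
  ¬ HasLabel .add w i ∧ ¬ HasLabel .mul w i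

/-- The value of variable gate `i` is `a ^ (2 ^ exponent w i)`. -/
noncomputable def exponent (w : List (Token ArithLabel)) (i : ℕ) : ℕ :=
  (gateCount w + 1) * (firstVar w i + 1)

open Classical in
/-- An input gate by which gate `i` multiplies: the gate itself if it is an input gate, and an
argument if it is a multiplication gate. -/
noncomputable def factorGate (w : List (Token ArithLabel)) (i : ℕ) : ℕ :=
  if HasLabel .mul w i then if InputGate w (fstArg w i) then fstArg w i else sndArg w i else i

open Classical in
/-- The argument of multiplication gate `i` that is not `factorGate w i`. -/
noncomputable def cofactorGate (w : List (Token ArithLabel)) (i : ℕ) : ℕ :=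
  if InputGate w (fstArg w i) then sndArg w i else fstArg w i

open Classical in
/-- The variable of the program for the power of `g`, or of its inverse if `s` is true, by which
multiplication by input gate `i` conjugates. -/
noncomputable def powerRef (s : Bool) (w : List (Token ArithLabel)) (i : ℕ) : ℕ :=
  if HasLabel .var w i then 3 + 2 * exponent w i + (if s then 1 else 0) else 2

open Classical in
/-- The variable of the program that is conjugated in a multiplication by input gate `i`, where `p`
stands for the other factor and `q` for its negative. -/
noncomputable def signedRef (w : List (Token ArithLabel)) (i p q : ℕ) : ℕ :=
  if HasLabel .var w i ∨ HasLabel .one w i then p else if HasLabel .negOne w i then q else 2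

open Classical in
/-- The other factor of gate `i`, which is `1` for an input gate, or the negative of this factor. -/
noncomputable def cofactorRef (s : Bool) (w : List (Token ArithLabel)) (i : ℕ) : ℕ :=
  if HasLabel .mul w i then valueRef s w (cofactorGate w i) else if s then 1 else 0

open Classical in
/-- The words for gate `i` are products of three factors; this is the first one. -/
noncomputable def leftRef (s : Bool) (w : List (Token ArithLabel)) (i : ℕ) : ℕ :=
  if HasLabel .add w i then valueRef s w (fstArg w i) else powerRef false w (factorGate w i)

open Classical in
/-- The second factor of a word for gate `i`. -/
noncomputable def midRef (s : Bool) (w : List (Token ArithLabel)) (i : ℕ) : ℕ :=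
  if HasLabel .add w i then valueRef s w (sndArg w i)
  else signedRef w (factorGate w i) (cofactorRef s w i) (cofactorRef (!s) w i)

open Classical in
/-- The third factor of a word for gate `i`. -/
noncomputable def rightRef (w : List (Token ArithLabel)) (i : ℕ) : ℕ :=
  if HasLabel .add w i then 2 else powerRef true w (factorGate w i)

/-- The right-hand side of variable `m` in the program for the circuit with word `w`. -/
noncomputable def slpRhs (w : List (Token ArithLabel)) (m : ℕ) : SLPRhs (GaLetter × Bool) ℕ :=
  if m = 0 then .sym (.h, true)
  else if m = 1 then .sym (.h, false)
  else if m = 2 then .cat 0 1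
  else if m = 3 then .sym (.g, true)
  else if m = 4 then .sym (.g, false)
  else if m < gateBase w then .cat (m - 2) (m - 2)
  else
    let i := (m - gateBase w) / 4
    match (m - gateBase w) % 4 with
    | 0 => .cat (midRef false w i) (rightRef w i)
    | 1 => .cat (leftRef false w i) (m - 1)
    | 2 => .cat (midRef true w i) (rightRef w i)
    | _ => .cat (leftRef true w i) (m - 1)

/-- The number of variables of the program. -/
noncomputable def slpSize (w : List (Token ArithLabel)) : ℕ := gateBase w + 4 * gateCount w

theorem five_le_gateBase (w : List (Token ArithLabel)) : 5 ≤ gateBase w := by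
  simp only [gateBase, tableSize]; omega

theorem slpRhs_table {w : List (Token ArithLabel)} {m : ℕ} (h₁ : 5 ≤ m) (h₂ : m < gateBase w) :
    slpRhs w m = .cat (m - 2) (m - 2) := by
  rw [slpRhs, if_neg (by omega), if_neg (by omega), if_neg (by omega), if_neg (by omega),
    if_neg (by omega), if_pos h₂]

theorem slpRhs_gate {w : List (Token ArithLabel)} (i : ℕ) :
    slpRhs w (gateBase w + 4 * i) = .cat (midRef false w i) (rightRef w i) ∧
    slpRhs w (gateBase w + 4 * i + 1) = .cat (leftRef false w i) (gateBase w + 4 * i) ∧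
    slpRhs w (gateBase w + 4 * i + 2) = .cat (midRef true w i) (rightRef w i) ∧
    slpRhs w (gateBase w + 4 * i + 3) = .cat (leftRef true w i) (gateBase w + 4 * i + 2) := by
  have key : ∀ r < 4, slpRhs w (gateBase w + 4 * i + r) = match r with
      | 0 => .cat (midRef false w i) (rightRef w i)
      | 1 => .cat (leftRef false w i) (gateBase w + 4 * i + r - 1)
      | 2 => .cat (midRef true w i) (rightRef w i)
      | _ => .cat (leftRef true w i) (gateBase w + 4 * i + r - 1) := by
    intro r hr
    have := five_le_gateBase w
    rw [slpRhs, if_neg (by omega), if_neg (by omega), if_neg (by omega), if_neg (by omega),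
      if_neg (by omega), if_neg (by omega)]
    simp only [show (gateBase w + 4 * i + r - gateBase w) / 4 = i by omega,
      show (gateBase w + 4 * i + r - gateBase w) % 4 = r by omega]
  exact ⟨key 0 (by omega), key 1 (by omega), key 2 (by omega), key 3 (by omega)⟩

/-! ### The program is computable in logarithmic space -/

section Logspace

open Classical

variable {O : Type} {n : ℕ} {f g : List (Token ArithLabel) → (Fin n → ℕ) → ℕ}

theorem logspaceFun_gateBase : LogspaceFun O fun w (_ : Fin n → ℕ) => gateBase w :=
  (LogspaceFun.const 3).add ((LogspaceFun.const 2).mul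
    ((logspaceFun_gateCount.succ.mul logspaceFun_gateCount.succ).succ))

theorem logspaceFun_valueRef (s : Bool) (hf : LogspaceFun O f) :
    LogspaceFun O fun w v => valueRef s w (f w v) :=
  (logspaceFun_gateBase.add ((LogspaceFun.const 4).mul hf)).add (.const _)

theorem logspacePred_inputGate (hf : LogspaceFun O f) :
    LogspacePred O fun w v => InputGate w (f w v) :=
  (logspacePred_hasLabel _ hf).not.and (logspacePred_hasLabel _ hf).not

theorem logspaceFun_factorGate (hf : LogspaceFun O f) :
    LogspaceFun O fun w v => factorGate w (f w v) :=
  (logspacePred_hasLabel _ hf).ite ((logspacePred_inputGate (logspaceFun_fstArg hf)).ite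
    (logspaceFun_fstArg hf) (logspaceFun_sndArg hf)) hf

theorem logspaceFun_cofactorGate (hf : LogspaceFun O f) :
    LogspaceFun O fun w v => cofactorGate w (f w v) :=
  (logspacePred_inputGate (logspaceFun_fstArg hf)).ite (logspaceFun_sndArg hf)
    (logspaceFun_fstArg hf)

theorem logspaceFun_powerRef (s : Bool) (hf : LogspaceFun O f) :
    LogspaceFun O fun w v => powerRef s w (f w v) :=
  (logspacePred_hasLabel _ hf).ite (((LogspaceFun.const 3).add ((LogspaceFun.const 2).mul
    (logspaceFun_gateCount.succ.mul (logspaceFun_firstVar hf).succ))).add (.const _)) (.const 2)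

theorem logspaceFun_cofactorRef (s : Bool) (hf : LogspaceFun O f) :
    LogspaceFun O fun w v => cofactorRef s w (f w v) :=
  (logspacePred_hasLabel _ hf).ite (logspaceFun_valueRef s (logspaceFun_cofactorGate hf)) (.const _)

theorem logspaceFun_leftRef (s : Bool) (hf : LogspaceFun O f) :
    LogspaceFun O fun w v => leftRef s w (f w v) :=
  (logspacePred_hasLabel _ hf).ite (logspaceFun_valueRef s (logspaceFun_fstArg hf))
    (logspaceFun_powerRef _ (logspaceFun_factorGate hf))

theorem logspaceFun_midRef (s : Bool) (hf : LogspaceFun O f) :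
    LogspaceFun O fun w v => midRef s w (f w v) :=
  (logspacePred_hasLabel _ hf).ite (logspaceFun_valueRef s (logspaceFun_sndArg hf))
    (((logspacePred_hasLabel _ (logspaceFun_factorGate hf)).or
      (logspacePred_hasLabel _ (logspaceFun_factorGate hf))).ite (logspaceFun_cofactorRef s hf)
      ((logspacePred_hasLabel _ (logspaceFun_factorGate hf)).ite (logspaceFun_cofactorRef _ hf)
        (.const 2)))

theorem logspaceFun_rightRef (hf : LogspaceFun O f) :
    LogspaceFun O fun w v => rightRef w (f w v) :=
  (logspacePred_hasLabel _ hf).ite (.const 2) (logspaceFun_powerRef _ (logspaceFun_factorGate hf))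

theorem logspaceOutput_cat {σ : Type}
    (hf : LogspaceFun (Token (SLPLabel σ)) f) (hg : LogspaceFun (Token (SLPLabel σ)) g) :
    LogspaceOutput fun w v => gateWord (SLPRhs.natCode (.cat (f w v) (g w v) : SLPRhs σ ℕ)) :=
  ((LogspaceOutput.single (.label .cat)).append ((LogspaceOutput.single .comma).append
    ((LogspaceOutput.bits .bit hf).append ((LogspaceOutput.single .comma).append
      (LogspaceOutput.bits .bit hg))))).congr fun w v => by simp [gateWord, SLPRhs.natCode]

theorem logspaceOutput_sym {σ : Type} (a : σ) :
    LogspaceOutput fun (_ : List (Token ArithLabel)) (_ : Fin n → ℕ) =>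
      gateWord (SLPRhs.natCode (.sym a : SLPRhs σ ℕ)) :=
  (LogspaceOutput.single (.label (.sym a))).congr fun w v => by simp [gateWord, SLPRhs.natCode]

theorem map_range_slpRhs {α : Type} (w : List (Token ArithLabel))
    (F : SLPRhs (GaLetter × Bool) ℕ → List α) :
    (List.range (slpSize w)).flatMap (fun m => F (slpRhs w m)) =
      F (.sym (.h, true)) ++ (F (.sym (.h, false)) ++ (F (.cat 0 1) ++ (F (.sym (.g, true)) ++
        (F (.sym (.g, false)) ++ ((List.range (gateBase w - 5)).flatMap (fun k =>
          F (.cat (k + 3) (k + 3))) ++ (List.range (gateCount w)).flatMap fun i =>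
          F (.cat (midRef false w i) (rightRef w i)) ++
          (F (.cat (leftRef false w i) (gateBase w + 4 * i)) ++
          (F (.cat (midRef true w i) (rightRef w i)) ++
          F (.cat (leftRef true w i) (gateBase w + 4 * i + 2))))))))) := by
  have h5 := five_le_gateBase w
  have hgates : ∀ n, (List.range (gateBase w + 4 * n)).flatMap (fun m => F (slpRhs w m)) =
      (List.range (gateBase w)).flatMap (fun m => F (slpRhs w m)) ++
        (List.range n).flatMap fun i =>
          F (.cat (midRef false w i) (rightRef w i)) ++
          (F (.cat (leftRef false w i) (gateBase w + 4 * i)) ++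
          (F (.cat (midRef true w i) (rightRef w i)) ++
          F (.cat (leftRef true w i) (gateBase w + 4 * i + 2)))) := by
    intro n
    induction n with
    | zero => simp
    | succ n ih =>
      obtain ⟨h₀, h₁, h₂, h₃⟩ := slpRhs_gate (w := w) n
      rw [show gateBase w + 4 * (n + 1) = gateBase w + 4 * n + 1 + 1 + 1 + 1 by ring]
      simp only [List.range_succ, List.flatMap_append, ih, List.flatMap_singleton, h₀, h₁, h₂,
        h₃, List.append_assoc]
  rw [slpSize, hgates]
  have htab : (List.range (gateBase w)).flatMap (fun m => F (slpRhs w m)) =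
      (List.range 5).flatMap (fun m => F (slpRhs w m)) ++
        (List.range (gateBase w - 5)).flatMap fun k => F (.cat (k + 3) (k + 3)) := by
    conv_lhs => rw [show gateBase w = 5 + (gateBase w - 5) by omega, List.range_add]
    rw [List.flatMap_append, List.flatMap_map]
    congr 1
    refine List.flatMap_congr fun k hk => ?_
    have := List.mem_range.1 hk
    rw [slpRhs_table (by omega) (by omega), show 5 + k - 2 = k + 3 by omega]
  rw [htab]
  simp [List.range_succ, slpRhs]

/-- The word of the program for a circuit with output gate `blockVal w 0`. -/
theorem logspaceOutput_slp : LogspaceOutput fun w (_ : Fin 0 → ℕ) =>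
    circuitWord (valueRef false w (blockVal w 0))
      ((List.range (slpSize w)).map fun m => (slpRhs w m).natCode) := by
  refine ((LogspaceOutput.bits Token.bit (logspaceFun_valueRef false (logspaceFun_blockVal
    (.const 0)))).append ((logspaceOutput_sym (GaLetter.h, true)).append
    ((logspaceOutput_sym (GaLetter.h, false)).append
    ((logspaceOutput_cat (.const 0) (.const 1)).append
    ((logspaceOutput_sym (GaLetter.g, true)).append
    ((logspaceOutput_sym (GaLetter.g, false)).append ((LogspaceOutput.flatMap_range
      (logspaceFun_gateBase.sub (.const 5))
      (logspaceOutput_cat ((LogspaceFun.proj 0).add (.const 3))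
        ((LogspaceFun.proj 0).add (.const 3)))).append (LogspaceOutput.flatMap_range
      logspaceFun_gateCount
      ((logspaceOutput_cat (logspaceFun_midRef false (.proj 0))
      (logspaceFun_rightRef (.proj 0))).append
      ((logspaceOutput_cat (logspaceFun_leftRef false (.proj 0))
        (logspaceFun_gateBase.add ((LogspaceFun.const 4).mul (.proj 0)))).append
      ((logspaceOutput_cat (logspaceFun_midRef true (.proj 0))
      (logspaceFun_rightRef (.proj 0))).append
      (logspaceOutput_cat (logspaceFun_leftRef true (.proj 0))
        ((logspaceFun_gateBase.add ((LogspaceFun.const 4).mul (.proj 0))).add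
          (.const 2)))))))))))))).congr fun w v => ?_
  rw [circuitWord, List.flatMap_map, map_range_slpRhs w fun r => gateWord r.natCode]
  rfl

end Logspace

end CircuitWord

/-! ### The program for the word of a skew circuit -/

/-- The gates of a circuit can be numbered such that arguments have smaller numbers. -/
theorem ArithCircuit.exists_rank (C : ArithCircuit) : ∃ rk : Fin C.size → ℕ,
    Function.Injective rk ∧ (∀ A, rk A < C.size) ∧ ∀ A B, B ∈ (C.rhs A).gates → rk B < rk A := by
  classical
  obtain ⟨lt, hlt, h⟩ := C.acyclic
  have hmono : ∀ A B, lt B A → (Finset.univ.filter fun D => lt D B).card <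
      (Finset.univ.filter fun D => lt D A).card := by
    intro A B hBA
    refine Finset.card_lt_card ⟨fun D hD => ?_, fun hsub => ?_⟩
    · simp only [Finset.mem_filter, Finset.mem_univ, true_and] at hD ⊢
      exact hlt.trans _ _ _ hD hBA
    · have := hsub (show B ∈ Finset.univ.filter fun D => lt D A by simpa using hBA)
      simp only [Finset.mem_filter, Finset.mem_univ, true_and] at this
      exact hlt.irrefl _ this
  refine ⟨fun A => (Finset.univ.filter fun D => lt D A).card, fun A B hAB => ?_, fun A => ?_,
    fun A B hB => hmono _ _ (h _ _ hB)⟩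
  · refine hlt.trichotomous A B (fun h => ?_) (fun h => ?_)
    · exact absurd hAB (hmono _ _ h).ne
    · exact absurd hAB (hmono _ _ h).ne'
  · have := Finset.card_lt_univ_of_notMem (s := Finset.univ.filter fun D => lt D A) (x := A)
      (by simpa using hlt.irrefl A)
    simpa using this

/-- The first gate that is labelled with the variable `k`. -/
noncomputable def ArithCircuit.varGate (C : ArithCircuit) (k : ℕ) : ℕ :=
  leastBelow (fun j => ∃ h : j < C.size, C.rhs ⟨j, h⟩ = .var k) C.size

theorem ArithCircuit.varGate_spec {C : ArithCircuit} {A : Fin C.size} {k : ℕ}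
    (hA : C.rhs A = .var k) : ∃ h : C.varGate k < C.size, C.rhs ⟨C.varGate k, h⟩ = .var k := by
  obtain ⟨h₁, h₂, h₃⟩ := leastBelow_spec (fun j => ∃ h : j < C.size, C.rhs ⟨j, h⟩ = .var k) C.size
  refine h₃ (lt_of_le_of_ne h₁ fun h => ?_)
  exact h₂ A (by rw [h]; exact A.2) ⟨A.2, hA⟩

namespace CircuitWord

section Circuit

variable (C : ArithCircuit)

theorem encode_eq : C.encode = circuitWord C.out (List.ofFn fun A => (C.rhs A).code) := rfl

theorem gateCount_encode : gateCount C.encode = C.size := by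
  rw [gateCount_eq (encode_eq C), List.length_ofFn]

theorem size_le_length : C.size ≤ C.encode.length := by
  classical
  rw [← gateCount_encode, gateCount]
  exact Nat.count_le _

variable {C}

theorem hasLabel_encode (l : ArithLabel) (A : Fin C.size) :
    HasLabel l C.encode A ↔ (C.rhs A).code.1 = l := by
  rw [hasLabel_iff (encode_eq C) (by simp)]
  simp

theorem blockVal_encode_zero : blockVal C.encode 0 = C.out :=
  blockVal_eq (p := 0) rfl (head_gatesWord _).1 (C.out.2.le.trans (size_le_length C))

theorem args_encode {A B D : Fin C.size} (h : C.rhs A = .add B D ∨ C.rhs A = .mul B D) :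
    fstArg C.encode A = B ∧ sndArg C.encode A = D := by
  have hA : A.1 < (List.ofFn fun A => (C.rhs A).code).length := by simp
  have hB : B.1 ≤ C.encode.length := B.2.le.trans (size_le_length C)
  have hD : D.1 ≤ C.encode.length := D.2.le.trans (size_le_length C)
  rcases h with h | h
  · exact ⟨fstArg_eq (encode_eq C) hA (l := .add) (ks := [D.1]) (by simp [h, ArithRhs.code]) hB,
      sndArg_eq (encode_eq C) hA (l := .add) (k := B.1) (ks := []) (by simp [h, ArithRhs.code]) hD⟩
  · exact ⟨fstArg_eq (encode_eq C) hA (l := .mul) (ks := [D.1]) (by simp [h, ArithRhs.code]) hB,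
      sndArg_eq (encode_eq C) hA (l := .mul) (k := B.1) (ks := []) (by simp [h, ArithRhs.code]) hD⟩

theorem firstVar_encode {A : Fin C.size} {k : ℕ} (h : C.rhs A = .var k) :
    firstVar C.encode A = C.varGate k := by
  rw [firstVar_spec (encode_eq C) (i := A) (k := k) (by simp) (by simp [h, ArithRhs.code]),
    ArithCircuit.varGate, List.length_ofFn]
  · congr 1
    funext j
    rw [eq_iff_iff]
    by_cases hj : j < C.size
    · simp only [List.getElem?_ofFn, hj, dif_pos, Option.some.injEq, exists_true_left]
      cases hr : C.rhs ⟨j, hj⟩ <;> simp [ArithRhs.code]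
    · simp [hj]
  · intro g hg hl
    obtain ⟨A, rfl⟩ := List.mem_ofFn.1 hg
    revert hl
    cases C.rhs A <;> simp [ArithRhs.code]

theorem inputGate_encode {A : Fin C.size} : InputGate C.encode A ↔ (C.rhs A).IsInput := by
  rw [InputGate, hasLabel_encode, hasLabel_encode]
  cases C.rhs A <;> simp [ArithRhs.code, ArithRhs.IsInput]

/-- The exponent `t` such that the variable `k` of the circuit is replaced by `a ^ (2 ^ t)`. -/
noncomputable def varExponent (C : ArithCircuit) (k : ℕ) : ℕ := (C.size + 1) * (C.varGate k + 1)

theorem exponent_encode {A : Fin C.size} {k : ℕ} (h : C.rhs A = .var k) :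
    exponent C.encode A = varExponent C k := by
  rw [exponent, gateCount_encode, firstVar_encode h, varExponent]

theorem powerRef_var {A : Fin C.size} {k : ℕ} (h : C.rhs A = .var k) (s : Bool) :
    powerRef s C.encode A = 3 + 2 * varExponent C k + if s then 1 else 0 := by
  rw [powerRef, if_pos ((hasLabel_encode _ _).2 (by rw [h]; rfl)), exponent_encode h]

theorem powerRef_const {A : Fin C.size} (h : ∀ k, C.rhs A ≠ .var k) (s : Bool) :
    powerRef s C.encode A = 2 := by
  rw [powerRef, if_neg]
  rw [hasLabel_encode]
  cases hA : C.rhs A <;> simp_all [ArithRhs.code]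

theorem refs_input {A : Fin C.size} (h : (C.rhs A).IsInput) (s : Bool) :
    leftRef s C.encode A = powerRef false C.encode A ∧
    midRef s C.encode A = signedRef C.encode A (if s then 1 else 0) (if s then 0 else 1) ∧
    rightRef C.encode A = powerRef true C.encode A := by
  obtain ⟨h₁, h₂⟩ := inputGate_encode.2 h
  rw [leftRef, midRef, rightRef, if_neg h₁, if_neg h₁, if_neg h₁, factorGate, if_neg h₂,
    cofactorRef,
    cofactorRef, if_neg h₂, if_neg h₂]
  cases s <;> simp

theorem refs_add {A B D : Fin C.size} (h : C.rhs A = .add B D) (s : Bool) :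
    leftRef s C.encode A = valueRef s C.encode B ∧ midRef s C.encode A = valueRef s C.encode D ∧
    rightRef C.encode A = 2 := by
  have h₁ : HasLabel .add C.encode A := (hasLabel_encode _ _).2 (by rw [h]; rfl)
  obtain ⟨h₂, h₃⟩ := args_encode (.inl h)
  rw [leftRef, midRef, rightRef, if_pos h₁, if_pos h₁, if_pos h₁, h₂, h₃]
  exact ⟨rfl, rfl, rfl⟩

theorem refs_mul {A B D : Fin C.size} (h : C.rhs A = .mul B D)
    (hskew : (C.rhs B).IsInput ∨ (C.rhs D).IsInput) :
    ∃ x y, (C.rhs x).IsInput ∧ (x = B ∧ y = D ∨ x = D ∧ y = B) ∧ ∀ s,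
      leftRef s C.encode A = powerRef false C.encode x ∧
      midRef s C.encode A =
        signedRef C.encode x (valueRef s C.encode y) (valueRef (!s) C.encode y) ∧
      rightRef C.encode A = powerRef true C.encode x := by
  have h₁ : ¬ HasLabel .add C.encode A := by rw [hasLabel_encode, h]; simp [ArithRhs.code]
  have h₂ : HasLabel .mul C.encode A := (hasLabel_encode _ _).2 (by rw [h]; rfl)
  obtain ⟨hB, hD⟩ := args_encode (.inr h)
  by_cases hin : (C.rhs B).IsInput
  · refine ⟨B, D, hin, .inl ⟨rfl, rfl⟩, fun s => ?_⟩
    rw [leftRef, midRef, rightRef, if_neg h₁, if_neg h₁, if_neg h₁, factorGate, if_pos h₂,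
      cofactorRef,
      cofactorRef, if_pos h₂, if_pos h₂, cofactorGate, hB, hD, if_pos (inputGate_encode.2 hin),
      if_pos (inputGate_encode.2 hin)]
    exact ⟨rfl, rfl, rfl⟩
  · refine ⟨D, B, hskew.resolve_left hin, .inr ⟨rfl, rfl⟩, fun s => ?_⟩
    rw [leftRef, midRef, rightRef, if_neg h₁, if_neg h₁, if_neg h₁, factorGate, if_pos h₂,
      cofactorRef,
      cofactorRef, if_pos h₂, if_pos h₂, cofactorGate, hB, hD, if_neg (inputGate_encode.not.2 hin),
      if_neg (inputGate_encode.not.2 hin)]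
    exact ⟨rfl, rfl, rfl⟩

theorem powerRef_lt (s : Bool) (w : List (Token ArithLabel)) (i : ℕ) :
    powerRef s w i < gateBase w := by
  have h := (leastBelow_spec (fun j => HasLabel .var w j ∧ BlockEq w (argPos w i) (argPos w j))
    (gateCount w)).1
  have h' : exponent w i < tableSize w :=
    Nat.lt_succ_of_le (Nat.mul_le_mul_left _ (Nat.succ_le_succ h))
  rw [powerRef, gateBase]
  split_ifs <;> omega

/-- The references in the variables for gate `A` lead to the table or to arguments of `A`. -/
theorem refs_cases (hC : C.IsSkew) (A : Fin C.size) {x : ℕ} {s : Bool}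
    (hx : x = leftRef s C.encode A ∨ x = midRef s C.encode A ∨ x = rightRef C.encode A) :
    x < gateBase C.encode ∨ ∃ t, ∃ B ∈ (C.rhs A).gates, x = valueRef t C.encode B := by
  have h5 := five_le_gateBase C.encode
  have hinput : (C.rhs A).IsInput → x < gateBase C.encode := by
    intro h
    obtain ⟨h₁, h₂, h₃⟩ := refs_input h s
    rcases hx with rfl | rfl | rfl
    · rw [h₁]; exact powerRef_lt _ _ _
    · rw [h₂, signedRef]
      split_ifs <;> omega
    · rw [h₃]; exact powerRef_lt _ _ _
  cases hA : C.rhs A with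
  | add B D =>
    obtain ⟨h₁, h₂, h₃⟩ := refs_add hA s
    rcases hx with rfl | rfl | rfl
    · exact .inr ⟨s, B, by simp [ArithRhs.gates], h₁⟩
    · exact .inr ⟨s, D, by simp [ArithRhs.gates], h₂⟩
    · exact .inl (by omega)
  | mul B D =>
    obtain ⟨y, z, -, hyz, h⟩ := refs_mul hA (hC _ _ _ hA)
    obtain ⟨h₁, h₂, h₃⟩ := h s
    have hz : z ∈ (ArithRhs.mul B D).gates := by
      rcases hyz with ⟨-, rfl⟩ | ⟨-, rfl⟩ <;> simp [ArithRhs.gates]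
    rcases hx with rfl | rfl | rfl
    · rw [h₁]; exact .inl (powerRef_lt _ _ _)
    · rw [h₂, signedRef]
      split_ifs
      · exact .inr ⟨s, z, hz, rfl⟩
      · exact .inr ⟨!s, z, hz, rfl⟩
      · exact .inl (by omega)
    · rw [h₃]; exact .inl (powerRef_lt _ _ _)
  | _ => exact .inl (hinput (by rw [hA]; trivial))

theorem slpSize_encode (C : ArithCircuit) :
    slpSize C.encode = gateBase C.encode + 4 * C.size := by
  rw [slpSize, gateCount_encode]

theorem valueRef_lt (s : Bool) (A : Fin C.size) : valueRef s C.encode A < slpSize C.encode := by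
  rw [valueRef, slpSize_encode]
  split_ifs <;> omega

/-- The references of the program are acyclic. -/
theorem exists_slpRank (hC : C.IsSkew) : ∃ ρ : ℕ → ℕ,
    (∀ m < slpSize C.encode, ∀ m' < slpSize C.encode, ρ m = ρ m' → m = m') ∧
    ∀ m < slpSize C.encode, ∀ x ∈ (slpRhs C.encode m).gates,
      x < slpSize C.encode ∧ ρ x < ρ m := by
  obtain ⟨rk, hinj, -, hlt⟩ := C.exists_rank
  have h5 := five_le_gateBase C.encode
  rw [slpSize_encode]
  generalize hb : gateBase C.encode = b
  rw [hb] at h5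
  -- the gates of the circuit are reordered by `rk`, in blocks of four
  let rk' : ℕ → ℕ := fun i => if h : i < C.size then rk ⟨i, h⟩ else 0
  have hrk' : ∀ A : Fin C.size, rk' A = rk A := fun A => by simp [rk']
  let ρ : ℕ → ℕ := fun m => if m < b then m else b + 4 * rk' ((m - b) / 4) + (m - b) % 4
  have hρ₁ : ∀ m < b, ρ m = m := fun m hm => if_pos hm
  have hρ₂ : ∀ (A : Fin C.size) r, r < 4 → ρ (b + 4 * A + r) = b + 4 * rk A + r := by
    intro A r hr
    simp only [ρ]
    rw [if_neg (by omega), show (b + 4 * A + r - b) / 4 = A by omega,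
      show (b + 4 * A + r - b) % 4 = r by omega, hrk']
  have hsplit : ∀ m < b + 4 * C.size, m < b ∨ ∃ (A : Fin C.size) (r : ℕ), r < 4 ∧
      m = b + 4 * A + r := by
    intro m hm
    by_cases h : m < b
    · exact .inl h
    · exact .inr ⟨⟨(m - b) / 4, by omega⟩, (m - b) % 4, by omega, by simp only; omega⟩
  refine ⟨ρ, fun m hm m' hm' h => ?_, fun m hm x hx => ?_⟩
  · rcases hsplit m hm with h₁ | ⟨A, r, hr, rfl⟩ <;>
      rcases hsplit m' hm' with h₂ | ⟨A', r', hr', rfl⟩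
    · rwa [hρ₁ _ h₁, hρ₁ _ h₂] at h
    · rw [hρ₁ _ h₁, hρ₂ _ _ hr'] at h; omega
    · rw [hρ₁ _ h₂, hρ₂ _ _ hr] at h; omega
    · rw [hρ₂ _ _ hr, hρ₂ _ _ hr'] at h
      obtain rfl : r = r' := by omega
      rw [hinj (show rk A = rk A' by omega)]
  · rcases hsplit m hm with h₁ | ⟨A, r, hr, rfl⟩
    · have hx' : x < m := by
        rw [slpRhs] at hx
        split_ifs at hx <;> simp [SLPRhs.gates] at hx <;> omega
      refine ⟨by omega, ?_⟩
      rw [hρ₁ _ h₁, hρ₁ _ (by omega)]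
      exact hx'
    · have hcase : (x < b ∨ ∃ t, ∃ B ∈ (C.rhs A).gates, x = valueRef t C.encode B) ∨
          ∃ r' < r, x = b + 4 * A + r' := by
        have hrefs := fun s hx => refs_cases (s := s) (x := x) hC A hx
        rw [hb] at hrefs
        obtain ⟨h₀, h₁, h₂, h₃⟩ := slpRhs_gate (w := C.encode) A
        rw [hb] at h₀ h₁ h₂ h₃
        interval_cases r
        · rw [add_zero, h₀] at hx
          simp only [SLPRhs.gates, List.mem_cons, List.not_mem_nil, or_false] at hx
          exact .inl (hrefs false (.inr hx))
        · rw [h₁] at hx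
          simp only [SLPRhs.gates, List.mem_cons, List.not_mem_nil, or_false] at hx
          rcases hx with hx | hx
          · exact .inl (hrefs false (.inl hx))
          · exact .inr ⟨0, by omega, hx⟩
        · rw [h₂] at hx
          simp only [SLPRhs.gates, List.mem_cons, List.not_mem_nil, or_false] at hx
          exact .inl (hrefs true (.inr hx))
        · rw [h₃] at hx
          simp only [SLPRhs.gates, List.mem_cons, List.not_mem_nil, or_false] at hx
          rcases hx with hx | hx
          · exact .inl (hrefs true (.inl hx))
          · exact .inr ⟨2, by omega, hx⟩
      rcases hcase with (hx | ⟨t, B, hB, rfl⟩) | ⟨r', hr', rfl⟩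
      · refine ⟨by omega, ?_⟩
        rw [hρ₁ _ hx, hρ₂ _ _ hr]
        omega
      · have hval : valueRef t C.encode B = b + 4 * B + if t then 3 else 1 := by rw [valueRef, hb]
        rw [hval, hρ₂ _ _ hr, hρ₂ _ _ (by split_ifs <;> omega)]
        have := hlt _ _ hB
        refine ⟨?_, ?_⟩ <;> split_ifs <;> omega
      · refine ⟨by omega, ?_⟩
        rw [hρ₂ _ _ hr, hρ₂ _ _ (by omega)]
        omega

end Circuit

end CircuitWord

/-! ### The matrix represented by the program -/

/-- The matrix `[[u, v], [0, 1]]`. -/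
def affMatrix (u v : ℝ) : Matrix (Fin 2) (Fin 2) ℝ := !![u, v; 0, 1]

theorem affMatrix_mul (u v u' v' : ℝ) :
    affMatrix u v * affMatrix u' v' = affMatrix (u * u') (u * v' + v) := by
  simp [affMatrix]

theorem affMatrix_one_zero : affMatrix 1 0 = 1 := by
  simp [affMatrix, Matrix.one_fin_two]

/-- The matrix represented by a word over the generators of `G_a`. -/
noncomputable def wordMatrix (a : ℝ) (ha : 2 ≤ a) (u : List (GaLetter × Bool)) :
    Matrix (Fin 2) (Fin 2) ℝ :=
  (((evalWord (gaGen a ha) u : groupGa a ha) : GL (Fin 2) ℝ) : Matrix (Fin 2) (Fin 2) ℝ)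

section

variable {a : ℝ} {ha : 2 ≤ a}

theorem wordMatrix_append (u v : List (GaLetter × Bool)) :
    wordMatrix a ha (u ++ v) = wordMatrix a ha u * wordMatrix a ha v := by
  simp [wordMatrix, evalWord]

theorem wordMatrix_eq_one_iff {u : List (GaLetter × Bool)} :
    wordMatrix a ha u = 1 ↔ evalWord (gaGen a ha) u = 1 := by
  rw [wordMatrix, ← Units.val_one, Units.val_inj, OneMemClass.coe_eq_one]

theorem wordMatrix_h : wordMatrix a ha [(.h, true)] = affMatrix 1 1 := by
  simp only [wordMatrix, evalWord, List.map_cons, List.map_nil, List.prod_singleton, if_true]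
  rfl

theorem wordMatrix_g : wordMatrix a ha [(.g, true)] = affMatrix a 0 := by
  simp only [wordMatrix, evalWord, List.map_cons, List.map_nil, List.prod_singleton, if_true]
  rfl

theorem wordMatrix_inv (x : GaLetter) :
    wordMatrix a ha [(x, true)] * wordMatrix a ha [(x, false)] = 1 := by
  rw [← wordMatrix_append, wordMatrix_eq_one_iff]
  simp [evalWord]

theorem affMatrix_right_inv {u v : ℝ} (hu : u ≠ 0) {M : Matrix (Fin 2) (Fin 2) ℝ}
    (h : affMatrix u v * M = 1) : M = affMatrix u⁻¹ (-(u⁻¹ * v)) := by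
  have h' : affMatrix u⁻¹ (-(u⁻¹ * v)) * affMatrix u v = 1 := by
    rw [affMatrix_mul, inv_mul_cancel₀ hu, add_neg_cancel, affMatrix_one_zero]
  calc M = affMatrix u⁻¹ (-(u⁻¹ * v)) * (affMatrix u v * M) := by rw [← mul_assoc, h', one_mul]
    _ = _ := by rw [h, mul_one]

theorem wordMatrix_h_inv : wordMatrix a ha [(.h, false)] = affMatrix 1 (-1) := by
  have h := wordMatrix_inv (a := a) (ha := ha) .h
  rw [wordMatrix_h] at h
  simpa using affMatrix_right_inv one_ne_zero h

theorem wordMatrix_g_inv : wordMatrix a ha [(.g, false)] = affMatrix a⁻¹ 0 := by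
  have h := wordMatrix_inv (a := a) (ha := ha) .g
  rw [wordMatrix_g] at h
  simpa using affMatrix_right_inv (by linarith) h

end

namespace CircuitWord

/-- The value of a gate under the substitution that replaces the variable `k` by
`a ^ (2 ^ varExponent C k)`. -/
noncomputable def realVal (a : ℝ) (C : ArithCircuit) (A : Fin C.size) : ℝ :=
  MvPolynomial.aeval (fun k => a ^ 2 ^ varExponent C k) (C.gateVal ℤ A)

section GateVal

variable {C : ArithCircuit} {A B D : Fin C.size} {R : Type} [CommRing R]

theorem gateVal_var {k : ℕ} (h : C.rhs A = .var k) : C.gateVal R A = MvPolynomial.X k := by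
  rw [ArithCircuit.gateVal]; split <;> simp_all

theorem gateVal_negOne (h : C.rhs A = .negOne) : C.gateVal R A = -1 := by
  rw [ArithCircuit.gateVal]; split <;> simp_all

theorem gateVal_zero (h : C.rhs A = .zero) : C.gateVal R A = 0 := by
  rw [ArithCircuit.gateVal]; split <;> simp_all

theorem gateVal_one (h : C.rhs A = .one) : C.gateVal R A = 1 := by
  rw [ArithCircuit.gateVal]; split <;> simp_all

theorem gateVal_add (h : C.rhs A = .add B D) :
    C.gateVal R A = C.gateVal R B + C.gateVal R D := by
  rw [ArithCircuit.gateVal]; split <;> simp_all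

theorem gateVal_mul (h : C.rhs A = .mul B D) :
    C.gateVal R A = C.gateVal R B * C.gateVal R D := by
  rw [ArithCircuit.gateVal]; split <;> simp_all

end GateVal

/-- The sign of the two words that belong to a gate. -/
def sign (s : Bool) : ℝ := if s then -1 else 1

/-- A family of matrices that is compatible with the right-hand sides of the program; `M m` is the
matrix for variable `m`, and the variables `0`, `1`, `3`, `4` produce `h`, `h⁻¹`, `g`, `g⁻¹`. -/
structure IsEvaluation (a : ℝ) (C : ArithCircuit) (M : ℕ → Matrix (Fin 2) (Fin 2) ℝ) : Prop where
  zero : M 0 = affMatrix 1 1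
  one : M 1 = affMatrix 1 (-1)
  three : M 3 = affMatrix a 0
  four : M 4 = affMatrix a⁻¹ 0
  cat : ∀ m < slpSize C.encode, ∀ x y, slpRhs C.encode m = .cat x y → M m = M x * M y

namespace IsEvaluation

variable {a : ℝ} {C : ArithCircuit} {M : ℕ → Matrix (Fin 2) (Fin 2) ℝ}

theorem two (hM : IsEvaluation a C M) : M 2 = affMatrix 1 0 := by
  have h5 := five_le_gateBase C.encode
  rw [hM.cat 2 (by rw [slpSize]; omega) 0 1 (by simp [slpRhs]), hM.zero, hM.one, affMatrix_mul]
  simp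

theorem table (hM : IsEvaluation a C M) {t : ℕ} (ht : t < tableSize C.encode) :
    M (3 + 2 * t) = affMatrix (a ^ 2 ^ t) 0 ∧ M (3 + 2 * t + 1) = affMatrix (a ^ 2 ^ t)⁻¹ 0 := by
  induction t with
  | zero => simpa using ⟨hM.three, hM.four⟩
  | succ t ih =>
    obtain ⟨h₁, h₂⟩ := ih (by omega)
    have hb : gateBase C.encode = 3 + 2 * tableSize C.encode := rfl
    have hs : gateBase C.encode ≤ slpSize C.encode := Nat.le_add_right _ _
    rw [hM.cat (3 + 2 * (t + 1)) (by omega) _ _ (slpRhs_table (by omega) (by omega)),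
      hM.cat (3 + 2 * (t + 1) + 1) (by omega) _ _ (slpRhs_table (by omega) (by omega)),
      show 3 + 2 * (t + 1) - 2 = 3 + 2 * t by omega,
      show 3 + 2 * (t + 1) + 1 - 2 = 3 + 2 * t + 1 by omega, h₁, h₂, affMatrix_mul, affMatrix_mul]
    have : a ^ 2 ^ (t + 1) = a ^ 2 ^ t * a ^ 2 ^ t := by rw [← pow_add, pow_succ]; ring_nf
    rw [this, mul_inv]
    simp

/-- Conjugation by the powers of `g` that belong to an input gate, together with the choice of the
word that is conjugated, multiplies by the value of the input gate. -/
theorem conj (hM : IsEvaluation a C M) (ha : a ≠ 0) {x : Fin C.size} (hx : (C.rhs x).IsInput)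
    {p q : ℕ} {v : ℝ}
    (hp : M p = affMatrix 1 v) (hq : M q = affMatrix 1 (-v)) :
    M (powerRef false C.encode x) * (M (signedRef C.encode x p q) * M (powerRef true C.encode x)) =
      affMatrix 1 (realVal a C x * v) := by
  have hl := fun l => hasLabel_encode (C := C) l x
  rw [signedRef, hl, hl, hl, realVal]
  cases h : C.rhs x with
  | var k =>
    have hlt := powerRef_lt false C.encode x
    rw [powerRef_var h, gateBase] at hlt
    obtain ⟨h₁, h₂⟩ := hM.table (t := varExponent C k) (by simp at hlt; omega)
    rw [powerRef_var h, powerRef_var h, gateVal_var h,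
      if_pos (show (ArithRhs.var k).code.1 = ArithLabel.var ∨ _ from .inl rfl), hp]
    simp only [Bool.false_eq_true, if_false, if_true, add_zero, h₁, h₂, affMatrix_mul,
      MvPolynomial.aeval_X]
    congr 1
    · field_simp
    · ring
  | negOne =>
    rw [powerRef_const (by simp [h]), powerRef_const (by simp [h]),
      if_neg (by simp [ArithRhs.code]),
      if_pos (show ArithRhs.negOne.code.1 = ArithLabel.negOne from rfl), hM.two, hq,
      gateVal_negOne h, affMatrix_mul, affMatrix_mul]
    simp
  | zero =>
    rw [powerRef_const (by simp [h]), powerRef_const (by simp [h]),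
      if_neg (by simp [ArithRhs.code]),
      if_neg (by simp [ArithRhs.code]), hM.two, gateVal_zero h, affMatrix_mul, affMatrix_mul]
    simp
  | one =>
    rw [powerRef_const (by simp [h]), powerRef_const (by simp [h]), if_pos (.inr rfl),
      hM.two, hp, gateVal_one h, affMatrix_mul, affMatrix_mul]
    simp
  | add => simp [h, ArithRhs.IsInput] at hx
  | mul => simp [h, ArithRhs.IsInput] at hx

/-- The two words for a gate with value `v` represent `h ^ v` and `h ^ (-v)`. -/
theorem valueRef_eq (hM : IsEvaluation a C M) (ha : a ≠ 0) (hC : C.IsSkew) (A : Fin C.size)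
    (s : Bool) :
    M (valueRef s C.encode A) = affMatrix 1 (sign s * realVal a C A) := by
  induction A using C.wf.induction generalizing s with
  | _ A ih =>
  have hword : M (valueRef s C.encode A) =
      M (leftRef s C.encode A) * (M (midRef s C.encode A) * M (rightRef C.encode A)) := by
    obtain ⟨h₀, h₁, h₂, h₃⟩ := slpRhs_gate (w := C.encode) A
    have hsz := slpSize_encode C
    have hA := A.2
    rw [valueRef]
    cases s
    · simp only [Bool.false_eq_true, if_false]
      rw [hM.cat _ (by omega) _ _ h₁, hM.cat _ (by omega) _ _ h₀]
    · simp only [if_true]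
      rw [hM.cat _ (by omega) _ _ h₃, hM.cat _ (by omega) _ _ h₂]
  rw [hword]
  have hinput : (C.rhs A).IsInput →
      M (leftRef s C.encode A) * (M (midRef s C.encode A) * M (rightRef C.encode A)) =
        affMatrix 1 (sign s * realVal a C A) := by
    intro h
    obtain ⟨h₁, h₂, h₃⟩ := refs_input h s
    rw [h₁, h₂, h₃, hM.conj ha h (v := sign s), mul_comm]
    · cases s <;> simp [sign, hM.zero, hM.one]
    · cases s <;> simp [sign, hM.zero, hM.one]
  cases hA : C.rhs A with
  | add B D =>
    obtain ⟨h₁, h₂, h₃⟩ := refs_add hA s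
    rw [h₁, h₂, h₃, hM.two, ih B (by simp [hA, ArithRhs.gates]),
      ih D (by simp [hA, ArithRhs.gates]),
      affMatrix_mul, affMatrix_mul, realVal, realVal, realVal, gateVal_add hA, map_add]
    congr 1
    · ring
    · ring
  | mul B D =>
    obtain ⟨x, y, hx, hxy, h⟩ := refs_mul hA (hC _ _ _ hA)
    obtain ⟨h₁, h₂, h₃⟩ := h s
    have hy : y ∈ (C.rhs A).gates := by
      rcases hxy with ⟨-, rfl⟩ | ⟨-, rfl⟩ <;> simp [hA, ArithRhs.gates]
    have hsign : sign (!s) = -sign s := by cases s <;> simp [sign]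
    rw [h₁, h₂, h₃, hM.conj ha hx (ih y hy s) (by rw [ih y hy, hsign, neg_mul])]
    have hval : realVal a C A = realVal a C x * realVal a C y := by
      rw [realVal, realVal, realVal, gateVal_mul hA, map_mul]
      rcases hxy with ⟨rfl, rfl⟩ | ⟨rfl, rfl⟩
      · rfl
      · exact mul_comm _ _
    rw [hval]
    congr 1
    ring
  | _ => exact hinput (by rw [hA]; trivial)

end IsEvaluation

/-- The straight-line program for a skew circuit. -/
noncomputable def slp (C : ArithCircuit) (hC : C.IsSkew) : SLP (GaLetter × Bool) :=
  SLP.ofFun (slpSize C.encode) (valueRef false C.encode C.out) (valueRef_lt false C.out)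
    (slpRhs C.encode) (exists_slpRank hC).choose (exists_slpRank hC).choose_spec.1
    (exists_slpRank hC).choose_spec.2

theorem encode_slp (C : ArithCircuit) (hC : C.IsSkew) :
    (slp C hC).encode = circuitWord (valueRef false C.encode (blockVal C.encode 0))
      ((List.range (slpSize C.encode)).map fun m => (slpRhs C.encode m).natCode) := by
  rw [slp, SLP.encode_ofFun, blockVal_encode_zero]

theorem wordMatrix_slp (a : ℝ) (ha : 2 ≤ a) (C : ArithCircuit) (hC : C.IsSkew) :
    wordMatrix a ha (slp C hC).val = affMatrix 1 (realVal a C C.out) := by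
  have h5 := five_le_gateBase C.encode
  have hsz := slpSize_encode C
  have hM : IsEvaluation a C fun m => if h : m < slpSize C.encode then
      wordMatrix a ha ((slp C hC).gateVal ⟨m, h⟩) else 1 := by
    have hsym : ∀ m x, m < 5 → slpRhs C.encode m = .sym x →
        (if h : m < slpSize C.encode then wordMatrix a ha ((slp C hC).gateVal ⟨m, h⟩) else 1) =
          wordMatrix a ha [x] := by
      intro m x hm hx
      rw [dif_pos (by omega)]
      exact congrArg _ (SLP.gateVal_ofFun_sym (by omega) hx)
    refine ⟨?_, ?_, ?_, ?_, fun m hm x y hxy => ?_⟩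
    · rw [hsym 0 _ (by omega) (by simp [slpRhs]; rfl), wordMatrix_h]
    · rw [hsym 1 _ (by omega) (by simp [slpRhs]; rfl), wordMatrix_h_inv]
    · rw [hsym 3 _ (by omega) (by simp [slpRhs]; rfl), wordMatrix_g]
    · rw [hsym 4 _ (by omega) (by simp [slpRhs]; rfl), wordMatrix_g_inv]
    · have h := (exists_slpRank hC).choose_spec.2 m hm
      rw [hxy] at h
      have hx := (h x (by simp [SLPRhs.gates])).1
      have hy := (h y (by simp [SLPRhs.gates])).1
      rw [dif_pos hm, dif_pos hx, dif_pos hy, ← wordMatrix_append]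
      exact congrArg _ (SLP.gateVal_ofFun_cat hm hx hy hxy)
  have := hM.valueRef_eq (by linarith) hC C.out false
  rw [dif_pos (valueRef_lt false C.out)] at this
  rw [show sign false = 1 from rfl, one_mul] at this
  exact this

theorem evalWord_slp_eq_one_iff (a : ℝ) (ha : 2 ≤ a) (C : ArithCircuit) (hC : C.IsSkew) :
    evalWord (gaGen a ha) (slp C hC).val = 1 ↔ realVal a C C.out = 0 := by
  rw [← wordMatrix_eq_one_iff, wordMatrix_slp, ← affMatrix_one_zero]
  constructor
  · intro h
    simpa [affMatrix] using congrFun (congrFun h 0) 1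
  · intro h
    rw [h]

end CircuitWord

/-! ### Kronecker substitution -/

/-- A number whose digits in base `D` have distinct positions below `G` is smaller than `D ^ G`. -/
theorem sum_mul_pow_lt {ι : Type*} [DecidableEq ι] {D : ℕ} {g : ι → ℕ} {S : Finset ι} {u : ι → ℕ}
    (hg : Set.InjOn g S) (hu : ∀ k ∈ S, u k < D) {G : ℕ} (hG : ∀ k ∈ S, g k < G) (hD : 0 < D) :
    ∑ k ∈ S, u k * D ^ g k < D ^ G := by
  induction S using Finset.induction_on_max_value g generalizing G with
  | empty => simpa using Nat.pow_pos hD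
  | insert i S hi hmax ih =>
    rw [Finset.sum_insert hi]
    have hlt : ∀ k ∈ S, g k < g i := fun k hk => lt_of_le_of_ne (hmax k hk) fun h =>
      hi (hg (by simp [hk]) (by simp) h ▸ hk)
    have h := ih (hg.mono (by simp)) (fun k hk => hu k (by simp [hk])) hlt
    calc u i * D ^ g i + ∑ k ∈ S, u k * D ^ g k < (u i + 1) * D ^ g i := by rw [add_one_mul]; omega
      _ ≤ D * D ^ g i := Nat.mul_le_mul_right _ (hu i (by simp))
      _ = D ^ (g i + 1) := (pow_succ' _ _).symm
      _ ≤ D ^ G := Nat.pow_le_pow_right hD (hG i (by simp))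

/-- Uniqueness of digits, in a form in which the positions of the digits need not be consecutive. -/
theorem eq_of_sum_mul_pow_eq {ι : Type*} [DecidableEq ι] {D : ℕ} {g : ι → ℕ} {S : Finset ι}
    {u v : ι → ℕ} (hg : Set.InjOn g S) (hu : ∀ k ∈ S, u k < D) (hv : ∀ k ∈ S, v k < D)
    (hD : 0 < D) (h : ∑ k ∈ S, u k * D ^ g k = ∑ k ∈ S, v k * D ^ g k) : ∀ k ∈ S, u k = v k := by
  induction S using Finset.induction_on_max_value g with
  | empty => simp
  | insert i S hi hmax ih =>
    rw [Finset.sum_insert hi, Finset.sum_insert hi] at h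
    have hlt : ∀ k ∈ S, g k < g i := fun k hk => lt_of_le_of_ne (hmax k hk) fun h =>
      hi (hg (by simp [hk]) (by simp) h ▸ hk)
    have hg' : Set.InjOn g S := hg.mono (by simp)
    have hu' : ∀ k ∈ S, u k < D := fun k hk => hu k (by simp [hk])
    have hv' : ∀ k ∈ S, v k < D := fun k hk => hv k (by simp [hk])
    have h₁ := sum_mul_pow_lt hg' hu' hlt hD
    have h₂ := sum_mul_pow_lt hg' hv' hlt hD
    have hpos : 0 < D ^ g i := Nat.pow_pos hD
    have hi' : u i = v i := by
      have := congrArg (· / D ^ g i) h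
      simp only [add_comm (_ * D ^ g i), Nat.add_mul_div_right _ _ hpos, Nat.div_eq_of_lt h₁,
        Nat.div_eq_of_lt h₂, zero_add] at this
      exact this
    rw [hi'] at h
    intro k hk
    rcases Finset.mem_insert.1 hk with rfl | hk
    · exact hi'
    · exact ih hg' hu' hv' (Nat.add_left_cancel h) k hk

namespace MvPolynomial

/-- The sum of the absolute values of the coefficients. -/
def coeffNorm (p : MvPolynomial ℕ ℤ) : ℤ :=
  ∑ m ∈ p.support, |p.coeff m|

theorem coeffNorm_eq_sum {p : MvPolynomial ℕ ℤ} {S : Finset (ℕ →₀ ℕ)} (h : p.support ⊆ S) :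
    p.coeffNorm = ∑ m ∈ S, |p.coeff m| :=
  Finset.sum_subset h fun m _ hm => by simpa using hm

theorem coeffNorm_add_le (p q : MvPolynomial ℕ ℤ) :
    (p + q).coeffNorm ≤ p.coeffNorm + q.coeffNorm := by
  classical
  rw [coeffNorm_eq_sum support_add, coeffNorm_eq_sum (p := p) Finset.subset_union_left,
    coeffNorm_eq_sum (p := q) Finset.subset_union_right, ← Finset.sum_add_distrib]
  exact Finset.sum_le_sum fun m _ => by rw [coeff_add]; exact abs_add_le _ _

theorem coeffNorm_neg (p : MvPolynomial ℕ ℤ) : (-p).coeffNorm = p.coeffNorm := by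
  simp [coeffNorm, support_neg]

theorem coeffNorm_X_mul (k : ℕ) (p : MvPolynomial ℕ ℤ) : (X k * p).coeffNorm = p.coeffNorm := by
  rw [coeffNorm, coeffNorm, support_X_mul, Finset.sum_map]
  exact Finset.sum_congr rfl fun m _ => by simp [coeff_X_mul]

/-- A polynomial with coefficients that are small compared with the gaps between the exponents
`e m` does not vanish when its monomials `m` are replaced by the powers `a ^ e m`, because the
term with the largest exponent dominates the sum of all others. -/
theorem sum_coeff_mul_pow_ne_zero {p : MvPolynomial ℕ ℤ} (hp : p ≠ 0) {a : ℝ} (ha : 2 ≤ a) {N : ℕ}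
    (hnorm : p.coeffNorm ≤ 2 ^ N) {e : (ℕ →₀ ℕ) → ℕ} (he : Set.InjOn e p.support)
    (hN : ∀ m, N ∣ e m) : ∑ m ∈ p.support, ((p.coeff m : ℤ) : ℝ) * a ^ e m ≠ 0 := by
  classical
  obtain ⟨m₀, hm₀, hmax⟩ := Finset.exists_max_image p.support e (support_nonempty.2 hp)
  have ha0 : (0 : ℝ) < a := by linarith
  have hgap : ∀ m ∈ p.support.erase m₀, a ^ e m * a ^ N ≤ a ^ e m₀ := by
    intro m hm
    obtain ⟨hne, hm⟩ := Finset.mem_erase.1 hm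
    have hlt : e m < e m₀ := lt_of_le_of_ne (hmax m hm) fun h => hne (he hm hm₀ h)
    obtain ⟨c, hc⟩ := hN m
    obtain ⟨d, hd⟩ := hN m₀
    have hcd : c + 1 ≤ d := by
      rw [hc, hd] at hlt
      exact Nat.lt_of_mul_lt_mul_left hlt
    rw [← pow_add]
    refine pow_le_pow_right₀ (by linarith) ?_
    rw [hc, hd]
    exact (Nat.mul_succ N c).symm ▸ Nat.mul_le_mul_left N hcd
  have hc₀ : (1 : ℝ) ≤ |((p.coeff m₀ : ℤ) : ℝ)| := by
    exact_mod_cast Int.one_le_abs (mem_support_iff.1 hm₀)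
  have hrest : |∑ m ∈ p.support.erase m₀, ((p.coeff m : ℤ) : ℝ) * a ^ e m| * a ^ N ≤
      (∑ m ∈ p.support.erase m₀, |((p.coeff m : ℤ) : ℝ)|) * a ^ e m₀ := by
    calc _ ≤ (∑ m ∈ p.support.erase m₀, |((p.coeff m : ℤ) : ℝ) * a ^ e m|) * a ^ N := by
          gcongr
          exact Finset.abs_sum_le_sum_abs _ _
      _ = ∑ m ∈ p.support.erase m₀, |((p.coeff m : ℤ) : ℝ)| * (a ^ e m * a ^ N) := by
          rw [Finset.sum_mul]
          exact Finset.sum_congr rfl fun m _ => by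
            rw [abs_mul, abs_of_pos (pow_pos ha0 (e m)), mul_assoc]
      _ ≤ ∑ m ∈ p.support.erase m₀, |((p.coeff m : ℤ) : ℝ)| * a ^ e m₀ :=
          Finset.sum_le_sum fun m hm => by gcongr; exact hgap m hm
      _ = _ := by rw [Finset.sum_mul]
  have hsmall : (∑ m ∈ p.support.erase m₀, |((p.coeff m : ℤ) : ℝ)|) < a ^ N := by
    have h : (p.coeffNorm : ℝ) ≤ 2 ^ N := by exact_mod_cast hnorm
    rw [coeffNorm, ← Finset.add_sum_erase _ _ hm₀] at h
    push_cast at h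
    have : (2 : ℝ) ^ N ≤ a ^ N := by gcongr
    linarith
  -- multiplied by `a ^ N`, the term of `m₀` would be both at least and less than `a ^ N * a ^ e m₀`
  intro h0
  rw [← Finset.add_sum_erase _ _ hm₀] at h0
  rw [← neg_eq_of_add_eq_zero_right h0, abs_neg, abs_mul, abs_of_pos (pow_pos ha0 (e m₀))] at hrest
  have hpos := pow_pos ha0 (e m₀)
  have hposN := pow_pos ha0 N
  have h₁ := mul_lt_mul_of_pos_right hsmall hpos
  have h₂ : 1 * a ^ e m₀ * a ^ N ≤ |((p.coeff m₀ : ℤ) : ℝ)| * a ^ e m₀ * a ^ N := by gcongr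
  linarith [mul_comm (a ^ N) (a ^ e m₀)]

end MvPolynomial

namespace CircuitWord

open MvPolynomial

variable {C : ArithCircuit}

/-- In a skew circuit, one of the factors of each product is a variable, `0`, `1` or `-1`; hence
coefficients at most double and degrees grow by at most one from gate to gate. -/
theorem gateVal_bounds (hC : C.IsSkew) {rk : Fin C.size → ℕ}
    (hrk : ∀ A, ∀ B ∈ (C.rhs A).gates, rk B < rk A) (A : Fin C.size) :
    (C.gateVal ℤ A).coeffNorm ≤ 2 ^ rk A ∧ ∀ m ∈ (C.gateVal ℤ A).support, ∀ k, m k ≠ 0 →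
      m k ≤ rk A + 1 ∧ ∃ B, C.rhs B = .var k := by
  classical
  induction A using C.wf.induction with
  | _ A ih =>
  have hone : (1 : MvPolynomial ℕ ℤ).coeffNorm = 1 := by
    simp [coeffNorm]
  have hle : (1 : ℤ) ≤ 2 ^ rk A := one_le_pow₀ (by norm_num)
  cases hA : C.rhs A with
  | var i =>
    rw [gateVal_var hA]
    constructor
    · rw [← mul_one (X i), coeffNorm_X_mul, hone]
      exact hle
    · intro m hm k hk
      rw [support_X, Finset.mem_singleton] at hm
      subst hm
      obtain rfl : i = k := by
        by_contra h
        exact hk (Finsupp.single_eq_of_ne' h)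
      exact ⟨by simp, A, hA⟩
  | negOne =>
    rw [gateVal_negOne hA, coeffNorm_neg, hone, support_neg]
    exact ⟨hle, by simp +contextual⟩
  | zero => simp [gateVal_zero hA, coeffNorm]
  | one =>
    rw [gateVal_one hA, hone]
    exact ⟨hle, by simp +contextual⟩
  | add B D =>
    have hB := hrk A B (by simp [hA, ArithRhs.gates])
    have hD := hrk A D (by simp [hA, ArithRhs.gates])
    obtain ⟨hB₁, hB₂⟩ := ih B (by simp [hA, ArithRhs.gates])
    obtain ⟨hD₁, hD₂⟩ := ih D (by simp [hA, ArithRhs.gates])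
    rw [gateVal_add hA]
    constructor
    · have h₁ : (2 : ℤ) ^ rk B ≤ 2 ^ (rk A - 1) := pow_le_pow_right₀ (by norm_num) (by omega)
      have h₂ : (2 : ℤ) ^ rk D ≤ 2 ^ (rk A - 1) := pow_le_pow_right₀ (by norm_num) (by omega)
      have h₃ : (2 : ℤ) ^ rk A = 2 * 2 ^ (rk A - 1) := by
        rw [← pow_succ']; congr 1; omega
      linarith [coeffNorm_add_le (C.gateVal ℤ B) (C.gateVal ℤ D)]
    · intro m hm k hk
      rcases Finset.mem_union.1 (support_add hm) with h | h
      · exact ⟨(hB₂ m h k hk).1.trans (by omega), (hB₂ m h k hk).2⟩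
      · exact ⟨(hD₂ m h k hk).1.trans (by omega), (hD₂ m h k hk).2⟩
  | mul B D =>
    obtain ⟨x, y, hx, hy, hval⟩ : ∃ x y, (C.rhs x).IsInput ∧ y ∈ (C.rhs A).gates ∧
        C.gateVal ℤ A = C.gateVal ℤ x * C.gateVal ℤ y := by
      rcases hC _ _ _ hA with h | h
      · exact ⟨B, D, h, by simp [hA, ArithRhs.gates], gateVal_mul hA⟩
      · exact ⟨D, B, h, by simp [hA, ArithRhs.gates], by rw [gateVal_mul hA, mul_comm]⟩
    have hlt := hrk A y hy
    obtain ⟨hy₁, hy₂⟩ := ih y hy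
    have hpow : (2 : ℤ) ^ rk y ≤ 2 ^ rk A := pow_le_pow_right₀ (by norm_num) hlt.le
    have hy₃ : ∀ m ∈ (C.gateVal ℤ y).support, ∀ k, m k ≠ 0 →
        m k ≤ rk A + 1 ∧ ∃ B, C.rhs B = .var k := fun m hm k hk =>
      ⟨(hy₂ m hm k hk).1.trans (by omega), (hy₂ m hm k hk).2⟩
    rw [hval]
    cases h : C.rhs x with
    | var i =>
      rw [gateVal_var h]
      refine ⟨by rw [coeffNorm_X_mul]; exact hy₁.trans hpow, fun m hm k hk => ?_⟩
      rw [support_X_mul, Finset.mem_map] at hm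
      obtain ⟨m', hm', rfl⟩ := hm
      by_cases hik : i = k
      · subst hik
        refine ⟨?_, x, h⟩
        have : m' i ≤ rk y + 1 := by
          by_cases h0 : m' i = 0
          · omega
          · exact (hy₂ m' hm' i h0).1
        simp
        omega
      · have hk' : (Finsupp.single i 1 + m' : ℕ →₀ ℕ) k = m' k := by
          rw [Finsupp.add_apply, Finsupp.single_eq_of_ne' hik, zero_add]
        simp only [addLeftEmbedding_apply, hk'] at hk ⊢
        exact hy₃ m' hm' k hk
    | negOne =>
      rw [gateVal_negOne h, neg_one_mul, coeffNorm_neg, support_neg]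
      exact ⟨hy₁.trans hpow, hy₃⟩
    | zero =>
      rw [gateVal_zero h, zero_mul]
      exact ⟨by simp [coeffNorm], by simp⟩
    | one =>
      rw [gateVal_one h, one_mul]
      exact ⟨hy₁.trans hpow, hy₃⟩
    | add => simp [h, ArithRhs.IsInput] at hx
    | mul => simp [h, ArithRhs.IsInput] at hx

/-- The exponent of `a` that replaces a monomial. -/
noncomputable def monomialExponent (C : ArithCircuit) (m : ℕ →₀ ℕ) : ℕ :=
  ∑ k ∈ m.support, m k * 2 ^ varExponent C k

theorem realVal_eq_sum (a : ℝ) (A : Fin C.size) :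
    realVal a C A = ∑ m ∈ (C.gateVal ℤ A).support,
      (((C.gateVal ℤ A).coeff m : ℤ) : ℝ) * a ^ monomialExponent C m := by
  rw [realVal, aeval_def, eval₂_eq]
  refine Finset.sum_congr rfl fun m _ => ?_
  rw [monomialExponent, ← Finset.prod_pow_eq_pow_sum]
  congr 1
  exact Finset.prod_congr rfl fun k _ => by rw [← pow_mul, mul_comm]

theorem dvd_monomialExponent (m : ℕ →₀ ℕ) : 2 ^ (C.size + 1) ∣ monomialExponent C m :=
  Finset.dvd_sum fun k _ => Dvd.dvd.mul_left (pow_dvd_pow 2 (Nat.le_mul_of_pos_right _ (by simp))) _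

/-- The exponents in a monomial are the digits of `monomialExponent` in base `2 ^ (C.size + 1)`. -/
theorem eq_of_monomialExponent_eq {m m' : ℕ →₀ ℕ}
    (hm : ∀ k, m k ≠ 0 → m k ≤ C.size ∧ ∃ B, C.rhs B = .var k)
    (hm' : ∀ k, m' k ≠ 0 → m' k ≤ C.size ∧ ∃ B, C.rhs B = .var k)
    (h : monomialExponent C m = monomialExponent C m') : m = m' := by
  classical
  have hvar : ∀ k ∈ m.support ∪ m'.support, ∃ B, C.rhs B = .var k := by
    intro k hk
    rcases Finset.mem_union.1 hk with hk | hk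
    · exact (hm k (Finsupp.mem_support_iff.1 hk)).2
    · exact (hm' k (Finsupp.mem_support_iff.1 hk)).2
  have hinj : Set.InjOn (fun k => C.varGate k + 1) (m.support ∪ m'.support : Finset ℕ) := by
    intro k hk l hl hkl
    obtain ⟨B, hB⟩ := hvar k hk
    obtain ⟨D, hD⟩ := hvar l hl
    obtain ⟨h₁, h₂⟩ := C.varGate_spec hB
    obtain ⟨h₃, h₄⟩ := C.varGate_spec hD
    have : C.varGate k = C.varGate l := Nat.succ_injective hkl
    simp only [this] at h₂
    simpa using h₂.symm.trans h₄
  have hlt : ∀ {u : ℕ →₀ ℕ}, (∀ k, u k ≠ 0 → u k ≤ C.size ∧ ∃ B, C.rhs B = .var k) →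
      ∀ k, u k < 2 ^ (C.size + 1) := by
    intro u hu k
    have : C.size + 1 < 2 ^ (C.size + 1) := Nat.lt_two_pow_self
    by_cases h0 : u k = 0
    · omega
    · have := (hu k h0).1
      omega
  have hsum : ∀ u : ℕ →₀ ℕ, u.support ⊆ m.support ∪ m'.support → monomialExponent C u =
      ∑ k ∈ m.support ∪ m'.support, u k * (2 ^ (C.size + 1)) ^ (C.varGate k + 1) := by
    intro u hu
    rw [monomialExponent]
    simp only [varExponent, pow_mul]
    exact Finset.sum_subset hu fun k _ hk => by simp [Finsupp.notMem_support_iff.1 hk]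
  rw [hsum m Finset.subset_union_left, hsum m' Finset.subset_union_right] at h
  have heq := eq_of_sum_mul_pow_eq hinj (fun k _ => hlt hm k) (fun k _ => hlt hm' k)
    (by positivity) h
  ext k
  by_cases hk : k ∈ m.support ∪ m'.support
  · exact heq k hk
  · simp only [Finset.mem_union, Finsupp.mem_support_iff, not_or, not_not] at hk
    rw [hk.1, hk.2]

theorem realVal_eq_zero_iff {a : ℝ} (ha : 2 ≤ a) (hC : C.IsSkew) (A : Fin C.size) :
    realVal a C A = 0 ↔ C.gateVal ℤ A = 0 := by
  constructor
  · obtain ⟨rk, -, hsize, hrk⟩ := C.exists_rank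
    obtain ⟨hnorm, hsupp⟩ := gateVal_bounds hC hrk A
    have hsupp' : ∀ m ∈ (C.gateVal ℤ A).support, ∀ k, m k ≠ 0 →
        m k ≤ C.size ∧ ∃ B, C.rhs B = .var k := fun m hm k hk =>
      ⟨(hsupp m hm k hk).1.trans (hsize A), (hsupp m hm k hk).2⟩
    contrapose
    intro h
    rw [realVal_eq_sum]
    refine sum_coeff_mul_pow_ne_zero h ha (N := 2 ^ (C.size + 1)) (hnorm.trans ?_) ?_
      dvd_monomialExponent
    · refine pow_le_pow_right₀ (by norm_num) ?_
      have : C.size + 1 < 2 ^ (C.size + 1) := Nat.lt_two_pow_self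
      have := hsize A
      omega
    · exact fun m hm m' hm' h => eq_of_monomialExponent_eq (hsupp' m hm) (hsupp' m' hm') h
  · intro h
    rw [realVal, h, map_zero]

end CircuitWord

theorem mainTheorem4 (a : ℝ) (ha : 2 ≤ a) :
    LogspaceReducible (skewPIT ℤ) (compressedWordProblem (gaGen a ha) (gaGen_generates a ha)) := by
  refine ⟨fun C => CircuitWord.slp C.1 C.2,
    LogspaceOutput.logspaceComputable CircuitWord.logspaceOutput_slp
      fun C => CircuitWord.encode_slp C.1 C.2, fun C => ?_⟩
  exact ((CircuitWord.evalWord_slp_eq_one_iff a ha C.1 C.2).trans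
    (CircuitWord.realVal_eq_zero_iff ha C.2 C.1.out)).symm
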